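/- For $\alpha\in\,]0,1[$ and $z\in\mathbf C\setminus]-\infty,0]$ let $$G_\alpha(z)=\frac{1}{2i\pi}\int_0^\infty \frac{e^{-e^{-i\pi\alpha}y^\alpha z^{1-\alpha}}-e^{-e^{i\pi\alpha}y^\alpha z^{1-\alpha}}}{z}\,e^{-y}\,dy ,$$ where all powers of $z$ and all logarithms are principal, and for $r>0$ let $G_\alpha(-r^+)=\lim_{z\to-r,\ \Im z>0}G_\alpha(z)$. **Theorem.** Let $\alpha\in\,]1/3,1/2]$. For every $r>0$ the limit $G_\alpha(-r^+)$ exists, and it has a polar decomposition $G_\alpha(-r^+)=R(r)e^{-i\pi\theta(r)}$ with $R(r)>0$ and $\theta(r)\in\,]0,1[$. The function $\theta$ is differentiable and nondecreasing on $]0,+\infty[$, strictly increasing if $\alpha<1/2$, with $\theta(r)\to\alpha$ as $r\to0^+$ and $\theta(r)\to 1/2$ as $r\to+\infty$. Moreover, for every $z\in\mathbf C\setminus]-\infty,0]$ the integral below converges absolutely and $$G_\alpha(z)=c_\alpha\,e^{-\delta z}z^{-1/2}\exp\left(-\int_0^\infty \log\left(1+\frac tz\right)\theta'(t)\,dt\right),$$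 where $$\delta=(1-\alpha)\,\alpha^{\frac{\alpha}{1-\alpha}},\qquad c_\alpha=\frac{\alpha^{\frac{1}{2(1-\alpha)}}}{\sqrt{2\pi(1-\alpha)}} .$$ -/

import Mathlib

open Set Filter Topology MeasureTheory

/-- The function `G_α` attached to the positive `α`-stable law, given by its integral formula;
powers are principal, i.e. positive on the positive axis and analytic off `(-∞, 0]`. -/
noncomputable def stableG (α : ℝ) (z : ℂ) : ℂ :=
  (2 * Complex.I * (Real.pi : ℂ))⁻¹ *
    ∫ y in Ioi (0 : ℝ),
      (Complex.exp (-(Complex.exp (-(Complex.I * Real.pi * α)) *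
            ((y ^ α : ℝ) : ℂ) * z ^ ((1 - α : ℝ) : ℂ))) -
          Complex.exp (-(Complex.exp (Complex.I * Real.pi * α) *
            ((y ^ α : ℝ) : ℂ) * z ^ ((1 - α : ℝ) : ℂ)))) / z *
        Complex.exp (-(y : ℂ))

/-- The boundary value `G_α(-r^+)`: the limit of `G_α(z)` as `z → -r` with `Im z > 0`. -/
noncomputable def stableGUpper (α r : ℝ) : ℂ :=
  limUnder (𝓝[{z : ℂ | 0 < z.im}] (-(r : ℂ))) (stableG α)

/-- The function `θ`, determined by `G_α(-r^+) = R(r) exp(-iπθ(r))` with `R(r) > 0` and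
`-1 ≤ θ(r) < 1`. -/
noncomputable def stableTheta (α r : ℝ) : ℝ :=
  -Complex.arg (stableGUpper α r) / Real.pi

/-- The exponential rate `δ = (1 - α) α^(α / (1 - α))`. -/
noncomputable def stableDelta (α : ℝ) : ℝ :=
  (1 - α) * α ^ (α / (1 - α))

/-- The constant `α^(1 / (2 (1 - α))) / √(2π (1 - α))`. -/
noncomputable def stableConst (α : ℝ) : ℝ :=
  α ^ (1 / (2 * (1 - α))) / Real.sqrt (2 * Real.pi * (1 - α))

/-!
Write `S(ζ) = ∫ exp (-ζ y^α - y) dy` (`powLaplace`), an entire function of `ζ`. In the coordinate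
`ζ = log z` the function `G_α` becomes the entire function `stableExt`, a combination of two values
of `S`; at `z = -r` from above it equals `N(r^(1-α)) / (2πir)` with
`N(λ) = S(-λ) - S(-λ exp (-2πiα))` (`stableN`). As `α ∈ (1/3, 1/2]`, the second term has modulus at
most one while `S(-λ) > 1`, so `Re N > 0`; the polar decomposition, the formula
`θ = 1/2 - arg N / π`, and the limits and the smoothness of `θ` follow.

*Monotonicity of `θ`.* After turning the ray of integration, `S(-λ)` and `S(-λ exp (-2πiα))` are
integrals of the same entire form `exp (-r (e^ζ - e^{αζ})) e^ζ dζ` (`hankelForm`), and the contour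
of the second can be deformed to a curve on which the phase `e^ζ - e^{αζ}` is real (`levelCurve`).
Parametrised by the value of the phase, real and imaginary part of `N` become Laplace transforms of
the two components `n, p > 0` of a chord joining the curve to the real axis, up to a term that only
helps (`hankelExcess_div_lt`). The slope `p / n` is monotone (`chordIm_div_chordRe_anti`, the place
where `α > 1/3` is decisive), and the classical single-crossing argument for the kernel `exp (-r t)`
makes `Im N / Re N` strictly decreasing (`stableN_im_div_re_lt`). All this is for `α < 1/2`; for
`α = 1/2` the function `N` is real and `θ = 1/2` (`stableTheta_half`).

*Product formula.* Let `J` be the logarithmic potential of the density `θ'`, seen in the coordinate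
`ζ` (`logPotential`), and `K = G_α · exp (δ z) · z^(1/2) · exp J` (`stableQuotient`). On the closed
strip `-π ≤ Im ζ ≤ 0` it is continuous; it is real on `Im ζ = 0` by symmetry, and real on
`Im ζ = -π` since the jump of the argument inside `J` is tied to `θ` (`stableQuotient_lower`). The
decay of `G_α` at the sharp rate `exp (-δ x)` on the positive axis (again by a level curve,
`im_powLaplace_bound`) and in a sector around the cut (`exists_norm_stableExt_le_sector`) feeds a
Phragmén–Lindelöf argument giving `|K| ≤ A (1 + exp (Re ζ / 2))`; a second one for `exp (±iK)`
shows that `K` is real, hence constant. Laplace's method on the cut (`tendsto_norm_stableGUpper`)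
identifies the constant.
-/

/-! ### The Laplace transform of a power of an exponential variable -/

/-- The Laplace transform `S(ζ) = ∫₀^∞ exp (-ζ y^α - y) dy` of the image of the standard exponential
law under `y ↦ y^α`, as a function of a complex variable. -/
noncomputable def powLaplace (α : ℝ) (ζ : ℂ) : ℂ :=
  ∫ y in Ioi (0 : ℝ), Complex.exp (-(ζ * ((y ^ α : ℝ) : ℂ))) * Complex.exp (-(y : ℂ))

/-- The derivative of `powLaplace`, as an integral. -/
noncomputable def powLaplaceDeriv (α : ℝ) (ζ : ℂ) : ℂ :=
  ∫ y in Ioi (0 : ℝ), -((y ^ α : ℝ) : ℂ) *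
    (Complex.exp (-(ζ * ((y ^ α : ℝ) : ℂ))) * Complex.exp (-(y : ℂ)))

/-- Young's inequality; as `α ≤ 1/2`, it lets half of the exponential absorb `R y^α`. -/
lemma mul_rpow_le_of_le_half {α : ℝ} (h0 : 0 < α) (h1 : α ≤ 1 / 2) {R y : ℝ} (hR : 0 ≤ R)
    (hy : 0 ≤ y) : R * y ^ α ≤ R + R ^ 2 / 2 + y / 2 := by
  have h : y ^ α ≤ 1 + Real.sqrt y := by
    rcases le_total y 1 with h | h
    · have := Real.rpow_le_one hy h h0.le
      linarith [Real.sqrt_nonneg y]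
    · have := Real.rpow_le_rpow_of_exponent_le h h1
      rw [← Real.sqrt_eq_rpow] at this
      linarith
  have h2 := Real.sq_sqrt hy
  have h3 := mul_le_mul_of_nonneg_left h hR
  nlinarith [sq_nonneg (R - Real.sqrt y)]

lemma norm_powLaplace_integrand (α : ℝ) (ζ : ℂ) (y : ℝ) :
    ‖Complex.exp (-(ζ * ((y ^ α : ℝ) : ℂ))) * Complex.exp (-(y : ℂ))‖ =
      Real.exp (-(ζ.re * y ^ α) - y) := by
  rw [norm_mul, Complex.norm_exp, Complex.norm_exp, ← Real.exp_add]
  simp [sub_eq_add_neg]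

lemma norm_powLaplace_integrand_le {α : ℝ} (h0 : 0 < α) (h1 : α ≤ 1 / 2) {R : ℝ} (hR : 0 ≤ R)
    {ζ : ℂ} (hζ : ‖ζ‖ ≤ R) {y : ℝ} (hy : 0 ≤ y) :
    ‖Complex.exp (-(ζ * ((y ^ α : ℝ) : ℂ))) * Complex.exp (-(y : ℂ))‖ ≤
      Real.exp (R + R ^ 2 / 2) * Real.exp (-(1 / 2) * y) := by
  rw [norm_powLaplace_integrand, ← Real.exp_add, Real.exp_le_exp]
  have := mul_rpow_le_of_le_half h0 h1 hR hy
  have h2 : -ζ.re ≤ R := (neg_le_abs _).trans ((Complex.abs_re_le_norm ζ).trans hζ)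
  have h3 := mul_le_mul_of_nonneg_right h2 (Real.rpow_nonneg hy α)
  linarith

lemma norm_powLaplaceDeriv_integrand_le {α : ℝ} (h0 : 0 < α) (h1 : α ≤ 1 / 2) {R : ℝ} (hR : 0 ≤ R)
    {ζ : ℂ} (hζ : ‖ζ‖ ≤ R) {y : ℝ} (hy : 0 ≤ y) :
    ‖-((y ^ α : ℝ) : ℂ) *
        (Complex.exp (-(ζ * ((y ^ α : ℝ) : ℂ))) * Complex.exp (-(y : ℂ)))‖ ≤
      Real.exp ((R + 1) + (R + 1) ^ 2 / 2) * Real.exp (-(1 / 2) * y) := by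
  have hp := Real.rpow_nonneg hy α
  rw [norm_mul, norm_powLaplace_integrand, ← Real.exp_add, norm_neg, Complex.norm_real,
    Real.norm_of_nonneg hp]
  have := mul_rpow_le_of_le_half h0 h1 (by linarith : 0 ≤ R + 1) hy
  have h2 : -ζ.re ≤ R := (neg_le_abs _).trans ((Complex.abs_re_le_norm ζ).trans hζ)
  have h3 := mul_le_mul_of_nonneg_right h2 hp
  calc y ^ α * Real.exp (-(ζ.re * y ^ α) - y)
      ≤ Real.exp (y ^ α) * Real.exp (-(ζ.re * y ^ α) - y) := by
        gcongr; linarith [Real.add_one_le_exp (y ^ α)]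
    _ ≤ _ := by
        rw [← Real.exp_add, Real.exp_le_exp]; linarith

lemma integrableOn_exp_neg_half : IntegrableOn (fun y : ℝ => Real.exp (-(1 / 2) * y)) (Ioi 0) :=
  integrableOn_exp_mul_Ioi (by norm_num) 0

lemma integral_exp_neg_half : ∫ y in Ioi (0 : ℝ), Real.exp (-(1 / 2) * y) = 2 := by
  rw [integral_exp_mul_Ioi (by norm_num)]; norm_num

lemma measurable_powLaplace_integrand (α : ℝ) (ζ : ℂ) :
    Measurable fun y : ℝ => Complex.exp (-(ζ * ((y ^ α : ℝ) : ℂ))) * Complex.exp (-(y : ℂ)) := by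
  have : Measurable fun y : ℝ => y ^ α := measurable_id.pow_const α
  fun_prop

lemma measurable_powLaplaceDeriv_integrand (α : ℝ) (ζ : ℂ) :
    Measurable fun y : ℝ => -((y ^ α : ℝ) : ℂ) *
      (Complex.exp (-(ζ * ((y ^ α : ℝ) : ℂ))) * Complex.exp (-(y : ℂ))) := by
  have : Measurable fun y : ℝ => y ^ α := measurable_id.pow_const α
  fun_prop

lemma integrableOn_powLaplace {α : ℝ} (h0 : 0 < α) (h1 : α ≤ 1 / 2) (ζ : ℂ) :
    IntegrableOn (fun y : ℝ =>
      Complex.exp (-(ζ * ((y ^ α : ℝ) : ℂ))) * Complex.exp (-(y : ℂ))) (Ioi 0) := by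
  refine Integrable.mono' (integrableOn_exp_neg_half.const_mul (Real.exp (‖ζ‖ + ‖ζ‖ ^ 2 / 2)))
    (measurable_powLaplace_integrand α ζ).aestronglyMeasurable ?_
  filter_upwards [ae_restrict_mem measurableSet_Ioi] with y hy
  exact norm_powLaplace_integrand_le h0 h1 (norm_nonneg _) le_rfl (le_of_lt hy)

lemma norm_powLaplace_le {α : ℝ} (h0 : 0 < α) (h1 : α ≤ 1 / 2) {R : ℝ} (hR : 0 ≤ R)
    {ζ : ℂ} (hζ : ‖ζ‖ ≤ R) : ‖powLaplace α ζ‖ ≤ 2 * Real.exp (R + R ^ 2 / 2) := by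
  have := norm_integral_le_of_norm_le (μ := volume.restrict (Ioi (0:ℝ)))
    (integrableOn_exp_neg_half.const_mul (Real.exp (R + R ^ 2 / 2)))
    (f := fun y : ℝ => Complex.exp (-(ζ * ((y ^ α : ℝ) : ℂ))) * Complex.exp (-(y : ℂ)))
    (by
      filter_upwards [ae_restrict_mem measurableSet_Ioi] with y hy
      exact norm_powLaplace_integrand_le h0 h1 hR hζ (le_of_lt hy))
  rw [integral_const_mul, integral_exp_neg_half] at this
  rw [powLaplace]; linarith

lemma norm_powLaplaceDeriv_le {α : ℝ} (h0 : 0 < α) (h1 : α ≤ 1 / 2) {R : ℝ} (hR : 0 ≤ R)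
    {ζ : ℂ} (hζ : ‖ζ‖ ≤ R) :
    ‖powLaplaceDeriv α ζ‖ ≤ 2 * Real.exp ((R + 1) + (R + 1) ^ 2 / 2) := by
  have := norm_integral_le_of_norm_le (μ := volume.restrict (Ioi (0:ℝ)))
    (integrableOn_exp_neg_half.const_mul (Real.exp ((R + 1) + (R + 1) ^ 2 / 2)))
    (f := fun y : ℝ => -((y ^ α : ℝ) : ℂ) *
        (Complex.exp (-(ζ * ((y ^ α : ℝ) : ℂ))) * Complex.exp (-(y : ℂ))))
    (by
      filter_upwards [ae_restrict_mem measurableSet_Ioi] with y hy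
      exact norm_powLaplaceDeriv_integrand_le h0 h1 hR hζ (le_of_lt hy))
  rw [integral_const_mul, integral_exp_neg_half] at this
  rw [powLaplaceDeriv]; linarith

lemma hasDerivAt_powLaplace {α : ℝ} (h0 : 0 < α) (h1 : α ≤ 1 / 2) (ζ : ℂ) :
    HasDerivAt (powLaplace α) (powLaplaceDeriv α ζ) ζ := by
  have hball : Metric.ball ζ 1 ∈ 𝓝 ζ := Metric.ball_mem_nhds _ one_pos
  refine (hasDerivAt_integral_of_dominated_loc_of_deriv_le
    (F := fun (ζ : ℂ) (y : ℝ) =>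
      Complex.exp (-(ζ * ((y ^ α : ℝ) : ℂ))) * Complex.exp (-(y : ℂ)))
    (F' := fun (ζ : ℂ) (y : ℝ) => -((y ^ α : ℝ) : ℂ) *
      (Complex.exp (-(ζ * ((y ^ α : ℝ) : ℂ))) * Complex.exp (-(y : ℂ))))
    (bound := fun y => Real.exp (((‖ζ‖ + 1) + 1) + ((‖ζ‖ + 1) + 1) ^ 2 / 2) *
      Real.exp (-(1 / 2) * y)) hball ?_ (integrableOn_powLaplace h0 h1 ζ) ?_ ?_ ?_ ?_).2
  · exact Eventually.of_forall fun z => (measurable_powLaplace_integrand α z).aestronglyMeasurable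
  · exact (measurable_powLaplaceDeriv_integrand α ζ).aestronglyMeasurable
  · filter_upwards [ae_restrict_mem measurableSet_Ioi] with y hy z hz
    refine norm_powLaplaceDeriv_integrand_le h0 h1 (by positivity) ?_ (le_of_lt hy)
    have := norm_sub_norm_le z ζ
    rw [Metric.mem_ball, dist_eq_norm] at hz
    linarith
  · exact integrableOn_exp_neg_half.const_mul _
  · refine Eventually.of_forall fun y z _ => ?_
    have := (((hasDerivAt_id z).mul_const ((y ^ α : ℝ) : ℂ)).neg.cexp).mul_const
      (Complex.exp (-(y : ℂ)))
    refine this.congr_deriv ?_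
    simp; ring

lemma differentiable_powLaplace {α : ℝ} (h0 : 0 < α) (h1 : α ≤ 1 / 2) :
    Differentiable ℂ (powLaplace α) := fun ζ => (hasDerivAt_powLaplace h0 h1 ζ).differentiableAt

lemma deriv_powLaplace {α : ℝ} (h0 : 0 < α) (h1 : α ≤ 1 / 2) :
    deriv (powLaplace α) = powLaplaceDeriv α :=
  funext fun ζ => (hasDerivAt_powLaplace h0 h1 ζ).deriv

lemma continuous_powLaplaceDeriv {α : ℝ} (h0 : 0 < α) (h1 : α ≤ 1 / 2) :
    Continuous (powLaplaceDeriv α) := by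
  rw [← deriv_powLaplace h0 h1]
  exact ((differentiable_powLaplace h0 h1).contDiff (n := 1)).continuous_deriv le_rfl

lemma norm_powLaplace_le_one {α : ℝ} {ζ : ℂ} (hζ : 0 ≤ ζ.re) : ‖powLaplace α ζ‖ ≤ 1 := by
  have hi : IntegrableOn (fun y : ℝ => Real.exp (-1 * y)) (Ioi 0) :=
    integrableOn_exp_mul_Ioi (by norm_num) 0
  have := norm_integral_le_of_norm_le (μ := volume.restrict (Ioi (0:ℝ))) hi
    (f := fun y : ℝ => Complex.exp (-(ζ * ((y ^ α : ℝ) : ℂ))) * Complex.exp (-(y : ℂ)))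
    (by
      filter_upwards [ae_restrict_mem measurableSet_Ioi] with y hy
      rw [norm_powLaplace_integrand, Real.exp_le_exp]
      have := mul_nonneg hζ (Real.rpow_nonneg (le_of_lt hy) α)
      linarith)
  rw [integral_exp_mul_Ioi (by norm_num)] at this
  simpa [powLaplace] using this

/-- The moment `∫₀^∞ y^α e^{-y} dy = Γ(1 + α)`. -/
noncomputable def powMoment (α : ℝ) : ℝ := ∫ y in Ioi (0 : ℝ), y ^ α * Real.exp (-y)

lemma integrableOn_rpow_mul_exp_neg {a : ℝ} (ha : 0 < a) :
    IntegrableOn (fun y : ℝ => y ^ a * Real.exp (-y)) (Ioi 0) := by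
  have := Real.GammaIntegral_convergent (s := a + 1) (by linarith)
  simpa [mul_comm] using this

lemma powMoment_pos {a : ℝ} (ha : 0 < a) : 0 < powMoment a := by
  have h := Real.Gamma_eq_integral (s := a + 1) (by linarith)
  have h2 := Real.Gamma_pos_of_pos (s := a + 1) (by linarith)
  rw [h] at h2
  simpa [powMoment, mul_comm] using h2

lemma norm_powLaplaceDeriv_le_powMoment {α : ℝ} (h0 : 0 < α) {ζ : ℂ} (hζ : 0 ≤ ζ.re) :
    ‖powLaplaceDeriv α ζ‖ ≤ powMoment α := by
  refine norm_integral_le_of_norm_le (integrableOn_rpow_mul_exp_neg h0) ?_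
  filter_upwards [ae_restrict_mem measurableSet_Ioi] with y hy
  have hp := Real.rpow_nonneg (le_of_lt hy) α
  rw [norm_mul, norm_powLaplace_integrand, norm_neg, Complex.norm_real, Real.norm_of_nonneg hp]
  gcongr
  have := mul_nonneg hζ hp
  linarith

lemma powLaplaceDeriv_zero (α : ℝ) : powLaplaceDeriv α 0 = -(powMoment α : ℂ) := by
  rw [powLaplaceDeriv, powMoment, ← integral_complex_ofReal, ← integral_neg]
  congr 1; ext y; simp

lemma powLaplace_conj (α : ℝ) (ζ : ℂ) :
    powLaplace α (starRingEnd ℂ ζ) = starRingEnd ℂ (powLaplace α ζ) := by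
  rw [powLaplace, powLaplace, ← integral_conj]
  congr 1; ext y
  rw [map_mul, ← Complex.exp_conj, ← Complex.exp_conj]
  simp

/-- The values of `powLaplace` on the negative axis. -/
noncomputable def powLaplaceReal (α l : ℝ) : ℝ :=
  ∫ y in Ioi (0 : ℝ), Real.exp (l * y ^ α - y)

lemma powLaplace_neg_ofReal (α l : ℝ) : powLaplace α (-(l : ℂ)) = powLaplaceReal α l := by
  rw [powLaplace, powLaplaceReal, ← integral_complex_ofReal]
  congr 1; ext y
  rw [← Complex.exp_add]; push_cast; congr 1; ring

lemma powLaplaceDeriv_neg_ofReal (α l : ℝ) : powLaplaceDeriv α (-(l : ℂ)) =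
    -((∫ y in Ioi (0 : ℝ), y ^ α * Real.exp (l * y ^ α - y) : ℝ) : ℂ) := by
  rw [powLaplaceDeriv, ← integral_complex_ofReal, ← integral_neg]
  congr 1; ext y
  rw [← Complex.exp_add]; push_cast
  have : -(-(l:ℂ) * ((y ^ α : ℝ) : ℂ)) + -(y:ℂ) = l * ((y ^ α : ℝ) : ℂ) - y := by ring
  rw [this]; ring

lemma integrableOn_powLaplaceReal {α : ℝ} (h0 : 0 < α) (h1 : α ≤ 1 / 2) (l : ℝ) :
    IntegrableOn (fun y : ℝ => Real.exp (l * y ^ α - y)) (Ioi 0) := by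
  have := (integrableOn_powLaplace h0 h1 (-(l : ℂ))).norm
  refine this.congr (Eventually.of_forall fun y => ?_)
  simp only [norm_powLaplace_integrand]; simp

lemma one_add_le_powLaplaceReal {α : ℝ} (h0 : 0 < α) (h1 : α ≤ 1 / 2) (l : ℝ) :
    1 + l * powMoment α ≤ powLaplaceReal α l := by
  have hi : IntegrableOn (fun y : ℝ => Real.exp (-1 * y)) (Ioi 0) :=
    integrableOn_exp_mul_Ioi (by norm_num) 0
  have hj := (integrableOn_rpow_mul_exp_neg h0).const_mul l
  have h : 1 + l * powMoment α =
      ∫ y in Ioi (0 : ℝ), (Real.exp (-1 * y) + l * (y ^ α * Real.exp (-y))) := by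
    rw [integral_add hi hj, integral_exp_mul_Ioi (by norm_num), powMoment, integral_const_mul]
    simp
  rw [h, powLaplaceReal]
  refine integral_mono (hi.add hj) (integrableOn_powLaplaceReal h0 h1 l) fun y => ?_
  have := Real.add_one_le_exp (l * y ^ α)
  simp only [sub_eq_add_neg, Real.exp_add]
  have h3 := mul_le_mul_of_nonneg_right this (Real.exp_pos (-y)).le
  rw [neg_one_mul]; linarith

/-- `S(-l)` beats every power of `l`; the fifth suffices for the decay `O(1/r²)` of `θ'`. -/
lemma pow_five_le_powLaplaceReal {α : ℝ} (h0 : 0 < α) (h1 : α ≤ 1 / 2) {l : ℝ} (hl : 0 ≤ l) :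
    powMoment (5 * α) / 120 * l ^ 5 ≤ powLaplaceReal α l := by
  have hj := (integrableOn_rpow_mul_exp_neg (a := 5 * α) (by linarith)).const_mul (l ^ 5 / 120)
  have h : powMoment (5 * α) / 120 * l ^ 5 =
      ∫ y in Ioi (0 : ℝ), l ^ 5 / 120 * (y ^ (5 * α) * Real.exp (-y)) := by
    rw [powMoment, integral_const_mul]; ring
  rw [h, powLaplaceReal]
  refine setIntegral_mono_on hj (integrableOn_powLaplaceReal h0 h1 l) measurableSet_Ioi
    fun y hy => ?_
  have hy : 0 < y := hy
  have := Real.pow_div_factorial_le_exp (l * y ^ α) (by positivity) 5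
  have h5 : y ^ (5 * α) = (y ^ α) ^ 5 := by
    rw [← Real.rpow_natCast, ← Real.rpow_mul hy.le]; congr 1; push_cast; ring
  rw [h5]
  simp only [sub_eq_add_neg, Real.exp_add]
  have h3 := mul_le_mul_of_nonneg_right this (Real.exp_pos (-y)).le
  norm_num [Nat.factorial] at h3
  rw [mul_pow] at h3
  linarith

/-! ### The boundary function -/

lemma integral_rpow_mul_exp_le {α : ℝ} (h0 : 0 < α) (h1 : α ≤ 1 / 2) {l : ℝ} (hl : 1 ≤ l) :
    ∫ y in Ioi (0 : ℝ), y ^ α * Real.exp (l * y ^ α - y) ≤ 7 * l * powLaplaceReal α l := by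
  have hS := one_add_le_powLaplaceReal h0 h1 l
  have hm := powMoment_pos h0
  have hi := (integrableOn_powLaplaceReal h0 h1 l).const_mul (5 * l)
  have key : ∫ y in Ioi (0 : ℝ), y ^ α * Real.exp (l * y ^ α - y) ≤
      ∫ y in Ioi (0 : ℝ), (5 * l * Real.exp (l * y ^ α - y) + Real.exp (-(1 / 2) * y)) := by
    refine integral_mono_of_nonneg ?_ (hi.add integrableOn_exp_neg_half) ?_
    · filter_upwards [ae_restrict_mem measurableSet_Ioi] with y hy
      exact mul_nonneg (Real.rpow_nonneg (le_of_lt hy) _) (Real.exp_pos _).le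
    · filter_upwards [ae_restrict_mem measurableSet_Ioi] with y hy
      have hy : 0 < y := hy
      have hsq := Real.sq_sqrt hy.le
      have hs0 := Real.sqrt_nonneg y
      rcases lt_or_ge y (16 * l ^ 2) with h | h
      · have hs : Real.sqrt y ≤ 4 * l := by
          rw [Real.sqrt_le_left (by positivity)]; nlinarith
        have : y ^ α ≤ 5 * l := by
          rcases le_total y 1 with h' | h'
          · have := Real.rpow_le_one hy.le h' h0.le
            linarith
          · have := Real.rpow_le_rpow_of_exponent_le h' h1
            rw [← Real.sqrt_eq_rpow] at this
            linarith
        have h2 := mul_le_mul_of_nonneg_right this (Real.exp_pos (l * y ^ α - y)).le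
        have := Real.exp_pos (-(1 / 2) * y)
        linarith
      · have h' : 1 ≤ y := by nlinarith
        have hr := Real.rpow_le_rpow_of_exponent_le h' h1
        rw [← Real.sqrt_eq_rpow] at hr
        have hs : 4 * l ≤ Real.sqrt y := Real.le_sqrt_of_sq_le (by nlinarith)
        have hls : l * Real.sqrt y ≤ y / 4 := by nlinarith
        have hly : l * y ^ α ≤ y / 4 := by nlinarith
        have hyα : y ^ α ≤ y / 4 := by nlinarith
        have : y ^ α * Real.exp (l * y ^ α - y) ≤ Real.exp (-(1 / 2) * y) := by
          calc y ^ α * Real.exp (l * y ^ α - y)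
              ≤ Real.exp (y ^ α) * Real.exp (l * y ^ α - y) := by
                gcongr; linarith [Real.add_one_le_exp (y ^ α)]
            _ ≤ _ := by rw [← Real.exp_add, Real.exp_le_exp]; linarith
        have := Real.exp_pos (l * y ^ α - y)
        have : 0 ≤ 5 * l * Real.exp (l * y ^ α - y) := by positivity
        linarith
  have h2 : ∫ y in Ioi (0 : ℝ), (5 * l * Real.exp (l * y ^ α - y) + Real.exp (-(1 / 2) * y)) =
      5 * l * powLaplaceReal α l + 2 := by
    rw [integral_add hi integrableOn_exp_neg_half, integral_const_mul, integral_exp_neg_half,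
      powLaplaceReal]
  rw [h2] at key
  have : 1 ≤ powLaplaceReal α l := by nlinarith
  nlinarith

/-- The unit complex number `exp (-2πiα)`. -/
noncomputable def stableRot (α : ℝ) : ℂ := Complex.exp (((-(2 * Real.pi * α) : ℝ) : ℂ) * Complex.I)

/-- The function `N(λ) = S(-λ) - S(-λ exp (-2πiα))`; at `λ = r^(1-α)` it is `2πir` times the
boundary value of `stableG α` at `-r`. -/
noncomputable def stableN (α : ℝ) (l : ℂ) : ℂ :=
  powLaplace α (-l) - powLaplace α (-(l * stableRot α))

/-- The derivative of `stableN`. -/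
noncomputable def stableNDeriv (α : ℝ) (l : ℂ) : ℂ :=
  -powLaplaceDeriv α (-l) + stableRot α * powLaplaceDeriv α (-(l * stableRot α))

lemma norm_stableRot (α : ℝ) : ‖stableRot α‖ = 1 := Complex.norm_exp_ofReal_mul_I _

lemma stableRot_re (α : ℝ) : (stableRot α).re = Real.cos (2 * Real.pi * α) := by
  rw [stableRot, Complex.exp_ofReal_mul_I_re, Real.cos_neg]

lemma stableRot_re_nonpos {α : ℝ} (h0 : 1 / 3 < α) (h1 : α ≤ 1 / 2) : (stableRot α).re ≤ 0 := by
  rw [stableRot_re]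
  apply Real.cos_nonpos_of_pi_div_two_le_of_le <;> nlinarith [Real.pi_pos]

lemma hasDerivAt_stableN {α : ℝ} (h0 : 0 < α) (h1 : α ≤ 1 / 2) (l : ℂ) :
    HasDerivAt (stableN α) (stableNDeriv α l) l := by
  have e1 := (hasDerivAt_powLaplace h0 h1 (-l)).comp l (hasDerivAt_neg l)
  have e2 := (hasDerivAt_powLaplace h0 h1 (-(l * stableRot α))).comp l
    ((hasDerivAt_id l).mul_const (stableRot α)).neg
  refine (e1.sub e2).congr_deriv ?_
  simp only [stableNDeriv]; ring

lemma continuous_stableNDeriv {α : ℝ} (h0 : 0 < α) (h1 : α ≤ 1 / 2) :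
    Continuous (stableNDeriv α) := by
  have := continuous_powLaplaceDeriv h0 h1
  unfold stableNDeriv; fun_prop

lemma continuous_stableN {α : ℝ} (h0 : 0 < α) (h1 : α ≤ 1 / 2) :
    Continuous (stableN α) :=
  continuous_iff_continuousAt.2 fun l => (hasDerivAt_stableN h0 h1 l).continuousAt

section
variable {α : ℝ}

lemma re_neg_mul_stableRot (h0 : 1 / 3 < α) (h1 : α ≤ 1 / 2) {l : ℝ} (hl : 0 ≤ l) :
    0 ≤ (-((l : ℂ) * stableRot α)).re := by
  have := mul_nonpos_of_nonneg_of_nonpos hl (stableRot_re_nonpos h0 h1)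
  simpa using this

/-- The second term of `N` has modulus at most one, because `cos (2πα) ≤ 0` puts its argument in the
right half plane. -/
lemma stableN_re_ge (h0 : 1 / 3 < α) (h1 : α ≤ 1 / 2) {l : ℝ} (hl : 0 ≤ l) :
    powLaplaceReal α l - 1 ≤ (stableN α l).re := by
  have h := norm_powLaplace_le_one (α := α) (re_neg_mul_stableRot h0 h1 hl)
  have h2 := (Complex.re_le_norm _).trans h
  rw [stableN, powLaplace_neg_ofReal, Complex.sub_re, Complex.ofReal_re]
  linarith

lemma stableN_re_pos (h0 : 1 / 3 < α) (h1 : α ≤ 1 / 2) {l : ℝ} (hl : 0 < l) :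
    0 < (stableN α l).re := by
  have := stableN_re_ge h0 h1 hl.le
  have h2 := one_add_le_powLaplaceReal (by linarith : 0 < α) h1 l
  have := mul_pos hl (powMoment_pos (by linarith : 0 < α))
  linarith

lemma abs_stableN_im_le (h0 : 1 / 3 < α) (h1 : α ≤ 1 / 2) {l : ℝ} (hl : 0 ≤ l) :
    |(stableN α l).im| ≤ 1 := by
  have h := norm_powLaplace_le_one (α := α) (re_neg_mul_stableRot h0 h1 hl)
  have h2 := (Complex.abs_im_le_norm _).trans h
  rw [stableN, powLaplace_neg_ofReal, Complex.sub_im, Complex.ofReal_im]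
  simpa using h2

lemma abs_stableNDeriv_im_le (h0 : 1 / 3 < α) (h1 : α ≤ 1 / 2) {l : ℝ} (hl : 0 ≤ l) :
    |(stableNDeriv α l).im| ≤ powMoment α := by
  have h := norm_powLaplaceDeriv_le_powMoment (by linarith : 0 < α)
    (re_neg_mul_stableRot h0 h1 hl)
  have h2 : ‖stableRot α * powLaplaceDeriv α (-(l * stableRot α))‖ ≤ powMoment α := by
    rw [norm_mul, norm_stableRot, one_mul]; exact h
  have h2 := (Complex.abs_im_le_norm _).trans h2
  rw [stableNDeriv, powLaplaceDeriv_neg_ofReal, neg_neg, Complex.add_im, Complex.ofReal_im]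
  simpa using h2

lemma abs_stableNDeriv_re_le (h0 : 1 / 3 < α) (h1 : α ≤ 1 / 2) {l : ℝ} (hl : 1 ≤ l) :
    |(stableNDeriv α l).re| ≤ 7 * l * powLaplaceReal α l + powMoment α := by
  have h := norm_powLaplaceDeriv_le_powMoment (by linarith : 0 < α)
    (re_neg_mul_stableRot h0 h1 (by linarith : 0 ≤ l))
  have h2 : ‖stableRot α * powLaplaceDeriv α (-(l * stableRot α))‖ ≤ powMoment α := by
    rw [norm_mul, norm_stableRot, one_mul]; exact h
  have h2 := (Complex.abs_re_le_norm _).trans h2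
  have h3 := integral_rpow_mul_exp_le (by linarith : 0 < α) h1 hl
  have h4 : 0 ≤ ∫ y in Ioi (0 : ℝ), y ^ α * Real.exp (l * y ^ α - y) :=
    setIntegral_nonneg measurableSet_Ioi fun y hy =>
      mul_nonneg (Real.rpow_nonneg (le_of_lt hy) _) (Real.exp_pos _).le
  rw [stableNDeriv, powLaplaceDeriv_neg_ofReal, neg_neg, Complex.add_re, Complex.ofReal_re]
  refine (abs_add_le _ _).trans ?_
  rw [abs_of_nonneg h4]
  linarith

/-- Cancellation in `Im (N'/N)`: as `Im N` and `Im N'` stay bounded, it decays faster than any power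
of `λ`. -/
lemma exists_abs_im_stableNDeriv_div_le (h0 : 1 / 3 < α) (h1 : α ≤ 1 / 2) :
    ∃ C, 0 ≤ C ∧ ∀ l : ℝ, 1 ≤ l → l ^ 3 * |(stableNDeriv α l / stableN α l).im| ≤ C := by
  set m := powMoment α with hm_def
  have hm : 0 < m := powMoment_pos (by linarith)
  set c := powMoment (5 * α) / 120 with hc_def
  have hc : 0 < c := div_pos (powMoment_pos (by linarith)) (by norm_num)
  set q := m / (1 + m) with hq_def
  have hq : 0 < q := by positivity
  refine ⟨m / (q * c) + (7 + m) / (q ^ 2 * c), by positivity, fun l hl => ?_⟩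
  have hl0 : 0 < l := by linarith
  set s := powLaplaceReal α l
  have hs1 : 1 + l * m ≤ s := one_add_le_powLaplaceReal (by linarith) h1 l
  have hs5 : c * l ^ 5 ≤ s := pow_five_le_powLaplaceReal (by linarith) h1 hl0.le
  have hsm : 1 + m ≤ s := by nlinarith
  have hs0 : 0 < s := by linarith
  have hqs : q * s ≤ s - 1 := by
    rw [hq_def, div_mul_eq_mul_div, div_le_iff₀ (by linarith)]; nlinarith
  have hre := stableN_re_ge h0 h1 hl0.le
  have him := abs_stableN_im_le h0 h1 hl0.le
  have hdi := abs_stableNDeriv_im_le h0 h1 hl0.le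
  have hdr := abs_stableNDeriv_re_le h0 h1 hl
  set N := stableN α l
  set D := stableNDeriv α l
  have hqs0 : 0 < q * s := by positivity
  have hNn : q * s ≤ ‖N‖ := by linarith [Complex.re_le_norm N]
  have hN2 : Complex.normSq N = ‖N‖ ^ 2 := Complex.normSq_eq_norm_sq N
  have hN0 : 0 < ‖N‖ := by linarith
  -- each product pairs a bounded imaginary part with a real part of size `O(l ‖N‖)`
  have e : (D / N).im = D.im * N.re / ‖N‖ ^ 2 - D.re * N.im / ‖N‖ ^ 2 := by
    rw [Complex.div_im, hN2]
  have b1 : |D.im * N.re / ‖N‖ ^ 2| ≤ m / (q * s) := by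
    rw [abs_div, abs_mul, abs_of_pos (by positivity : 0 < ‖N‖ ^ 2)]
    calc |D.im| * |N.re| / ‖N‖ ^ 2 ≤ m * ‖N‖ / ‖N‖ ^ 2 := by
          gcongr; exact Complex.abs_re_le_norm N
      _ = m / ‖N‖ := by field_simp
      _ ≤ m / (q * s) := by gcongr
  have b2 : |D.re * N.im / ‖N‖ ^ 2| ≤ (7 * l * s + m) / (q * s) ^ 2 := by
    rw [abs_div, abs_mul, abs_of_pos (by positivity : 0 < ‖N‖ ^ 2)]
    calc |D.re| * |N.im| / ‖N‖ ^ 2 ≤ (7 * l * s + m) * 1 / ‖N‖ ^ 2 := by gcongr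
      _ ≤ (7 * l * s + m) / (q * s) ^ 2 := by rw [mul_one]; gcongr
  have b3 : |(D / N).im| ≤ m / (q * s) + (7 * l * s + m) / (q * s) ^ 2 := by
    rw [e]; exact (abs_sub _ _).trans (add_le_add b1 b2)
  have hl5 : l ^ 3 ≤ l ^ 5 := pow_le_pow_right₀ hl (by norm_num)
  have hl4 : l ^ 3 * l ≤ l ^ 5 := by
    calc l ^ 3 * l = l ^ 4 := by ring
      _ ≤ l ^ 5 := pow_le_pow_right₀ hl (by norm_num)
  calc l ^ 3 * |(D / N).im| ≤ l ^ 3 * (m / (q * s) + (7 * l * s + m) / (q * s) ^ 2) := by gcongr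
    _ ≤ m / (q * c) + (7 + m) / (q ^ 2 * c) := by
      rw [mul_add]
      gcongr
      · rw [mul_div_assoc', div_le_div_iff₀ hqs0 (by positivity)]
        have : l ^ 3 * c ≤ s := by nlinarith
        have := mul_le_mul_of_nonneg_left this (by positivity : 0 ≤ m * q)
        linarith
      · have h7 : 7 * l * s + m ≤ (7 + m) * (l * s) := by
          have : 1 ≤ l * s := by nlinarith
          nlinarith
        calc l ^ 3 * ((7 * l * s + m) / (q * s) ^ 2)
            ≤ l ^ 3 * ((7 + m) * (l * s) / (q * s) ^ 2) := by gcongr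
          _ = (7 + m) * (l ^ 3 * l) / (q ^ 2 * s) := by field_simp
          _ ≤ (7 + m) / (q ^ 2 * c) := by
            rw [div_le_div_iff₀ (by positivity) (by positivity)]
            have : l ^ 3 * l * c ≤ s := by nlinarith
            have := mul_le_mul_of_nonneg_left this (by positivity : 0 ≤ (7 + m) * q ^ 2)
            linarith
end

/-! ### The function `stableG` in the logarithmic coordinate -/

/-- The function `stableG α` in the coordinate `ζ = log z`; it is entire in `ζ`. -/
noncomputable def stableExt (α : ℝ) (ζ : ℂ) : ℂ :=
  (2 * Complex.I * (Real.pi : ℂ))⁻¹ * Complex.exp (-ζ) *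
    (powLaplace α (Complex.exp (-(Complex.I * Real.pi * α) + (1 - α) * ζ)) -
      powLaplace α (Complex.exp (Complex.I * Real.pi * α + (1 - α) * ζ)))

lemma stableG_eq_stableExt {α : ℝ} (h0 : 0 < α) (h1 : α ≤ 1 / 2) {z : ℂ} (hz : z ≠ 0) :
    stableG α z = stableExt α (Complex.log z) := by
  have hpow : z ^ ((1 - α : ℝ) : ℂ) = Complex.exp ((1 - α) * Complex.log z) := by
    rw [Complex.cpow_def_of_ne_zero hz]; push_cast; ring_nf
  rw [stableG, stableExt, Complex.exp_add, Complex.exp_add, ← hpow, powLaplace, powLaplace,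
    ← integral_sub (integrableOn_powLaplace h0 h1 _) (integrableOn_powLaplace h0 h1 _),
    mul_assoc (2 * Complex.I * (Real.pi : ℂ))⁻¹,
    Complex.exp_neg (Complex.log z), Complex.exp_log hz]
  refine congrArg (fun w => (2 * Complex.I * (Real.pi : ℂ))⁻¹ * w) ?_
  rw [← integral_const_mul]
  refine setIntegral_congr_fun measurableSet_Ioi fun y _ => ?_
  have e (a b c : ℂ) : a * b * c = a * c * b := by ring
  rw [e _ ((y ^ α : ℝ) : ℂ), e _ ((y ^ α : ℝ) : ℂ)]
  ring

lemma differentiable_stableExt {α : ℝ} (h0 : 0 < α) (h1 : α ≤ 1 / 2) :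
    Differentiable ℂ (stableExt α) := by
  have := differentiable_powLaplace h0 h1
  unfold stableExt
  have e1 : Differentiable ℂ fun ζ : ℂ =>
    powLaplace α (Complex.exp (-(Complex.I * Real.pi * α) + (1 - α) * ζ)) :=
    this.comp (by fun_prop)
  have e2 : Differentiable ℂ fun ζ : ℂ =>
    powLaplace α (Complex.exp (Complex.I * Real.pi * α + (1 - α) * ζ)) :=
    this.comp (by fun_prop)
  fun_prop

lemma stableExt_conj (α : ℝ) (ζ : ℂ) :
    stableExt α (starRingEnd ℂ ζ) = starRingEnd ℂ (stableExt α ζ) := by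
  simp only [stableExt, map_mul, map_sub, map_inv₀, ← powLaplace_conj, ← Complex.exp_conj,
    map_add, map_neg, Complex.conj_I, Complex.conj_ofReal, map_one, map_ofNat]
  have e1 : -(-Complex.I * Real.pi * α) + (1 - α) * (starRingEnd ℂ) ζ =
    Complex.I * Real.pi * α + (1 - α) * (starRingEnd ℂ) ζ := by ring
  have e2 : (-Complex.I * Real.pi * α) + (1 - α) * (starRingEnd ℂ) ζ =
    -(Complex.I * Real.pi * α) + (1 - α) * (starRingEnd ℂ) ζ := by ring
  rw [e1, e2, show (2 * -Complex.I * (Real.pi : ℂ))⁻¹ = -(2 * Complex.I * (Real.pi : ℂ))⁻¹ by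
    rw [← inv_neg]; ring_nf]
  ring

lemma stableExt_upper (α x : ℝ) :
    stableExt α (x + Real.pi * Complex.I) =
      (2 * Complex.I * (Real.pi : ℂ))⁻¹ * ((Real.exp (-x) : ℝ) : ℂ) *
        stableN α ((Real.exp ((1 - α) * x) : ℝ) : ℂ) := by
  have e0 : Complex.exp (-(x + Real.pi * Complex.I)) = -Complex.exp (-x) := by
    rw [neg_add, Complex.exp_add, Complex.exp_neg (Real.pi * Complex.I), Complex.exp_pi_mul_I]
    norm_num
  have e1 : Complex.exp (-(Complex.I * Real.pi * α) + (1 - α) * (x + Real.pi * Complex.I)) =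
      -(Complex.exp ((1 - α) * x) * stableRot α) := by
    rw [show -(Complex.I * Real.pi * α) + (1 - α) * (x + Real.pi * Complex.I) =
      ((1 - α) * x + ((-(2 * Real.pi * α) : ℝ) : ℂ) * Complex.I) + Real.pi * Complex.I by
        push_cast; ring, Complex.exp_add, Complex.exp_pi_mul_I, Complex.exp_add, stableRot]
    ring
  have e2 : Complex.exp (Complex.I * Real.pi * α + (1 - α) * (x + Real.pi * Complex.I)) =
      -Complex.exp ((1 - α) * x) := by
    rw [show Complex.I * Real.pi * α + (1 - α) * (x + Real.pi * Complex.I) =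
      (1 - α) * x + Real.pi * Complex.I by ring, Complex.exp_add, Complex.exp_pi_mul_I]
    ring
  rw [stableExt, e0, e1, e2, stableN]
  push_cast
  ring

lemma tendsto_stableG_upper {α : ℝ} (h0 : 0 < α) (h1 : α ≤ 1 / 2) {r : ℝ} (hr : 0 < r) :
    Tendsto (stableG α) (𝓝[{z : ℂ | 0 < z.im}] (-(r : ℂ)))
      (𝓝 (stableExt α (Real.log r + Real.pi * Complex.I))) := by
  have hlog := Complex.tendsto_log_nhdsWithin_im_nonneg_of_re_neg_of_im_zero (z := -(r : ℂ))
    (by simpa using hr) (by simp)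
  rw [norm_neg, Complex.norm_real, Real.norm_of_nonneg hr.le] at hlog
  have hsub : {z : ℂ | 0 < z.im} ⊆ {z : ℂ | 0 ≤ z.im} := fun z hz => le_of_lt (mem_ofPred_eq ▸ hz)
  have := ((differentiable_stableExt h0 h1).continuous.tendsto _).comp
    (hlog.mono_left (nhdsWithin_mono _ hsub))
  refine this.congr' ?_
  filter_upwards [self_mem_nhdsWithin] with z hz
  have hz : 0 < z.im := hz
  refine (stableG_eq_stableExt h0 h1 ?_).symm
  rintro rfl; simp at hz

lemma neBot_upper (r : ℝ) : (𝓝[{z : ℂ | 0 < z.im}] (-(r : ℂ))).NeBot := by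
  rw [← mem_closure_iff_nhdsWithin_neBot, Complex.closure_setOfPred_lt_im]
  simp

lemma stableGUpper_eq {α : ℝ} (h0 : 0 < α) (h1 : α ≤ 1 / 2) {r : ℝ} (hr : 0 < r) :
    stableGUpper α r = stableExt α (Real.log r + Real.pi * Complex.I) := by
  have := neBot_upper r
  exact (tendsto_stableG_upper h0 h1 hr).limUnder_eq

lemma stableGUpper_eq_stableN {α : ℝ} (h0 : 0 < α) (h1 : α ≤ 1 / 2) {r : ℝ} (hr : 0 < r) :
    stableGUpper α r =
      (((2 * Real.pi * r)⁻¹ : ℝ) : ℂ) * (-Complex.I * stableN α ((r ^ (1 - α) : ℝ) : ℂ)) := by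
  rw [stableGUpper_eq h0 h1 hr, stableExt_upper, Real.exp_neg, Real.exp_log hr,
    Real.rpow_def_of_pos hr, mul_comm (1 - α), mul_inv, mul_inv, Complex.inv_I]
  push_cast
  rw [mul_inv, mul_inv]; ring

lemma arg_neg_I_mul {w : ℂ} (hw : 0 < w.re) :
    Complex.arg (-Complex.I * w) = Complex.arg w - Real.pi / 2 := by
  have hw0 : w ≠ 0 := by rintro rfl; simp at hw
  have hI : -Complex.I ≠ 0 := by simp
  have h := Complex.abs_arg_lt_pi_div_two_iff.2 (Or.inl hw)
  have h2 := abs_lt.1 h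
  have hm : Complex.arg (-Complex.I) + Complex.arg w ∈ Ioc (-Real.pi) Real.pi := by
    rw [Complex.arg_neg_I]
    constructor <;> linarith [Real.pi_pos]
  rw [Complex.arg_mul hI hw0 hm, Complex.arg_neg_I]; ring

/-! ### The argument of the boundary values -/

lemma stableTheta_eq {α : ℝ} (h0 : 1 / 3 < α) (h1 : α ≤ 1 / 2) {r : ℝ} (hr : 0 < r) :
    stableTheta α r = 1 / 2 - Complex.arg (stableN α ((r ^ (1 - α) : ℝ) : ℂ)) / Real.pi := by
  have hN := stableN_re_pos h0 h1 (Real.rpow_pos_of_pos hr (1 - α))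
  rw [stableTheta, stableGUpper_eq_stableN (by linarith) h1 hr,
    Complex.arg_real_mul _ (by positivity), arg_neg_I_mul hN]
  field_simp [Real.pi_ne_zero]; ring

lemma stableTheta_mem_Ioo {α : ℝ} (h0 : 1 / 3 < α) (h1 : α ≤ 1 / 2) {r : ℝ} (hr : 0 < r) :
    stableTheta α r ∈ Ioo (0 : ℝ) 1 := by
  have hN := stableN_re_pos h0 h1 (Real.rpow_pos_of_pos hr (1 - α))
  have h := abs_lt.1 (Complex.abs_arg_lt_pi_div_two_iff.2 (Or.inl hN))
  rw [stableTheta_eq h0 h1 hr]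
  have hp := Real.pi_pos
  have h3 : Complex.arg (stableN α ((r ^ (1 - α) : ℝ) : ℂ)) / Real.pi < 1 / 2 := by
    rw [div_lt_iff₀ hp]; linarith
  have h4 : -(1 / 2) < Complex.arg (stableN α ((r ^ (1 - α) : ℝ) : ℂ)) / Real.pi := by
    rw [lt_div_iff₀ hp]; linarith
  constructor <;> linarith

lemma stableGUpper_polar {α : ℝ} (h0 : 1 / 3 < α) (h1 : α ≤ 1 / 2) {r : ℝ} (hr : 0 < r) :
    0 < ‖stableGUpper α r‖ ∧ stableGUpper α r =
      ‖stableGUpper α r‖ * Complex.exp (-(Complex.I * Real.pi * stableTheta α r)) := by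
  have hN := stableN_re_pos h0 h1 (Real.rpow_pos_of_pos hr (1 - α))
  refine ⟨?_, ?_⟩
  · rw [norm_pos_iff, stableGUpper_eq_stableN (by linarith) h1 hr]
    have hN0 : stableN α ((r ^ (1 - α) : ℝ) : ℂ) ≠ 0 := by
      intro h; rw [h] at hN; simp at hN
    have : ((2 * Real.pi * r)⁻¹ : ℝ) ≠ 0 := by positivity
    exact mul_ne_zero (by exact_mod_cast this) (mul_ne_zero (by simp) hN0)
  · have : (-(Complex.I * Real.pi * stableTheta α r)) =
        Complex.arg (stableGUpper α r) * Complex.I := by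
      rw [stableTheta]
      have : (Real.pi : ℂ) ≠ 0 := by exact_mod_cast Real.pi_ne_zero
      push_cast; field_simp
    rw [this, Complex.norm_mul_exp_arg_mul_I]

/-- The derivative of `stableTheta α`. -/
noncomputable def stableThetaDeriv (α r : ℝ) : ℝ :=
  -((stableNDeriv α ((r ^ (1 - α) : ℝ) : ℂ) / stableN α ((r ^ (1 - α) : ℝ) : ℂ)).im *
    ((1 - α) * r ^ (-α))) / Real.pi

lemma hasDerivAt_stableTheta {α : ℝ} (h0 : 1 / 3 < α) (h1 : α ≤ 1 / 2) {r : ℝ} (hr : 0 < r) :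
    HasDerivAt (stableTheta α) (stableThetaDeriv α r) r := by
  have hN := stableN_re_pos h0 h1 (Real.rpow_pos_of_pos hr (1 - α))
  have e1 : HasDerivAt (fun r : ℝ => r ^ (1 - α)) ((1 - α) * r ^ (-α)) r := by
    have := Real.hasDerivAt_rpow_const (x := r) (p := 1 - α) (Or.inl hr.ne')
    refine this.congr_deriv ?_
    congr 2; ring
  have e2 := (hasDerivAt_stableN (by linarith : 0 < α) h1 ((r ^ (1 - α) : ℝ) : ℂ)).comp r
    e1.ofReal_comp
  have e3 := e2.clog_real (Or.inl hN)
  have e4 := (Complex.imCLM.hasFDerivAt.comp_hasDerivAt r e3)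
  have e5 := (e4.div_const Real.pi).const_sub (1 / 2)
  have e6 : HasDerivAt (fun r => 1 / 2 - Complex.arg (stableN α ((r ^ (1 - α) : ℝ) : ℂ)) / Real.pi)
      (stableThetaDeriv α r) r := by
    simp only [← Complex.log_im]
    refine HasDerivAt.congr_deriv e5 ?_
    simp only [Complex.imCLM_apply, Function.comp_apply, stableThetaDeriv]
    rw [neg_div, mul_div_right_comm (stableNDeriv α _), Complex.im_mul_ofReal]
  refine e6.congr_of_eventuallyEq ?_
  filter_upwards [lt_mem_nhds hr] with x hx
  exact stableTheta_eq h0 h1 hx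

lemma continuousOn_stableThetaDeriv {α : ℝ} (h0 : 1 / 3 < α) (h1 : α ≤ 1 / 2) :
    ContinuousOn (stableThetaDeriv α) (Ioi 0) := by
  have c1 : ContinuousOn (fun r : ℝ => ((r ^ (1 - α) : ℝ) : ℂ)) (Ioi 0) :=
    Complex.continuous_ofReal.comp_continuousOn
      (continuousOn_id.rpow_const fun x hx => Or.inl (ne_of_gt hx))
  have c2 : ContinuousOn (fun r : ℝ => r ^ (-α)) (Ioi 0) :=
    continuousOn_id.rpow_const fun x hx => Or.inl (ne_of_gt hx)
  have c3 := (continuous_stableN (by linarith : 0 < α) h1).comp_continuousOn c1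
  have c4 := (continuous_stableNDeriv (by linarith : 0 < α) h1).comp_continuousOn c1
  have c5 := c4.div c3 (fun x hx h => by
    have := stableN_re_pos h0 h1 (Real.rpow_pos_of_pos (mem_Ioi.1 hx) (1 - α))
    simp only [Function.comp_apply] at h
    rw [h] at this; simp at this)
  have c6 := Complex.continuous_im.comp_continuousOn c5
  exact ((c6.mul (continuousOn_const.mul c2)).neg).div_const _

lemma stableN_zero (α : ℝ) : stableN α 0 = 0 := by simp [stableN]

lemma stableNDeriv_zero (α : ℝ) :
    stableNDeriv α 0 = (powMoment α : ℂ) * (1 - stableRot α) := by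
  simp [stableNDeriv, powLaplaceDeriv_zero]; ring

lemma one_sub_stableRot_re (α : ℝ) :
    (1 - stableRot α).re = 2 * Real.sin (Real.pi * α) * Real.sin (Real.pi * α) := by
  have h := Real.sin_sq_add_cos_sq (Real.pi * α)
  rw [Complex.sub_re, stableRot_re, show 2 * Real.pi * α = 2 * (Real.pi * α) by ring,
    Real.cos_two_mul, Complex.one_re]
  nlinarith

lemma one_sub_stableRot_im (α : ℝ) :
    (1 - stableRot α).im = 2 * Real.sin (Real.pi * α) * Real.cos (Real.pi * α) := by
  rw [Complex.sub_im, stableRot, Complex.exp_ofReal_mul_I_im, Real.sin_neg,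
    show 2 * Real.pi * α = 2 * (Real.pi * α) by ring, Real.sin_two_mul, Complex.one_im]
  ring

lemma one_sub_stableRot (α : ℝ) : 1 - stableRot α =
    ((2 * Real.sin (Real.pi * α) : ℝ) : ℂ) * (Complex.cos ((Real.pi / 2 - Real.pi * α : ℝ) : ℂ) +
      Complex.sin ((Real.pi / 2 - Real.pi * α : ℝ) : ℂ) * Complex.I) := by
  rw [← Complex.ofReal_cos, ← Complex.ofReal_sin, Real.cos_pi_div_two_sub,
    Real.sin_pi_div_two_sub]
  apply Complex.ext
  · rw [one_sub_stableRot_re, Complex.re_ofReal_mul]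
    simp only [Complex.add_re, Complex.mul_re, Complex.ofReal_re, Complex.ofReal_im,
      Complex.I_re, Complex.I_im]
    ring
  · rw [one_sub_stableRot_im, Complex.im_ofReal_mul]
    simp only [Complex.add_im, Complex.mul_im, Complex.ofReal_re, Complex.ofReal_im,
      Complex.I_re, Complex.I_im]
    ring

lemma sin_pi_mul_pos {α : ℝ} (h0 : 0 < α) (h1 : α ≤ 1 / 2) : 0 < Real.sin (Real.pi * α) :=
  Real.sin_pos_of_pos_of_lt_pi (mul_pos Real.pi_pos h0) (by nlinarith [Real.pi_pos])

lemma stableNDeriv_zero_re_pos {α : ℝ} (h0 : 0 < α) (h1 : α ≤ 1 / 2) :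
    0 < (stableNDeriv α 0).re := by
  have hs := sin_pi_mul_pos h0 h1
  have hm := powMoment_pos h0
  rw [stableNDeriv_zero, Complex.re_ofReal_mul, one_sub_stableRot_re]
  positivity

lemma stableNDeriv_zero_ne {α : ℝ} (h0 : 0 < α) (h1 : α ≤ 1 / 2) : stableNDeriv α 0 ≠ 0 := by
  intro h
  have h2 := stableNDeriv_zero_re_pos h0 h1
  rw [h] at h2; simp at h2

lemma arg_stableNDeriv_zero {α : ℝ} (h0 : 0 < α) (h1 : α ≤ 1 / 2) :
    Complex.arg (stableNDeriv α 0) = Real.pi / 2 - Real.pi * α := by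
  have hs := sin_pi_mul_pos h0 h1
  have hp := Real.pi_pos
  rw [stableNDeriv_zero, Complex.arg_real_mul _ (powMoment_pos h0), one_sub_stableRot,
    Complex.arg_real_mul _ (by linarith), Complex.arg_cos_add_sin_mul_I]
  constructor <;> nlinarith

lemma tendsto_rpow_one_sub_nhdsGT {α : ℝ} (h1 : α ≤ 1 / 2) :
    Tendsto (fun r : ℝ => r ^ (1 - α)) (𝓝[>] 0) (𝓝[>] 0) := by
  refine tendsto_nhdsWithin_iff.2 ⟨?_, ?_⟩
  · have := (Real.continuousAt_rpow_const 0 (1 - α) (Or.inr (by linarith))).tendsto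
    rw [Real.zero_rpow (by linarith)] at this
    exact this.mono_left nhdsWithin_le_nhds
  · filter_upwards [self_mem_nhdsWithin] with r hr
    exact Real.rpow_pos_of_pos hr _

/-- `N` has a simple zero at the origin, where its derivative has argument `π/2 - πα`. -/
lemma tendsto_stableTheta_zero {α : ℝ} (h0 : 1 / 3 < α) (h1 : α ≤ 1 / 2) :
    Tendsto (stableTheta α) (𝓝[>] 0) (𝓝 α) := by
  have hα : 0 < α := by linarith
  have hs := sin_pi_mul_pos hα h1
  have h := (hasDerivAt_stableN hα h1 0).tendsto_slope
  have hre := stableNDeriv_zero_re_pos hα h1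
  have hcoe : Tendsto (fun r : ℝ => ((r ^ (1 - α) : ℝ) : ℂ)) (𝓝[>] 0) (𝓝[≠] 0) := by
    refine tendsto_nhdsWithin_iff.2 ⟨?_, ?_⟩
    · have := (Complex.continuous_ofReal.tendsto 0).comp
        ((tendsto_nhdsWithin_iff.1 (tendsto_rpow_one_sub_nhdsGT h1)).1)
      rw [Complex.ofReal_zero] at this
      exact this
    · filter_upwards [self_mem_nhdsWithin] with r hr
      have := Real.rpow_pos_of_pos (mem_Ioi.1 hr) (1 - α)
      simpa using this.ne'
  have h2 := (Complex.continuousAt_arg (Or.inl hre)).tendsto.comp (h.comp hcoe)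
  rw [arg_stableNDeriv_zero hα h1] at h2
  have h3 := (h2.div_const Real.pi).const_sub (1 / 2)
  have e : 1 / 2 - (Real.pi / 2 - Real.pi * α) / Real.pi = α := by
    field_simp [Real.pi_ne_zero]; ring
  rw [e] at h3
  refine h3.congr' ?_
  filter_upwards [self_mem_nhdsWithin] with r hr
  have hl := Real.rpow_pos_of_pos (mem_Ioi.1 hr) (1 - α)
  rw [stableTheta_eq h0 h1 hr]
  simp only [Function.comp_apply]
  rw [slope_def_field, stableN_zero, sub_zero, sub_zero]
  rw [div_eq_inv_mul (stableN α _), ← Complex.ofReal_inv, Complex.arg_real_mul _ (inv_pos.2 hl)]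

lemma tendsto_stableTheta_atTop {α : ℝ} (h0 : 1 / 3 < α) (h1 : α ≤ 1 / 2) :
    Tendsto (stableTheta α) atTop (𝓝 (1 / 2)) := by
  have hα : 0 < α := by linarith
  have hm := powMoment_pos hα
  have hl : Tendsto (fun r : ℝ => r ^ (1 - α)) atTop atTop := tendsto_rpow_atTop (by linarith)
  have hb : Tendsto (fun r : ℝ => 1 / (r ^ (1 - α) * powMoment α)) atTop (𝓝 0) := by
    simp only [one_div]
    exact tendsto_inv_atTop_zero.comp (hl.atTop_mul_const hm)
  have hq : Tendsto (fun r : ℝ => (stableN α ((r ^ (1 - α) : ℝ) : ℂ)).im /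
      ‖stableN α ((r ^ (1 - α) : ℝ) : ℂ)‖) atTop (𝓝 0) := by
    refine squeeze_zero_norm' ?_ hb
    filter_upwards [eventually_gt_atTop 0] with r hr
    have hlr := Real.rpow_pos_of_pos hr (1 - α)
    have h2 := one_add_le_powLaplaceReal hα h1 (r ^ (1 - α))
    have h3 := stableN_re_ge h0 h1 hlr.le
    have h4 := abs_stableN_im_le h0 h1 hlr.le
    have h5 := Complex.re_le_norm (stableN α ((r ^ (1 - α) : ℝ) : ℂ))
    rw [Real.norm_eq_abs, abs_div, abs_norm]
    have : 0 < r ^ (1 - α) * powMoment α := by positivity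
    gcongr
    linarith
  have h2 := (Real.continuous_arcsin.tendsto 0).comp hq
  rw [Real.arcsin_zero] at h2
  have h3 := (h2.div_const Real.pi).const_sub (1 / 2)
  rw [zero_div, sub_zero] at h3
  refine h3.congr' ?_
  filter_upwards [eventually_gt_atTop 0] with r hr
  have hN := stableN_re_pos h0 h1 (Real.rpow_pos_of_pos hr (1 - α))
  rw [stableTheta_eq h0 h1 hr, Complex.arg_of_re_nonneg hN.le]
  rfl

/-- Near `λ = 0` the quotient `λN'/N` is continuous because `N` has a simple zero there. -/
lemma exists_norm_mul_stableNDeriv_div_le {α : ℝ} (h0 : 1 / 3 < α) (h1 : α ≤ 1 / 2) :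
    ∃ C, 0 ≤ C ∧ ∀ l : ℝ, 0 < l → l ≤ 1 → ‖(l : ℂ) * (stableNDeriv α l / stableN α l)‖ ≤ C := by
  have hα : 0 < α := by linarith
  have hd : Continuous (dslope (stableN α) 0) := by
    rw [continuous_iff_continuousAt]
    intro z
    rcases eq_or_ne z 0 with rfl | hz
    · exact continuousAt_dslope_same.2 (hasDerivAt_stableN hα h1 0).differentiableAt
    · exact (continuousAt_dslope_of_ne hz).2 (continuous_stableN hα h1).continuousAt
  have hne : ∀ l ∈ Icc (0 : ℝ) 1, dslope (stableN α) 0 (l : ℂ) ≠ 0 := by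
    intro l hl
    rcases eq_or_ne l 0 with rfl | hl0
    · rw [Complex.ofReal_zero, dslope_same, (hasDerivAt_stableN hα h1 0).deriv]
      exact stableNDeriv_zero_ne hα h1
    · have hlp : 0 < l := lt_of_le_of_ne hl.1 (Ne.symm hl0)
      have hN := stableN_re_pos h0 h1 hlp
      rw [dslope_of_ne _ (by exact_mod_cast hl0), slope_def_field, stableN_zero, sub_zero, sub_zero]
      refine div_ne_zero ?_ (by exact_mod_cast hl0)
      intro h; rw [h] at hN; simp at hN
  have hc : ContinuousOn (fun l : ℝ => stableNDeriv α l / dslope (stableN α) 0 (l : ℂ))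
      (Icc 0 1) :=
    ((continuous_stableNDeriv hα h1).comp Complex.continuous_ofReal).continuousOn.div
      (hd.comp Complex.continuous_ofReal).continuousOn hne
  obtain ⟨C, hC⟩ := isCompact_Icc.exists_bound_of_continuousOn hc
  refine ⟨max C 0, le_max_right _ _, fun l hl hl1 => ?_⟩
  have := (hC l ⟨hl.le, hl1⟩).trans (le_max_left C 0)
  have hl0 : (l : ℂ) ≠ 0 := by exact_mod_cast hl.ne'
  rw [dslope_of_ne _ hl0, slope_def_field, stableN_zero, sub_zero, sub_zero] at this
  rw [div_div_eq_mul_div] at this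
  rwa [mul_div_assoc', mul_comm (l : ℂ)]

/-- For `r ≤ 1` the simple zero of `N` is used, for `r ≥ 1` the decay of `Im (N'/N)`. -/
lemma exists_abs_stableThetaDeriv_le {α : ℝ} (h0 : 1 / 3 < α) (h1 : α ≤ 1 / 2) :
    ∃ C, 0 ≤ C ∧ ∀ r : ℝ, 0 < r →
      |stableThetaDeriv α r| ≤ C / r ∧ |stableThetaDeriv α r| ≤ C / r ^ 2 := by
  obtain ⟨C₁, hC₁, h₁⟩ := exists_norm_mul_stableNDeriv_div_le h0 h1
  obtain ⟨C₂, hC₂, h₂⟩ := exists_abs_im_stableNDeriv_div_le h0 h1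
  have hp := Real.pi_gt_three
  refine ⟨C₁ + C₂, by linarith, fun r hr => ?_⟩
  set l := r ^ (1 - α) with hl_def
  have hl : 0 < l := Real.rpow_pos_of_pos hr _
  have hrl : r * r ^ (-α) = l := by
    rw [hl_def, sub_eq_add_neg, Real.rpow_add hr, Real.rpow_one]
  set q := stableNDeriv α l / stableN α l with hq
  have hb : r * |stableThetaDeriv α r| ≤ l * |q.im| := by
    have : |stableThetaDeriv α r| = |q.im| * ((1 - α) * r ^ (-α)) / Real.pi := by
      rw [stableThetaDeriv, neg_div, abs_neg, abs_div, abs_mul, abs_of_pos Real.pi_pos,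
        abs_of_pos (a := (1 - α) * r ^ (-α))
          (mul_pos (by linarith) (Real.rpow_pos_of_pos hr _))]
    rw [this, show r * (|q.im| * ((1 - α) * r ^ (-α)) / Real.pi) =
      ((1 - α) / Real.pi) * (|q.im| * (r * r ^ (-α))) by ring, hrl]
    have h3 : (1 - α) / Real.pi ≤ 1 := by rw [div_le_one Real.pi_pos]; linarith
    have h4 : 0 ≤ |q.im| * l := by positivity
    nlinarith
  rcases le_or_gt r 1 with h | h
  · have hl1 : l ≤ 1 := Real.rpow_le_one hr.le h (by linarith)
    have h3 := h₁ l hl hl1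
    rw [norm_mul, Complex.norm_real, Real.norm_of_nonneg hl.le] at h3
    have h4 := mul_le_mul_of_nonneg_left (Complex.abs_im_le_norm q) hl.le
    have h5 : r * |stableThetaDeriv α r| ≤ C₁ + C₂ := by linarith
    have h6 : r ^ 2 * |stableThetaDeriv α r| ≤ C₁ + C₂ := by
      calc r ^ 2 * |stableThetaDeriv α r| = r * (r * |stableThetaDeriv α r|) := by ring
        _ ≤ 1 * (C₁ + C₂) := by gcongr
        _ = _ := one_mul _
    exact ⟨by rw [le_div_iff₀' hr]; exact h5, by rw [le_div_iff₀' (by positivity)]; exact h6⟩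
  · have hl1 : 1 ≤ l := Real.one_le_rpow h.le (by linarith)
    have h3 := h₂ l hl1
    -- since `2 (1 - α) ≥ 1`
    have hrl2 : r ≤ l ^ 2 := by
      rw [hl_def, ← Real.rpow_natCast, ← Real.rpow_mul hr.le]
      exact Real.self_le_rpow_of_one_le h.le (by push_cast; linarith)
    have h6 : r ^ 2 * |stableThetaDeriv α r| ≤ C₁ + C₂ := by
      calc r ^ 2 * |stableThetaDeriv α r| = r * (r * |stableThetaDeriv α r|) := by ring
        _ ≤ l ^ 2 * (l * |q.im|) := by gcongr
        _ = l ^ 3 * |q.im| := by ring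
        _ ≤ C₁ + C₂ := by linarith
    have h5 : r * |stableThetaDeriv α r| ≤ C₁ + C₂ := by
      refine le_trans ?_ h6
      gcongr; nlinarith
    exact ⟨by rw [le_div_iff₀' hr]; exact h5, by rw [le_div_iff₀' (by positivity)]; exact h6⟩

/-! ### Rotating the path of integration -/

/-- The integrand `exp (-r (s - s^α)) ds` on the Riemann surface of the logarithm, in the coordinate
`ζ = log s`, where it becomes an entire function. -/
noncomputable def hankelForm (α : ℝ) (r ζ : ℂ) : ℂ :=
  Complex.exp (-(r * (Complex.exp ζ - Complex.exp (α * ζ)))) * Complex.exp ζ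

lemma differentiable_hankelForm (α : ℝ) (r : ℂ) : Differentiable ℂ (hankelForm α r) := by
  unfold hankelForm; fun_prop

lemma norm_hankelForm (α : ℝ) (r : ℂ) (x y : ℝ) :
    ‖hankelForm α r (x + y * Complex.I)‖ =
      Real.exp (-((r * Complex.exp (y * Complex.I)).re * Real.exp x) +
        (r * Complex.exp ((α * y : ℝ) * Complex.I)).re * Real.exp (α * x)) * Real.exp x := by
  have e : (α : ℂ) * (x + y * Complex.I) = ((α * x : ℝ) : ℂ) + ((α * y : ℝ) : ℂ) * Complex.I := by
    push_cast; ring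
  rw [hankelForm, norm_mul, Complex.norm_exp, Complex.norm_exp, e, Complex.exp_add,
    Complex.exp_add, ← Complex.ofReal_exp, ← Complex.ofReal_exp]
  have e2 (a b : ℝ) (w w' : ℂ) : (-(r * ((a : ℂ) * w - (b : ℂ) * w'))).re =
      -((r * w).re * a) + (r * w').re * b := by
    rw [show -(r * ((a : ℂ) * w - (b : ℂ) * w')) = (b : ℂ) * (r * w') - (a : ℂ) * (r * w) by ring,
      Complex.sub_re, Complex.re_ofReal_mul, Complex.re_ofReal_mul]
    ring
  rw [e2]; simp

lemma re_mul_exp_I_le (r : ℂ) (y : ℝ) : |(r * Complex.exp (y * Complex.I)).re| ≤ ‖r‖ := by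
  refine (Complex.abs_re_le_norm _).trans ?_
  rw [norm_mul, Complex.norm_exp_ofReal_mul_I, mul_one]

lemma norm_hankelForm_le_left {α : ℝ} (h0 : 0 < α) (r : ℂ) {x : ℝ} (hx : x ≤ 0) (y : ℝ) :
    ‖hankelForm α r (x + y * Complex.I)‖ ≤ Real.exp (2 * ‖r‖) * Real.exp x := by
  rw [norm_hankelForm]
  gcongr
  have h1 := abs_le.1 (re_mul_exp_I_le r y)
  have h2 := abs_le.1 (re_mul_exp_I_le r (α * y))
  have h3 : Real.exp x ≤ 1 := Real.exp_le_one_iff.2 hx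
  have h4 : Real.exp (α * x) ≤ 1 := Real.exp_le_one_iff.2 (by nlinarith)
  have h5 := Real.exp_pos x
  have h6 := Real.exp_pos (α * x)
  have hn := norm_nonneg r
  nlinarith

lemma norm_hankelForm_le_right {α : ℝ} (r : ℂ) {k : ℝ} {x y : ℝ}
    (hk : k ≤ (r * Complex.exp (y * Complex.I)).re) :
    ‖hankelForm α r (x + y * Complex.I)‖ ≤
      Real.exp (-(k * Real.exp x) + ‖r‖ * Real.exp (α * x)) * Real.exp x := by
  rw [norm_hankelForm]
  gcongr
  exact (abs_le.1 (re_mul_exp_I_le r (α * y))).2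

lemma norm_sub_le_vertical {P F : ℂ → ℂ} (hP : ∀ ζ, HasDerivAt P (F ζ) ζ) {x a b C : ℝ}
    (hF : ∀ y ∈ uIcc a b, ‖F (x + y * Complex.I)‖ ≤ C) :
    ‖P (x + b * Complex.I) - P (x + a * Complex.I)‖ ≤ C * |b - a| := by
  have hd : ∀ y ∈ uIcc a b, HasDerivWithinAt (fun y : ℝ => P (x + y * Complex.I))
      (F (x + y * Complex.I) * Complex.I) (uIcc a b) y := by
    intro y _
    have e1 : HasDerivAt (fun y : ℝ => (x : ℂ) + y * Complex.I) Complex.I y := by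
      simpa using ((Complex.ofRealCLM.hasDerivAt (x := y)).mul_const Complex.I).const_add (x : ℂ)
    exact ((hP _).comp_of_eq y e1 rfl).hasDerivWithinAt
  have := (convex_uIcc a b).norm_image_sub_le_of_norm_hasDerivWithin_le hd (C := C)
    (fun y hy => by simpa using hF y hy) left_mem_uIcc right_mem_uIcc
  simpa using this

lemma exists_hankelPrim {α : ℝ} (h0 : 0 < α) (r : ℂ) : ∃ P : ℂ → ℂ,
    (∀ ζ, HasDerivAt P (hankelForm α r ζ) ζ) ∧ Tendsto (fun x : ℝ => P x) atBot (𝓝 0) := by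
  obtain ⟨P, hP⟩ := (differentiable_hankelForm α r).isExactOn_univ
  have hd : ∀ x ∈ Iic (0 : ℝ), HasDerivAt (fun x : ℝ => P x) (hankelForm α r x) x :=
    fun x _ => (hP _ (mem_univ _)).comp_ofReal
  have hi : IntegrableOn (fun x : ℝ => hankelForm α r x) (Iic 0) := by
    refine Integrable.mono' ((integrableOn_exp_Iic 0).const_mul (Real.exp (2 * ‖r‖))) ?_ ?_
    · exact ((differentiable_hankelForm α r).continuous.comp
        Complex.continuous_ofReal).aestronglyMeasurable
    · filter_upwards [ae_restrict_mem measurableSet_Iic] with x hx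
      simpa using norm_hankelForm_le_left h0 r hx 0
  have hl := tendsto_limUnder_of_hasDerivAt_of_integrableOn_Iic hd hi
  refine ⟨fun ζ => P ζ - limUnder atBot (fun x : ℝ => P x), fun ζ => ?_, ?_⟩
  · exact (hP ζ (mem_univ _)).sub_const _
  · simpa using hl.sub_const (limUnder atBot (fun x : ℝ => P x))

open Classical in
/-- The primitive of `hankelForm α r` vanishing at `Re ζ → -∞`, that is, the integral of
`exp (-r (s - s^α)) ds` from `0` to `exp ζ`. -/
noncomputable def hankelPrim (α : ℝ) (r : ℂ) : ℂ → ℂ :=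
  if h : 0 < α then Classical.choose (exists_hankelPrim h r) else 0

lemma hasDerivAt_hankelPrim {α : ℝ} (h0 : 0 < α) (r ζ : ℂ) :
    HasDerivAt (hankelPrim α r) (hankelForm α r ζ) ζ := by
  rw [hankelPrim, dif_pos h0]
  exact (Classical.choose_spec (exists_hankelPrim h0 r)).1 ζ

lemma tendsto_hankelPrim_ofReal_atBot {α : ℝ} (h0 : 0 < α) (r : ℂ) :
    Tendsto (fun x : ℝ => hankelPrim α r x) atBot (𝓝 0) := by
  rw [hankelPrim, dif_pos h0]
  exact (Classical.choose_spec (exists_hankelPrim h0 r)).2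

lemma tendsto_hankelPrim_atBot {α : ℝ} (h0 : 0 < α) (r : ℂ) {ι : Type*} {l : Filter ι}
    {X Y : ι → ℝ} {M : ℝ} (hX : Tendsto X l atBot) (hY : ∀ᶠ i in l, |Y i| ≤ M) :
    Tendsto (fun i => hankelPrim α r (X i + Y i * Complex.I)) l (𝓝 0) := by
  have h1 := (tendsto_hankelPrim_ofReal_atBot h0 r).comp hX
  have h2 : Tendsto (fun i => hankelPrim α r (X i + Y i * Complex.I) - hankelPrim α r (X i)) l
      (𝓝 0) := by
    have hb : Tendsto (fun i => Real.exp (2 * ‖r‖) * Real.exp (X i) * M) l (𝓝 0) := by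
      have := ((Real.tendsto_exp_atBot.comp hX).const_mul (Real.exp (2 * ‖r‖))).mul_const M
      simpa using this
    refine squeeze_zero_norm' ?_ hb
    filter_upwards [hY, hX.eventually (eventually_le_atBot 0)] with i hi hx
    have := norm_sub_le_vertical (hasDerivAt_hankelPrim h0 r) (x := X i) (a := 0) (b := Y i)
      (fun y _ => norm_hankelForm_le_left h0 r hx y)
    simp only [Complex.ofReal_zero, zero_mul, add_zero, sub_zero] at this
    exact this.trans (by gcongr)
  simpa using h2.add h1

lemma tendsto_hankelForm_bound {α : ℝ} (h1 : α ≤ 1 / 2) (R : ℝ) (hR : 0 ≤ R) {k : ℝ} (hk : 0 < k) :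
    Tendsto (fun x : ℝ => Real.exp (-(k * Real.exp x) + R * Real.exp (α * x)) * Real.exp x)
      atTop (𝓝 0) := by
  have hs : Tendsto (fun x : ℝ => Real.exp (x / 2)) atTop atTop :=
    Real.tendsto_exp_atTop.comp (tendsto_id.atTop_div_const (by norm_num))
  have hq : Tendsto (fun s : ℝ => s * (-k * s + (R + 2))) atTop atBot :=
    tendsto_id.atTop_mul_atBot₀
      (tendsto_atBot_add_const_right _ _ (tendsto_id.const_mul_atTop_of_neg (by linarith)))
  refine squeeze_zero' (Eventually.of_forall fun x => by positivity) ?_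
    (Real.tendsto_exp_atBot.comp (hq.comp hs))
  filter_upwards [eventually_ge_atTop 0] with x hx
  simp only [Function.comp_apply]
  rw [← Real.exp_add, Real.exp_le_exp]
  have e1 : Real.exp x = Real.exp (x / 2) * Real.exp (x / 2) := by rw [← Real.exp_add]; ring_nf
  have e2 : Real.exp (α * x) ≤ Real.exp (x / 2) := Real.exp_le_exp.2 (by nlinarith)
  have e3 := Real.add_one_le_exp (x / 2)
  have e4 := mul_le_mul_of_nonneg_left e2 hR
  rw [e1]; nlinarith

lemma tendsto_hankelForm_atTop {α : ℝ} (h1 : α ≤ 1 / 2) (r : ℂ) {ι : Type*} {l : Filter ι}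
    {X Y : ι → ℝ} {k : ℝ} (hk : 0 < k) (hX : Tendsto X l atTop)
    (hY : ∀ᶠ i in l, k ≤ (r * Complex.exp (Y i * Complex.I)).re) :
    Tendsto (fun i => hankelForm α r (X i + Y i * Complex.I)) l (𝓝 0) := by
  refine squeeze_zero_norm' ?_ ((tendsto_hankelForm_bound h1 ‖r‖ (norm_nonneg r) hk).comp hX)
  filter_upwards [hY] with i hi
  exact norm_hankelForm_le_right r hi

/-- At infinity `hankelPrim` does not see the direction, as long as `Re (r s)` stays positive. -/
lemma tendsto_hankelPrim_sub_atTop {α : ℝ} (h0 : 0 < α) (h1 : α ≤ 1 / 2) (r : ℂ) {ι : Type*}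
    {l : Filter ι} {X Y : ι → ℝ} {k M y₀ : ℝ} (hk : 0 < k) (hX : Tendsto X l atTop)
    (hY : ∀ᶠ i in l, |Y i - y₀| ≤ M ∧
      ∀ y ∈ uIcc y₀ (Y i), k ≤ (r * Complex.exp (y * Complex.I)).re) :
    Tendsto (fun i => hankelPrim α r (X i + Y i * Complex.I) -
      hankelPrim α r (X i + y₀ * Complex.I)) l (𝓝 0) := by
  have hb := ((tendsto_hankelForm_bound h1 ‖r‖ (norm_nonneg r) hk).comp hX).mul_const M
  rw [zero_mul] at hb
  refine squeeze_zero_norm' ?_ hb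
  filter_upwards [hY] with i hi
  have := norm_sub_le_vertical (hasDerivAt_hankelPrim h0 r) (x := X i) (a := y₀) (b := Y i)
    (fun y hy => norm_hankelForm_le_right (α := α) r (hi.2 y hy))
  refine this.trans ?_
  simp only [Function.comp_apply]
  gcongr
  exact hi.1

lemma exp_neg_mul_add_rpow_le {α : ℝ} (h0 : 0 < α) (h1 : α ≤ 1 / 2) {k R u : ℝ} (hk : 0 < k)
    (hR : 0 ≤ R) (hu : 0 ≤ u) : Real.exp (-(k * u) + R * u ^ α) ≤
      Real.exp (k * (R / k + (R / k) ^ 2 / 2)) * Real.exp (-(k / 2) * u) := by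
  have := mul_le_mul_of_nonneg_left
    (mul_rpow_le_of_le_half h0 h1 (by positivity : 0 ≤ R / k) hu) hk.le
  have e : k * (R / k * u ^ α) = R * u ^ α := by field_simp
  rw [← Real.exp_add, Real.exp_le_exp]
  linarith

lemma norm_exp_ray (α : ℝ) (r : ℂ) (y u : ℝ) :
    ‖Complex.exp (-(r * (u * Complex.exp (y * Complex.I) -
      ((u ^ α : ℝ) : ℂ) * Complex.exp ((α * y : ℝ) * Complex.I))))‖ =
    Real.exp (-((r * Complex.exp (y * Complex.I)).re * u) +
      (r * Complex.exp ((α * y : ℝ) * Complex.I)).re * u ^ α) := by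
  rw [Complex.norm_exp]
  congr 1
  rw [show -(r * (u * Complex.exp (y * Complex.I) -
      ((u ^ α : ℝ) : ℂ) * Complex.exp ((α * y : ℝ) * Complex.I))) =
      ((u ^ α : ℝ) : ℂ) * (r * Complex.exp ((α * y : ℝ) * Complex.I)) -
      (u : ℂ) * (r * Complex.exp (y * Complex.I)) by ring,
      Complex.sub_re, Complex.re_ofReal_mul, Complex.re_ofReal_mul]
  ring

lemma integrableOn_exp_ray {α : ℝ} (h0 : 0 < α) (h1 : α ≤ 1 / 2) (r : ℂ) {y : ℝ}
    (hy : 0 < (r * Complex.exp (y * Complex.I)).re) :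
    IntegrableOn (fun u : ℝ => Complex.exp (-(r * (u * Complex.exp (y * Complex.I) -
      ((u ^ α : ℝ) : ℂ) * Complex.exp ((α * y : ℝ) * Complex.I))))) (Ioi 0) := by
  set k := (r * Complex.exp (y * Complex.I)).re with hk
  refine Integrable.mono' ((integrableOn_exp_mul_Ioi (a := -(k / 2)) (by linarith) 0).const_mul
    (Real.exp (k * (‖r‖ / k + (‖r‖ / k) ^ 2 / 2)))) ?_ ?_
  · have : Measurable fun y : ℝ => y ^ α := measurable_id.pow_const α
    exact Measurable.aestronglyMeasurable (by fun_prop)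
  · filter_upwards [ae_restrict_mem measurableSet_Ioi] with u hu
    have hu : 0 < u := hu
    rw [norm_exp_ray]
    refine le_trans ?_ (exp_neg_mul_add_rpow_le h0 h1 hy (norm_nonneg r) hu.le)
    gcongr
    exact (abs_le.1 (re_mul_exp_I_le r (α * y))).2

/-- The limit of `hankelPrim` along a ray on which `exp (-r s)` decays. -/
lemma tendsto_hankelPrim_ray {α : ℝ} (h0 : 0 < α) (h1 : α ≤ 1 / 2) (r : ℂ) {y : ℝ}
    (hy : 0 < (r * Complex.exp (y * Complex.I)).re) :
    Tendsto (fun x : ℝ => hankelPrim α r (x + y * Complex.I)) atTop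
      (𝓝 (Complex.exp (y * Complex.I) * ∫ u in Ioi (0 : ℝ),
        Complex.exp (-(r * (u * Complex.exp (y * Complex.I) -
          ((u ^ α : ℝ) : ℂ) * Complex.exp ((α * y : ℝ) * Complex.I)))))) := by
  set f : ℝ → ℂ := fun u => hankelPrim α r (Real.log u + y * Complex.I) with hf
  set g : ℝ → ℂ := fun u => Complex.exp (y * Complex.I) *
    Complex.exp (-(r * (u * Complex.exp (y * Complex.I) -
          ((u ^ α : ℝ) : ℂ) * Complex.exp ((α * y : ℝ) * Complex.I)))) with hg
  have hder : ∀ u ∈ Ioi (0 : ℝ), HasDerivAt f (g u) u := by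
    intro u hu
    have hu : 0 < u := hu
    have e1 : HasDerivAt (fun u : ℝ => (Real.log u : ℂ) + y * Complex.I) ((u⁻¹ : ℝ) : ℂ) u :=
      ((Real.hasDerivAt_log hu.ne').ofReal_comp).add_const _
    refine ((hasDerivAt_hankelPrim h0 r _).comp_of_eq u e1 rfl).congr_deriv ?_
    have e2 : Complex.exp (Real.log u + y * Complex.I) = u * Complex.exp (y * Complex.I) := by
      rw [Complex.exp_add, ← Complex.ofReal_exp, Real.exp_log hu]
    have e3 : Complex.exp (α * (Real.log u + y * Complex.I)) =
        ((u ^ α : ℝ) : ℂ) * Complex.exp ((α * y : ℝ) * Complex.I) := by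
      rw [Real.rpow_def_of_pos hu, Complex.ofReal_exp, ← Complex.exp_add]
      push_cast; ring_nf
    have hu' : (u : ℂ) ≠ 0 := by exact_mod_cast hu.ne'
    rw [hankelForm, e2, e3]
    simp only [hg]
    rw [Complex.ofReal_inv, mul_assoc, mul_right_comm, mul_inv_cancel₀ hu', one_mul, mul_comm]
  have hgi : IntegrableOn g (Ioi 0) := (integrableOn_exp_ray h0 h1 r hy).const_mul _
  have hl : Tendsto f atTop (𝓝 (limUnder atTop f)) :=
    tendsto_limUnder_of_hasDerivAt_of_integrableOn_Ioi hder hgi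
  have hz : Tendsto f (𝓝[>] 0) (𝓝 0) :=
    tendsto_hankelPrim_atBot h0 r (M := |y|) Real.tendsto_log_nhdsGT_zero
      (Eventually.of_forall fun _ => le_rfl)
  have hint : ∫ u in Ioi (0 : ℝ), g u = limUnder atTop f := by
    have := integral_Ioi_of_hasDerivAt_of_tendsto (a := 0) (f := Function.update f 0 0) (f' := g)
      (m := limUnder atTop f) ?_ ?_ hgi ?_
    · simpa using this
    · rw [continuousWithinAt_update_same, Ici_sdiff_left]; exact hz
    · intro u hu
      refine (hder u hu).congr_of_eventuallyEq ?_
      filter_upwards [lt_mem_nhds (mem_Ioi.1 hu)] with v hv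
      rw [Function.update_of_ne hv.ne']
    · refine hl.congr' ?_
      filter_upwards [eventually_gt_atTop 0] with v hv
      rw [Function.update_of_ne hv.ne']
  rw [← integral_const_mul]
  change Tendsto _ _ (𝓝 (∫ u in Ioi (0 : ℝ), g u))
  rw [hint]
  refine (hl.comp Real.tendsto_exp_atTop).congr fun x => ?_
  simp [hf]

lemma integral_exp_ray_eq_powLaplace {α : ℝ} (r : ℂ) {y ρ : ℝ} (hρ : 0 < ρ)
    (hr : r * Complex.exp (y * Complex.I) = ρ) :
    ∫ u in Ioi (0 : ℝ), Complex.exp (-(r * (u * Complex.exp (y * Complex.I) -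
        ((u ^ α : ℝ) : ℂ) * Complex.exp ((α * y : ℝ) * Complex.I)))) =
      ((ρ⁻¹ : ℝ) : ℂ) * powLaplace α
        (-(r * Complex.exp ((α * y : ℝ) * Complex.I) * ((ρ ^ (-α) : ℝ) : ℂ))) := by
  set q := r * Complex.exp ((α * y : ℝ) * Complex.I) with hq
  have h := integral_comp_mul_left_Ioi (fun v : ℝ =>
    Complex.exp (-(-(q * ((ρ ^ (-α) : ℝ) : ℂ)) * ((v ^ α : ℝ) : ℂ))) * Complex.exp (-(v : ℂ))) 0 hρ
  rw [mul_zero, ← powLaplace, Complex.real_smul] at h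
  rw [← h]
  refine setIntegral_congr_fun measurableSet_Ioi fun u hu => ?_
  have hu : 0 < u := hu
  have e : ρ ^ (-α) * (ρ * u) ^ α = u ^ α := by
    rw [Real.mul_rpow hρ.le hu.le, ← mul_assoc, ← Real.rpow_add hρ]; simp
  have e' : ((ρ ^ (-α) : ℝ) : ℂ) * (((ρ * u) ^ α : ℝ) : ℂ) = ((u ^ α : ℝ) : ℂ) := by
    rw [← Complex.ofReal_mul, e]
  rw [← Complex.exp_add]
  congr 1
  rw [show -(-(q * ((ρ ^ (-α) : ℝ) : ℂ)) * (((ρ * u) ^ α : ℝ) : ℂ)) =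
    q * (((ρ ^ (-α) : ℝ) : ℂ) * (((ρ * u) ^ α : ℝ) : ℂ)) by ring, e', Complex.ofReal_mul ρ u, ← hr, hq]
  ring

lemma tendsto_hankelPrim_powLaplace {α : ℝ} (h0 : 0 < α) (h1 : α ≤ 1 / 2) (r : ℂ) {y ρ : ℝ}
    (hρ : 0 < ρ) (hr : r * Complex.exp (y * Complex.I) = ρ) :
    Tendsto (fun x : ℝ => hankelPrim α r (x + y * Complex.I)) atTop
      (𝓝 (Complex.exp (y * Complex.I) * (((ρ⁻¹ : ℝ) : ℂ) * powLaplace α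
        (-(r * Complex.exp ((α * y : ℝ) * Complex.I) * ((ρ ^ (-α) : ℝ) : ℂ)))))) := by
  rw [← integral_exp_ray_eq_powLaplace r hρ hr]
  exact tendsto_hankelPrim_ray h0 h1 r (by rw [hr]; simpa using hρ)

/-! ### Comparing integrals through their primitives -/

/-- An improper integral of a nonnegative function is nonnegative, expressed through the limits of a
primitive so that no integrability has to be established. -/
lemma le_of_hasDerivAt_nonneg_of_tendsto {f f' : ℝ → ℝ} {a b A B : ℝ} (hab : a < b)
    (hd : ∀ x ∈ Ioo a b, HasDerivAt f (f' x) x) (hf' : ∀ x ∈ Ioo a b, 0 ≤ f' x)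
    (hA : Tendsto f (𝓝[>] a) (𝓝 A)) (hB : Tendsto f (𝓝[<] b) (𝓝 B)) : A ≤ B := by
  have hm : MonotoneOn f (Ioo a b) := by
    refine monotoneOn_of_deriv_nonneg (convex_Ioo a b)
      (fun x hx => (hd x hx).continuousAt.continuousWithinAt) ?_ ?_
    · rw [interior_Ioo]
      exact fun x hx => (hd x hx).differentiableAt.differentiableWithinAt
    · rw [interior_Ioo]
      intro x hx; rw [(hd x hx).deriv]; exact hf' x hx
  have hc : (a + b) / 2 ∈ Ioo a b := ⟨by linarith, by linarith⟩
  have h1 : A ≤ f ((a + b) / 2) := by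
    refine le_of_tendsto hA ?_
    filter_upwards [Ioo_mem_nhdsGT hc.1] with x hx
    exact hm ⟨hx.1, hx.2.trans hc.2⟩ hc hx.2.le
  have h2 : f ((a + b) / 2) ≤ B := by
    refine ge_of_tendsto hB ?_
    filter_upwards [Ioo_mem_nhdsLT hc.2] with x hx
    exact hm hc ⟨hc.1.trans hx.1, hx.2⟩ hx.1.le
  exact h1.trans h2

lemma strictMonoOn_Ioo_of_hasDerivAt_pos {f f' : ℝ → ℝ} {a b : ℝ}
    (hd : ∀ x ∈ Ioo a b, HasDerivAt f (f' x) x) (hf' : ∀ x ∈ Ioo a b, 0 < f' x) :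
    StrictMonoOn f (Ioo a b) := by
  refine strictMonoOn_of_deriv_pos (convex_Ioo a b)
    (fun x hx => (hd x hx).continuousAt.continuousWithinAt) ?_
  rw [interior_Ioo]
  intro x hx; rw [(hd x hx).deriv]; exact hf' x hx

lemma lt_of_hasDerivAt_pos_of_tendsto {f f' : ℝ → ℝ} {a b A B : ℝ} (hab : a < b)
    (hd : ∀ x ∈ Ioo a b, HasDerivAt f (f' x) x) (hf' : ∀ x ∈ Ioo a b, 0 < f' x)
    (hA : Tendsto f (𝓝[>] a) (𝓝 A)) (hB : Tendsto f (𝓝[<] b) (𝓝 B)) : A < B := by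
  have hm := strictMonoOn_Ioo_of_hasDerivAt_pos hd hf'
  have hc : (a + b) / 2 ∈ Ioo a b := ⟨by linarith, by linarith⟩
  have hc' : (a + 3 * b) / 4 ∈ Ioo a b := ⟨by linarith, by linarith⟩
  have h1 : A ≤ f ((a + b) / 2) := by
    refine le_of_tendsto hA ?_
    filter_upwards [Ioo_mem_nhdsGT hc.1] with x hx
    exact (hm ⟨hx.1, hx.2.trans hc.2⟩ hc hx.2).le
  have h2 : f ((a + 3 * b) / 4) ≤ B := by
    refine ge_of_tendsto hB ?_
    filter_upwards [Ioo_mem_nhdsLT hc'.2] with x hx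
    exact (hm hc' ⟨hc'.1.trans hx.1, hx.2⟩ hx.1).le
  exact (h1.trans_lt (hm hc hc' (by linarith))).trans_le h2

/-! ### The curve on which the phase is real -/

/-- The logarithm of the modulus of the point of argument `φ` on the curve `Im (s - s^α) = 0`. -/
noncomputable def levelLog (α φ : ℝ) : ℝ :=
  (Real.log (Real.sin (α * φ)) - Real.log (Real.sin φ)) / (1 - α)

/-- The curve `Im (s - s^α) = 0` on the Riemann surface of the logarithm, in the coordinate `log s`,
parametrized by the argument. -/
noncomputable def levelCurve (α φ : ℝ) : ℂ := levelLog α φ + φ * Complex.I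

/-- The value of `s - s^α` on the curve `levelCurve`. -/
noncomputable def levelValue (α φ : ℝ) : ℝ :=
  Real.exp (levelLog α φ) * Real.cos φ - Real.exp (α * levelLog α φ) * Real.cos (α * φ)

lemma exp_levelCurve (α φ : ℝ) : Complex.exp (levelCurve α φ) =
    ((Real.exp (levelLog α φ) * Real.cos φ : ℝ) : ℂ) +
      ((Real.exp (levelLog α φ) * Real.sin φ : ℝ) : ℂ) * Complex.I := by
  rw [levelCurve, Complex.exp_add, Complex.exp_mul_I]
  push_cast; ring

lemma exp_mul_levelCurve (α φ : ℝ) : Complex.exp (α * levelCurve α φ) =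
    ((Real.exp (α * levelLog α φ) * Real.cos (α * φ) : ℝ) : ℂ) +
      ((Real.exp (α * levelLog α φ) * Real.sin (α * φ) : ℝ) : ℂ) * Complex.I := by
  rw [levelCurve, mul_add, ← mul_assoc, Complex.exp_add, Complex.exp_mul_I]
  push_cast; ring

lemma exp_levelLog_mul_sin {α φ : ℝ} (h1 : α ≤ 1 / 2) (hs : 0 < Real.sin φ)
    (hs' : 0 < Real.sin (α * φ)) :
    Real.exp (levelLog α φ) * Real.sin φ =
      Real.exp (α * levelLog α φ) * Real.sin (α * φ) := by
  have h : levelLog α φ + Real.log (Real.sin φ) =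
      α * levelLog α φ + Real.log (Real.sin (α * φ)) := by
    have : (1 - α) * levelLog α φ = Real.log (Real.sin (α * φ)) - Real.log (Real.sin φ) := by
      rw [levelLog, mul_div_cancel₀ _ (by linarith)]
    linarith
  have := congrArg Real.exp h
  rwa [Real.exp_add, Real.exp_add, Real.exp_log hs, Real.exp_log hs'] at this

lemma exp_levelCurve_sub {α φ : ℝ} (h1 : α ≤ 1 / 2) (hs : 0 < Real.sin φ)
    (hs' : 0 < Real.sin (α * φ)) :
    Complex.exp (levelCurve α φ) - Complex.exp (α * levelCurve α φ) = levelValue α φ := by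
  rw [exp_levelCurve, exp_mul_levelCurve, exp_levelLog_mul_sin h1 hs hs', levelValue]
  push_cast; ring

lemma hankelForm_levelCurve {α φ : ℝ} (h1 : α ≤ 1 / 2) (hs : 0 < Real.sin φ)
    (hs' : 0 < Real.sin (α * φ)) (r : ℝ) :
    hankelForm α r (levelCurve α φ) =
      ((Real.exp (-(r * levelValue α φ)) : ℝ) : ℂ) * Complex.exp (levelCurve α φ) := by
  rw [hankelForm, exp_levelCurve_sub h1 hs hs']; push_cast; rfl

/-- Along `levelCurve` the real quantity `s - s^α` is strictly decreasing in the argument: its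
derivative `d` equals `g' ζ'` with `g' = s - α s^α`, and `Im ζ' = 1` gives
`d * Im g' = -|g'|²`, where `Im g' = (1 - α) Im s > 0`. -/
lemma exists_hasDerivAt_levelCurve {α φ : ℝ} (h1 : α ≤ 1 / 2) (hs : 0 < Real.sin φ)
    (hs' : 0 < Real.sin (α * φ)) :
    ∃ (c : ℂ) (d : ℝ), HasDerivAt (levelCurve α) c φ ∧ HasDerivAt (levelValue α) d φ ∧ d < 0 ∧
      (Complex.exp (levelCurve α φ) - α * Complex.exp (α * levelCurve α φ)) * c = d ∧
      (0 < α → 0 < Real.sin ((1 - α) * φ) → 0 < (Complex.exp (levelCurve α φ) * c).im) := by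
  have e1 : HasDerivAt (fun φ : ℝ => Real.sin (α * φ)) (Real.cos (α * φ) * α) φ := by
    simpa using ((hasDerivAt_id φ).const_mul α).sin
  obtain ⟨l', hl'⟩ : ∃ l', HasDerivAt (levelLog α) l' φ :=
    ⟨_, ((e1.log hs'.ne').sub ((Real.hasDerivAt_sin φ).log hs.ne')).div_const (1 - α)⟩
  have hc : HasDerivAt (levelCurve α) ((l' : ℂ) + Complex.I) φ := by
    have e2 := (Complex.ofRealCLM.hasDerivAt (x := φ)).mul_const Complex.I
    refine (hl'.ofReal_comp.add e2).congr_deriv ?_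
    simp
  set c : ℂ := (l' : ℂ) + Complex.I with hc_def
  have hcim : c.im = 1 := by simp [hc_def]
  set g' := Complex.exp (levelCurve α φ) - α * Complex.exp (α * levelCurve α φ) with hg'
  have hv : HasDerivAt (fun φ => Complex.exp (levelCurve α φ) -
      Complex.exp (α * levelCurve α φ)) (g' * c) φ := by
    refine (hc.cexp.sub (hc.const_mul (α : ℂ)).cexp).congr_deriv ?_
    rw [hg']; ring
  have hev : (fun φ : ℝ => (levelValue α φ : ℂ)) =ᶠ[𝓝 φ] fun φ => Complex.exp (levelCurve α φ) -
      Complex.exp (α * levelCurve α φ) := by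
    have c1 : ContinuousAt (fun φ : ℝ => Real.sin φ) φ := by fun_prop
    have c2 : ContinuousAt (fun φ : ℝ => Real.sin (α * φ)) φ := by fun_prop
    filter_upwards [c1.eventually (lt_mem_nhds hs), c2.eventually (lt_mem_nhds hs')] with x hx hx'
    exact (exp_levelCurve_sub h1 hx hx').symm
  have hv2 := hv.congr_of_eventuallyEq hev
  have hre : HasDerivAt (levelValue α) (g' * c).re φ := by
    simpa [Function.comp_def] using Complex.reCLM.hasFDerivAt.comp_hasDerivAt φ hv2
  have him : HasDerivAt (fun _ : ℝ => (0 : ℝ)) (g' * c).im φ := by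
    simpa [Function.comp_def] using Complex.imCLM.hasFDerivAt.comp_hasDerivAt φ hv2
  have him0 : (g' * c).im = 0 := him.unique (hasDerivAt_const φ 0)
  set d := (g' * c).re with hd
  have hgc : g' * c = d := by
    apply Complex.ext
    · simp [hd]
    · simpa using him0
  have hgim : g'.im = (1 - α) * (Real.exp (levelLog α φ) * Real.sin φ) := by
    rw [hg', exp_levelCurve, exp_mul_levelCurve, exp_levelLog_mul_sin h1 hs hs',
      Complex.sub_im, Complex.im_ofReal_mul]
    simp only [Complex.add_im, Complex.ofReal_im, Complex.im_ofReal_mul, Complex.I_im]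
    ring
  have hgim_pos : 0 < g'.im := by
    rw [hgim]; have := Real.exp_pos (levelLog α φ)
    exact mul_pos (by linarith) (mul_pos this hs)
  have hns : 0 < Complex.normSq g' := by
    rw [Complex.normSq_pos]; rintro h; rw [h] at hgim_pos; simp at hgim_pos
  have hmul : Complex.normSq g' * c = d * (starRingEnd ℂ) g' := by
    rw [← hgc, ← Complex.mul_conj]; ring
  have hd_im : Complex.normSq g' = -(d * g'.im) := by
    have := congrArg Complex.im hmul
    rw [Complex.im_ofReal_mul, Complex.im_ofReal_mul, hcim, Complex.conj_im] at this
    linarith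
  have hdneg : d < 0 := by
    by_contra h
    push Not at h
    have := mul_nonneg h hgim_pos.le
    linarith
  refine ⟨c, d, hc, hre, hdneg, hgc, fun hα hs2 => ?_⟩
  have key : Complex.normSq g' * (Complex.exp (levelCurve α φ) * c).im =
      -d * (α * (Real.exp (levelLog α φ) * Real.exp (α * levelLog α φ) *
        Real.sin ((1 - α) * φ))) := by
    rw [← Complex.im_ofReal_mul, show (Complex.normSq g' : ℂ) *
      (Complex.exp (levelCurve α φ) * c) = Complex.exp (levelCurve α φ) *
        (Complex.normSq g' * c) by ring, hmul, show Complex.exp (levelCurve α φ) *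
      (d * (starRingEnd ℂ) g') = d * (Complex.exp (levelCurve α φ) * (starRingEnd ℂ) g') by ring,
      Complex.im_ofReal_mul, hg', exp_levelCurve, exp_mul_levelCurve,
      show (1 - α) * φ = φ - α * φ by ring, Real.sin_sub]
    simp only [Complex.mul_im, Complex.conj_re, Complex.conj_im, Complex.sub_re, Complex.sub_im,
      Complex.add_re, Complex.add_im, Complex.mul_re, Complex.ofReal_re,
      Complex.ofReal_im, Complex.I_re, Complex.I_im]
    ring
  have hpos : 0 < -d * (α * (Real.exp (levelLog α φ) * Real.exp (α * levelLog α φ) *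
        Real.sin ((1 - α) * φ))) := by
    have := Real.exp_pos (levelLog α φ)
    have := Real.exp_pos (α * levelLog α φ)
    have : 0 < -d := by linarith
    positivity
  rw [← key] at hpos
  exact (pos_iff_pos_of_mul_pos hpos).1 hns

lemma hankelPrim_im_ofReal {α : ℝ} (h0 : 0 < α) (r x : ℝ) : (hankelPrim α r x).im = 0 := by
  have hd : ∀ x : ℝ, HasDerivAt (fun x : ℝ => (hankelPrim α r x).im) 0 x := by
    intro x
    have := Complex.imCLM.hasFDerivAt.comp_hasDerivAt x
      (hasDerivAt_hankelPrim h0 (r : ℂ) (x : ℂ)).comp_ofReal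
    refine this.congr_deriv ?_
    have e : hankelForm α r x =
        ((Real.exp (-(r * (Real.exp x - Real.exp (α * x)))) * Real.exp x : ℝ) : ℂ) := by
      rw [hankelForm]; push_cast; rfl
    rw [e, Complex.imCLM_apply, Complex.ofReal_im]
  have hc : ∀ y, (hankelPrim α r x).im = (hankelPrim α r (y : ℝ)).im := fun y =>
    is_const_of_deriv_eq_zero (fun x => (hd x).differentiableAt) (fun x => (hd x).deriv) x y
  have ht := (Complex.continuous_im.tendsto 0).comp (tendsto_hankelPrim_ofReal_atBot h0 (r : ℂ))
  have : Tendsto (fun _ : ℝ => (hankelPrim α r x).im) atBot (𝓝 0) := by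
    refine (ht.congr fun y => ?_)
    exact (hc y).symm
  exact tendsto_const_nhds_iff.1 this

lemma tendsto_levelLog_pi {α : ℝ} (h0 : 0 < α) (h1 : α ≤ 1 / 2) :
    Tendsto (levelLog α) (𝓝[<] Real.pi) atTop := by
  have hα : 0 < Real.sin (α * Real.pi) := by
    rw [mul_comm]; exact sin_pi_mul_pos h0 h1
  have t1 : Tendsto (fun φ => Real.log (Real.sin (α * φ))) (𝓝[<] Real.pi)
      (𝓝 (Real.log (Real.sin (α * Real.pi)))) := by
    have : ContinuousAt (fun φ => Real.log (Real.sin (α * φ))) Real.pi :=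
      ContinuousAt.log (by fun_prop) hα.ne'
    exact this.tendsto.mono_left nhdsWithin_le_nhds
  have t2 : Tendsto (fun φ => Real.log (Real.sin φ)) (𝓝[<] Real.pi) atBot := by
    refine Real.tendsto_log_nhdsGT_zero.comp (tendsto_nhdsWithin_iff.2 ⟨?_, ?_⟩)
    · have := Real.continuous_sin.tendsto Real.pi
      rw [Real.sin_pi] at this
      exact this.mono_left nhdsWithin_le_nhds
    · filter_upwards [Ioo_mem_nhdsLT Real.pi_pos] with x hx
      exact Real.sin_pos_of_pos_of_lt_pi hx.1 hx.2
  have t3 := t1.add_atTop (tendsto_neg_atBot_atTop.comp t2)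
  exact t3.atTop_div_const (by linarith : 0 < 1 - α)

lemma tendsto_levelLog_zero {α : ℝ} (h0 : 0 < α) :
    Tendsto (levelLog α) (𝓝[>] 0) (𝓝 (Real.log α / (1 - α))) := by
  have s1 : Tendsto (fun φ : ℝ => Real.sin φ / φ) (𝓝[>] 0) (𝓝 1) := by
    have := (Real.hasDerivAt_sin 0).tendsto_slope
    rw [Real.cos_zero] at this
    refine (this.mono_left (nhdsGT_le_nhdsNE 0)).congr fun x => ?_
    rw [slope_def_field, Real.sin_zero, sub_zero, sub_zero]
  have s2 : Tendsto (fun φ : ℝ => Real.sin (α * φ) / φ) (𝓝[>] 0) (𝓝 α) := by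
    have e1 : HasDerivAt (fun φ : ℝ => Real.sin (α * φ)) (Real.cos (α * 0) * α) 0 := by
      simpa using ((hasDerivAt_id (0 : ℝ)).const_mul α).sin
    have := e1.tendsto_slope
    rw [mul_zero, Real.cos_zero, one_mul] at this
    refine (this.mono_left (nhdsGT_le_nhdsNE 0)).congr fun x => ?_
    rw [slope_def_field, mul_zero, Real.sin_zero, sub_zero, sub_zero]
  have s3 := ((s2.div s1 one_ne_zero).log (by rw [div_one]; exact h0.ne')).div_const (1 - α)
  rw [div_one] at s3
  refine s3.congr' ?_
  have hp := Real.pi_pos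
  filter_upwards [Ioo_mem_nhdsGT (show (0:ℝ) < min Real.pi (Real.pi / α) by positivity)] with x hx
  have hx1 : x < Real.pi := hx.2.trans_le (min_le_left _ _)
  have hx2 : x < Real.pi / α := hx.2.trans_le (min_le_right _ _)
  rw [lt_div_iff₀ h0, mul_comm] at hx2
  have p1 := Real.sin_pos_of_pos_of_lt_pi hx.1 hx1
  have p2 := Real.sin_pos_of_pos_of_lt_pi (mul_pos h0 hx.1) hx2
  have hx0 := hx.1.ne'
  rw [levelLog, ← Real.log_div p2.ne' p1.ne']
  congr 2
  simp only [Pi.div_apply]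
  field_simp

lemma exp_log_div_sub {α : ℝ} (h0 : 0 < α) (h1 : α ≤ 1 / 2) :
    Real.exp (Real.log α / (1 - α)) - Real.exp (α * (Real.log α / (1 - α))) =
      -stableDelta α := by
  have e1 : Real.exp (α * (Real.log α / (1 - α))) = α ^ (α / (1 - α)) := by
    rw [Real.rpow_def_of_pos h0]; ring_nf
  have e2 : Real.exp (Real.log α / (1 - α)) = α * α ^ (α / (1 - α)) := by
    rw [Real.rpow_def_of_pos h0]
    conv_rhs => rw [← Real.exp_log h0, Real.log_exp, ← Real.exp_add]
    rw [Real.exp_log h0]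
    congr 1
    have : 1 - α ≠ 0 := by linarith
    field_simp; ring
  rw [e1, e2, stableDelta]; ring

/-! ### Decay on the positive axis -/

section
variable {α : ℝ}

lemma sin_pos_of_mem_zero_pi (h0 : 0 < α) (h1 : α ≤ 1 / 2) {φ : ℝ} (hφ : φ ∈ Ioo 0 Real.pi) :
    0 < Real.sin φ ∧ 0 < Real.sin (α * φ) ∧ 0 < Real.sin ((1 - α) * φ) := by
  obtain ⟨a, b⟩ := hφ
  refine ⟨Real.sin_pos_of_pos_of_lt_pi a b, Real.sin_pos_of_pos_of_lt_pi (by positivity) ?_,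
    Real.sin_pos_of_pos_of_lt_pi (mul_pos (by linarith) a) ?_⟩ <;> nlinarith

/-- On the branch over `(0, π)` the phase decreases from its value `-δ` at the saddle point, which the
curve reaches as `φ → 0`. -/
lemma levelValue_le_neg_stableDelta (h0 : 0 < α) (h1 : α ≤ 1 / 2) {φ : ℝ}
    (hφ : φ ∈ Ioo 0 Real.pi) : levelValue α φ ≤ -stableDelta α := by
  have hA : StrictMonoOn (fun φ => -levelValue α φ) (Ioo 0 Real.pi) := by
    choose! c d hc hv hneg _ using fun φ (hφ : φ ∈ Ioo 0 Real.pi) =>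
      exists_hasDerivAt_levelCurve h1 (sin_pos_of_mem_zero_pi h0 h1 hφ).1
        (sin_pos_of_mem_zero_pi h0 h1 hφ).2.1
    exact strictMonoOn_Ioo_of_hasDerivAt_pos (fun x hx => (hv x hx).neg)
      fun x hx => neg_pos.2 (hneg x hx)
  have hl := tendsto_levelLog_zero h0
  have ht : Tendsto (levelValue α) (𝓝[>] 0) (𝓝 (-stableDelta α)) := by
    have c1 : Tendsto (fun φ : ℝ => Real.cos φ) (𝓝[>] 0) (𝓝 1) := by
      have := (Real.continuous_cos.tendsto 0).mono_left (nhdsWithin_le_nhds (s := Ioi 0))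
      rwa [Real.cos_zero] at this
    have c2 : Tendsto (fun φ : ℝ => Real.cos (α * φ)) (𝓝[>] 0) (𝓝 1) := by
      have hcont : Continuous fun φ : ℝ => Real.cos (α * φ) := by fun_prop
      have := (hcont.tendsto 0).mono_left (nhdsWithin_le_nhds (s := Ioi 0))
      simpa using this
    have := (((Real.continuous_exp.tendsto _).comp hl).mul c1).sub
      (((Real.continuous_exp.tendsto _).comp (hl.const_mul α)).mul c2)
    rw [mul_one, mul_one, exp_log_div_sub h0 h1] at this
    exact this
  refine ge_of_tendsto ht ?_
  filter_upwards [Ioo_mem_nhdsGT hφ.1] with x hx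
  have := hA ⟨hx.1, hx.2.trans hφ.2⟩ hφ hx.2
  simp only at this
  linarith

lemma tendsto_hankelPrim_levelCurve_zero (h0 : 0 < α) (r : ℝ) :
    Tendsto (fun φ => (hankelPrim α r (levelCurve α φ)).im) (𝓝[>] 0) (𝓝 0) := by
  have hc : Tendsto (levelCurve α) (𝓝[>] 0) (𝓝 ((Real.log α / (1 - α) : ℝ) : ℂ)) := by
    have e1 := (Complex.continuous_ofReal.tendsto _).comp (tendsto_levelLog_zero h0)
    have e2 : Tendsto (fun φ : ℝ => (φ : ℂ) * Complex.I) (𝓝[>] 0) (𝓝 0) := by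
      have : Continuous fun φ : ℝ => (φ : ℂ) * Complex.I := by fun_prop
      have := (this.tendsto 0).mono_left (nhdsWithin_le_nhds (s := Ioi 0))
      simpa using this
    simpa using! e1.add e2
  have := (Complex.continuous_im.tendsto _).comp
    ((hasDerivAt_hankelPrim h0 (r : ℂ) _).continuousAt.tendsto.comp hc)
  rw [hankelPrim_im_ofReal h0] at this
  exact this

/-- As `φ → π` the curve goes to infinity, where `hankelPrim` does not distinguish it from the negative
ray; on that ray it is a value of `powLaplace`. -/
lemma tendsto_hankelPrim_levelCurve_pi (h0 : 0 < α) (h1 : α ≤ 1 / 2) {x : ℝ} (hx : 0 < x) :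
    Tendsto (fun φ => hankelPrim α ((-x : ℝ) : ℂ) (levelCurve α φ)) (𝓝[<] Real.pi)
      (𝓝 (-(((x⁻¹ : ℝ) : ℂ) * powLaplace α
        (((x ^ (1 - α) : ℝ) : ℂ) * Complex.exp ((α * Real.pi : ℝ) * Complex.I))))) := by
  have hlog := tendsto_levelLog_pi h0 h1
  have hp := Real.pi_pos
  have hr : ((-x : ℝ) : ℂ) * Complex.exp (Real.pi * Complex.I) = (x : ℂ) := by
    rw [Complex.exp_pi_mul_I]; push_cast; ring
  have t1 := (tendsto_hankelPrim_powLaplace h0 h1 ((-x : ℝ) : ℂ) hx hr).comp hlog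
  have t2 := tendsto_hankelPrim_sub_atTop h0 h1 ((-x : ℝ) : ℂ) (l := 𝓝[<] Real.pi)
    (X := levelLog α) (Y := id) (k := x / 2) (M := Real.pi) (y₀ := Real.pi) (by linarith) hlog ?_
  · have t3 := t2.add t1
    rw [zero_add] at t3
    convert t3 using 1
    · ext φ; simp [levelCurve]
    · rw [Complex.exp_pi_mul_I, show x ^ (1 - α) = x * x ^ (-α) by
        rw [sub_eq_add_neg, Real.rpow_add hx, Real.rpow_one]]
      push_cast; ring_nf
  · filter_upwards [Ioo_mem_nhdsLT (show 2 * Real.pi / 3 < Real.pi by linarith)] with φ hφ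
    refine ⟨by rw [abs_le]; constructor <;> simp only [id] <;> linarith [hφ.1, hφ.2], ?_⟩
    intro y hy
    rw [id, uIcc_of_ge hφ.2.le] at hy
    have hy1 : 2 * Real.pi / 3 ≤ y := hφ.1.le.trans hy.1
    have hcos : Real.cos y ≤ -(1 / 2) := by
      have := Real.cos_le_cos_of_nonneg_of_le_pi (by linarith) hy.2 hy1
      rwa [show 2 * Real.pi / 3 = Real.pi - Real.pi / 3 by ring, Real.cos_pi_sub,
        Real.cos_pi_div_three] at this
    rw [Complex.re_ofReal_mul, Complex.exp_ofReal_mul_I_re]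
    nlinarith

/-- The imaginary part of `S` on the ray of argument `πα`, which carries the values of `stableG α`
on the positive axis, is found by moving the path of integration to the curve `levelCurve`, on
which `s - s^α ≤ -δ`. -/
lemma im_powLaplace_bound (h0 : 0 < α) (h1 : α ≤ 1 / 2) : ∃ C, 0 ≤ C ∧ ∀ x : ℝ, 1 ≤ x →
    |x⁻¹ * (powLaplace α (((x ^ (1 - α) : ℝ) : ℂ) *
      Complex.exp ((α * Real.pi : ℝ) * Complex.I))).im| ≤ C * Real.exp (-(stableDelta α * x)) := by
  set J : ℝ → ℝ := fun x => x⁻¹ * (powLaplace α (((x ^ (1 - α) : ℝ) : ℂ) *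
      Complex.exp ((α * Real.pi : ℝ) * Complex.I))).im with hJ
  choose! c d hc hv hneg hgc hpos using fun φ (hφ : φ ∈ Ioo 0 Real.pi) =>
      exists_hasDerivAt_levelCurve h1 (sin_pos_of_mem_zero_pi h0 h1 hφ).1
        (sin_pos_of_mem_zero_pi h0 h1 hφ).2.1
  set q : ℝ → ℝ := fun φ => (Complex.exp (levelCurve α φ) * c φ).im
  have hq : ∀ φ ∈ Ioo 0 Real.pi, 0 < q φ := fun φ hφ =>
    hpos φ hφ h0 (sin_pos_of_mem_zero_pi h0 h1 hφ).2.2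
  have hder : ∀ x : ℝ, ∀ φ ∈ Ioo 0 Real.pi,
      HasDerivAt (fun φ => (hankelPrim α ((-x : ℝ) : ℂ) (levelCurve α φ)).im)
        (Real.exp (x * levelValue α φ) * q φ) φ := by
    intro x φ hφ
    have e1 := (hasDerivAt_hankelPrim h0 ((-x : ℝ) : ℂ) (levelCurve α φ)).comp φ (hc φ hφ)
    have e2 := Complex.imCLM.hasFDerivAt.comp_hasDerivAt φ e1
    refine e2.congr_deriv ?_
    obtain ⟨s1, s2, _⟩ := sin_pos_of_mem_zero_pi h0 h1 hφ
    rw [hankelForm_levelCurve h1 s1 s2, Complex.imCLM_apply, mul_assoc, Complex.im_ofReal_mul]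
    simp [q]
  have hz : ∀ x : ℝ, Tendsto (fun φ => (hankelPrim α ((-x : ℝ) : ℂ) (levelCurve α φ)).im)
      (𝓝[>] 0) (𝓝 0) := fun x => tendsto_hankelPrim_levelCurve_zero h0 (-x)
  have hp : ∀ x : ℝ, 0 < x → Tendsto (fun φ =>
      (hankelPrim α ((-x : ℝ) : ℂ) (levelCurve α φ)).im) (𝓝[<] Real.pi) (𝓝 (-J x)) := by
    intro x hx
    have := (Complex.continuous_im.tendsto _).comp (tendsto_hankelPrim_levelCurve_pi h0 h1 hx)
    rwa [Complex.neg_im, Complex.im_ofReal_mul] at this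
  refine ⟨-J 1 * Real.exp (stableDelta α), ?_, fun x hx => ?_⟩
  · have := le_of_hasDerivAt_nonneg_of_tendsto Real.pi_pos (hder 1)
      (fun φ hφ => (mul_pos (Real.exp_pos _) (hq φ hφ)).le) (hz 1) (hp 1 one_pos)
    exact mul_nonneg this (Real.exp_pos _).le
  · have hx0 : 0 < x := by linarith
    have a1 := le_of_hasDerivAt_nonneg_of_tendsto Real.pi_pos (hder x)
      (fun φ hφ => (mul_pos (Real.exp_pos _) (hq φ hφ)).le) (hz x) (hp x hx0)
    set E := Real.exp (-(stableDelta α * (x - 1))) with hE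
    -- the integrand for `x` is at most `E` times that for `1`, since the phase is at most `-δ`
    have a2 := le_of_hasDerivAt_nonneg_of_tendsto Real.pi_pos
      (fun φ hφ => ((hder 1 φ hφ).const_mul E).sub (hder x φ hφ))
      (fun φ hφ => ?_) (((hz 1).const_mul E).sub (hz x)) (((hp 1 one_pos).const_mul E).sub (hp x hx0))
    · change |J x| ≤ _
      rw [abs_of_nonpos (by linarith)]
      have : -J 1 * Real.exp (stableDelta α) * Real.exp (-(stableDelta α * x)) = E * -J 1 := by
        rw [mul_assoc, ← Real.exp_add, hE]; ring_nf
      rw [this]; linarith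
    · have hle := levelValue_le_neg_stableDelta h0 h1 hφ
      have : Real.exp (x * levelValue α φ) ≤ E * Real.exp (1 * levelValue α φ) := by
        rw [hE, ← Real.exp_add, Real.exp_le_exp]
        nlinarith
      have := mul_le_mul_of_nonneg_right this (hq φ hφ).le
      linarith
end

/-! ### The slope of the chord -/

section
variable {α : ℝ}

lemma pi_div_bounds (h0 : 1 / 3 < α) (h1 : α < 1 / 2) :
    2 * Real.pi < Real.pi / α ∧ Real.pi / α < 3 * Real.pi := by
  have hp := Real.pi_pos
  rw [lt_div_iff₀ (by linarith), div_lt_iff₀ (by linarith)]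
  constructor <;> nlinarith

lemma mem_Ioo_two_pi (h0 : 1 / 3 < α) (h1 : α < 1 / 2) {φ : ℝ}
    (hφ : φ ∈ Ioo (2 * Real.pi) (Real.pi / α)) :
    2 * Real.pi < φ ∧ φ < 3 * Real.pi ∧ 2 * Real.pi * α < α * φ ∧ α * φ < Real.pi ∧
      φ - 2 * Real.pi < α * φ := by
  have hb := pi_div_bounds h0 h1
  have hp := Real.pi_pos
  have h2 := hφ.2
  rw [lt_div_iff₀ (by linarith)] at h2
  refine ⟨hφ.1, hφ.2.trans hb.2, by nlinarith [hφ.1], by linarith, ?_⟩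
  have : (1 - α) * φ < 2 * Real.pi := by
    have h3 : α * ((1 - α) * φ) < α * (2 * Real.pi) := by nlinarith
    exact lt_of_mul_lt_mul_left h3 (by linarith)
  linarith

lemma sin_pos_of_mem_two_pi {x : ℝ} (h1 : 2 * Real.pi < x) (h2 : x < 3 * Real.pi) :
    0 < Real.sin x := by
  rw [← Real.sin_sub_two_pi]
  exact Real.sin_pos_of_pos_of_lt_pi (by linarith) (by linarith)

lemma sin_pos_of_mem_Ioo_two_pi (h0 : 1 / 3 < α) (h1 : α < 1 / 2) {φ : ℝ}
    (hφ : φ ∈ Ioo (2 * Real.pi) (Real.pi / α)) :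
    0 < Real.sin φ ∧ 0 < Real.sin (α * φ) ∧ Real.cos (α * φ) < 0 := by
  obtain ⟨a, b, c, d, e⟩ := mem_Ioo_two_pi h0 h1 hφ
  have hp := Real.pi_pos
  refine ⟨sin_pos_of_mem_two_pi a b, Real.sin_pos_of_pos_of_lt_pi (by nlinarith) d,
    Real.cos_neg_of_pi_div_two_lt_of_lt (by nlinarith) (by linarith)⟩

lemma cot_sub_cot_pos {x y : ℝ} (hx : 0 < Real.sin x) (hy : 0 < Real.sin y)
    (hxy : 0 < Real.sin (y - x)) :
    0 < Real.cos x / Real.sin x - Real.cos y / Real.sin y := by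
  have : Real.cos x / Real.sin x - Real.cos y / Real.sin y =
      Real.sin (y - x) / (Real.sin x * Real.sin y) := by
    rw [Real.sin_sub]; field_simp
  rw [this]; positivity

/-- The relation between the argument `φ` of a point of the curve and the angle `β` under which the
corresponding chord is seen. -/
noncomputable def chordRel (α φ β : ℝ) : ℝ :=
  (1 - α) * Real.log (Real.sin β) + α * Real.log (Real.sin (φ + β)) -
    Real.log (Real.sin (α * φ + β))

/-- `chordRel` is strictly increasing in both variables; this is where `α > 1/3` is decisive, as it
gives `φ - 2π < αφ` for all `φ < π/α`. -/
lemma chordRel_lt (h0 : 1 / 3 < α) (h1 : α < 1 / 2) {φ₁ φ₂ β₁ β₂ : ℝ}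
    (hφ₁ : φ₁ ∈ Ioo (2 * Real.pi) (Real.pi / α)) (hφ₂ : φ₂ ∈ Ioo (2 * Real.pi) (Real.pi / α))
    (hφ : φ₁ < φ₂) (hβ : β₁ ≤ β₂) (hβ₁ : 0 < β₁)
    (hs : φ₂ + β₂ < 3 * Real.pi) (hs' : α * φ₂ + β₂ < Real.pi) :
    chordRel α φ₁ β₁ < chordRel α φ₂ β₂ := by
  have hp := Real.pi_pos
  set x := φ₂ - φ₁ with hx
  set y := β₂ - β₁ with hy
  have hx0 : 0 < x := by rw [hx]; linarith
  have hy0 : 0 ≤ y := by rw [hy]; linarith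
  have hα : 0 < α := by linarith
  have main : ∀ s ∈ Icc (0 : ℝ) 1, ∃ d, 0 < d ∧
      HasDerivAt (fun s => chordRel α (φ₁ + s * x) (β₁ + s * y)) d s := by
    intro s hs01
    have hφs : φ₁ + s * x ∈ Ioo (2 * Real.pi) (Real.pi / α) := by
      have e1 : 0 ≤ s * x := mul_nonneg hs01.1 hx0.le
      have e2 : s * x ≤ x := mul_le_of_le_one_left hx0.le hs01.2
      exact ⟨by linarith [hφ₁.1], by linarith [hφ₂.2]⟩
    have hsx : s * x ≤ x := mul_le_of_le_one_left hx0.le hs01.2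
    have hsy : s * y ≤ y := mul_le_of_le_one_left hy0 hs01.2
    have hsy0 : 0 ≤ s * y := mul_nonneg hs01.1 hy0
    set φ := φ₁ + s * x with hφ_def
    set β := β₁ + s * y with hβ_def
    obtain ⟨a, b, c, d, e⟩ := mem_Ioo_two_pi h0 h1 hφs
    have hβ0 : 0 < β := by linarith
    have hle1 : φ + β < 3 * Real.pi := by linarith
    have hle2 : α * φ + β < Real.pi := by
      have : α * φ ≤ α * φ₂ := mul_le_mul_of_nonneg_left (by linarith) hα.le
      linarith
    have hαφ : 0 < α * φ := by nlinarith
    have s1 : 0 < Real.sin β := Real.sin_pos_of_pos_of_lt_pi hβ0 (by linarith)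
    have s2 : 0 < Real.sin (φ + β) := sin_pos_of_mem_two_pi (by linarith) hle1
    have s3 : 0 < Real.sin (α * φ + β) := Real.sin_pos_of_pos_of_lt_pi (by linarith) hle2
    have k1 : 0 < Real.cos β / Real.sin β - Real.cos (α * φ + β) / Real.sin (α * φ + β) := by
      apply cot_sub_cot_pos s1 s3
      rw [add_sub_cancel_right]
      exact Real.sin_pos_of_pos_of_lt_pi hαφ d
    have k2 : 0 < Real.cos (φ + β) / Real.sin (φ + β) -
        Real.cos (α * φ + β) / Real.sin (α * φ + β) := by
      apply cot_sub_cot_pos s2 s3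
      rw [← Real.sin_add_two_pi]
      exact Real.sin_pos_of_pos_of_lt_pi (by linarith) (by linarith)
    have d1 : HasDerivAt (fun s => φ₁ + s * x) x s := by
      simpa using ((hasDerivAt_id s).mul_const x).const_add φ₁
    have d2 : HasDerivAt (fun s => β₁ + s * y) y s := by
      simpa using ((hasDerivAt_id s).mul_const y).const_add β₁
    have g1 := (d2.sin.log s1.ne').const_mul (1 - α)
    have g2 := ((d1.add d2).sin.log s2.ne').const_mul α
    have g3 := ((d1.const_mul α).add d2).sin.log s3.ne'
    refine ⟨_, ?_, (g1.add g2).sub g3⟩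
    have expand : (1 - α) * (Real.cos β * y / Real.sin β) +
        α * (Real.cos (φ + β) * (x + y) / Real.sin (φ + β)) -
        Real.cos (α * φ + β) * (α * x + y) / Real.sin (α * φ + β) =
        y * ((1 - α) * (Real.cos β / Real.sin β - Real.cos (α * φ + β) / Real.sin (α * φ + β)) +
          α * (Real.cos (φ + β) / Real.sin (φ + β) -
            Real.cos (α * φ + β) / Real.sin (α * φ + β))) +
        α * x * (Real.cos (φ + β) / Real.sin (φ + β) -
            Real.cos (α * φ + β) / Real.sin (α * φ + β)) := by ring
    change 0 < (1 - α) * (Real.cos β * y / Real.sin β) +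
        α * (Real.cos (φ + β) * (x + y) / Real.sin (φ + β)) -
        Real.cos (α * φ + β) * (α * x + y) / Real.sin (α * φ + β)
    rw [expand]
    have : 0 < 1 - α := by linarith
    exact add_pos_of_nonneg_of_pos
      (mul_nonneg hy0 (add_nonneg (mul_pos this k1).le (mul_pos hα k2).le))
      (mul_pos (mul_pos hα hx0) k2)
  choose! d hd hder using main
  have hm : StrictMonoOn (fun s => chordRel α (φ₁ + s * x) (β₁ + s * y)) (Icc 0 1) := by
    refine strictMonoOn_of_deriv_pos (convex_Icc 0 1)
      (fun s hs => (hder s hs).continuousAt.continuousWithinAt) ?_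
    rw [interior_Icc]
    intro s hs
    rw [(hder s (Ioo_subset_Icc_self hs)).deriv]; exact hd s (Ioo_subset_Icc_self hs)
  have := hm (left_mem_Icc.2 zero_le_one) (right_mem_Icc.2 zero_le_one) one_pos
  simpa [hx, hy] using this

/-- The function `u - u^α` has slope at least `1 - α` on `[1, ∞)`. -/
lemma sub_rpow_le (h0 : 0 < α) (h1 : α ≤ 1 / 2) {u v : ℝ} (hu : 1 ≤ u) (huv : u ≤ v) :
    (1 - α) * (v - u) ≤ (v - v ^ α) - (u - u ^ α) := by
  have hu0 : 0 < u := by linarith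
  have hb := rpow_one_add_le_one_add_mul_self (s := v / u - 1) (p := α)
    (by have : 0 ≤ v / u := div_nonneg (by linarith) hu0.le
        linarith) h0.le (by linarith)
  rw [add_sub_cancel, Real.div_rpow (by linarith) hu0.le, div_le_iff₀ (by positivity)] at hb
  have hle : u ^ α ≤ u := by
    have := Real.rpow_le_rpow_of_exponent_le hu (show α ≤ 1 by linarith)
    rwa [Real.rpow_one] at this
  have e : (1 + α * (v / u - 1)) * u ^ α = u ^ α + α * (v - u) * (u ^ α / u) := by
    field_simp
  have : u ^ α / u ≤ 1 := by rwa [div_le_one hu0]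
  have h3 : α * (v - u) * (u ^ α / u) ≤ α * (v - u) * 1 := by
    gcongr
  linarith

lemma exists_sub_rpow_eq (h0 : 0 < α) (h1 : α ≤ 1 / 2) {t : ℝ} (ht : 0 ≤ t) :
    ∃ u, 1 ≤ u ∧ u - u ^ α = t := by
  have hc : ContinuousOn (fun u : ℝ => u - u ^ α) (Icc 1 (1 + t / (1 - α))) :=
    continuousOn_id.sub (continuousOn_id.rpow_const fun x _ => Or.inr h0.le)
  have h2 : 1 ≤ 1 + t / (1 - α) := by
    have : 0 ≤ t / (1 - α) := div_nonneg ht (by linarith)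
    linarith
  have h3 := sub_rpow_le h0 h1 le_rfl h2
  have h4 : (1 - α) * (1 + t / (1 - α) - 1) = t := by
    have : 1 - α ≠ 0 := by linarith
    field_simp; ring
  obtain ⟨u, hu, he⟩ := intermediate_value_Icc h2 hc
    (show t ∈ Icc _ _ from ⟨by simpa using ht, by
      rw [h4] at h3; simp only [Real.one_rpow] at h3 ⊢; linarith⟩)
  exact ⟨u, hu.1, he⟩

/-- The solution `u ≥ 1` of `u - u^α = t`, for `t ≥ 0`. -/
noncomputable def upperRoot (α t : ℝ) : ℝ := Classical.epsilon fun u => 1 ≤ u ∧ u - u ^ α = t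

lemma upperRoot_spec (h0 : 0 < α) (h1 : α ≤ 1 / 2) {t : ℝ} (ht : 0 ≤ t) :
    1 ≤ upperRoot α t ∧ upperRoot α t - upperRoot α t ^ α = t :=
  Classical.epsilon_spec (exists_sub_rpow_eq h0 h1 ht)

lemma abs_upperRoot_sub_le (h0 : 0 < α) (h1 : α ≤ 1 / 2) {s t : ℝ} (hs : 0 ≤ s) (ht : 0 ≤ t) :
    (1 - α) * |upperRoot α t - upperRoot α s| ≤ |t - s| := by
  obtain ⟨a, b⟩ := upperRoot_spec h0 h1 hs
  obtain ⟨c, d⟩ := upperRoot_spec h0 h1 ht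
  rcases le_total (upperRoot α s) (upperRoot α t) with h | h
  · have := sub_rpow_le h0 h1 a h
    rw [b, d] at this
    rw [abs_of_nonneg (by linarith)]
    exact this.trans (le_abs_self _)
  · have := sub_rpow_le h0 h1 c h
    rw [b, d] at this
    rw [abs_of_nonpos (by linarith)]
    have := this.trans (neg_abs_le (t - s) |> fun h => by linarith : s - t ≤ |t - s|)
    linarith

lemma tendsto_upperRoot (h0 : 0 < α) (h1 : α ≤ 1 / 2) {ι : Type*} {l : Filter ι} {f : ι → ℝ}
    {t : ℝ} (ht : 0 ≤ t) (hf : Tendsto f l (𝓝 t)) (hf0 : ∀ᶠ i in l, 0 ≤ f i) :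
    Tendsto (fun i => upperRoot α (f i)) l (𝓝 (upperRoot α t)) := by
  rw [tendsto_iff_norm_sub_tendsto_zero] at hf ⊢
  have h2 := hf.const_mul (1 - α)⁻¹
  rw [mul_zero] at h2
  refine squeeze_zero' (Eventually.of_forall fun _ => norm_nonneg _) ?_ h2
  filter_upwards [hf0] with i hi
  have := abs_upperRoot_sub_le h0 h1 ht hi
  rw [← div_eq_inv_mul, le_div_iff₀ (by linarith), mul_comm]
  exact this

lemma hasDerivAt_upperRoot (h0 : 0 < α) (h1 : α ≤ 1 / 2) {t : ℝ} (ht : 0 < t) :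
    HasDerivAt (upperRoot α) (1 - α * upperRoot α t ^ (α - 1))⁻¹ t := by
  obtain ⟨a, b⟩ := upperRoot_spec h0 h1 ht.le
  have hu : 0 < upperRoot α t := by linarith
  have hc : ContinuousAt (upperRoot α) t := by
    refine tendsto_upperRoot h0 h1 ht.le tendsto_id ?_
    filter_upwards [lt_mem_nhds ht] with s hs using hs.le
  have hd : HasDerivAt (fun u : ℝ => u - u ^ α) (1 - α * upperRoot α t ^ (α - 1))
      (upperRoot α t) :=
    (hasDerivAt_id _).sub (Real.hasDerivAt_rpow_const (Or.inl hu.ne'))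
  refine HasDerivAt.of_local_left_inverse hc hd ?_ ?_
  · have : upperRoot α t ^ (α - 1) ≤ 1 := Real.rpow_le_one_of_one_le_of_nonpos a (by linarith)
    nlinarith
  · filter_upwards [lt_mem_nhds ht] with s hs
    exact (upperRoot_spec h0 h1 hs.le).2

lemma strictAntiOn_levelValue (h0 : 1 / 3 < α) (h1 : α < 1 / 2) :
    StrictAntiOn (levelValue α) (Ioo (2 * Real.pi) (Real.pi / α)) := by
  choose! c d hc hv hneg _ using fun φ (hφ : φ ∈ Ioo (2 * Real.pi) (Real.pi / α)) =>
    exists_hasDerivAt_levelCurve h1.le (sin_pos_of_mem_Ioo_two_pi h0 h1 hφ).1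
      (sin_pos_of_mem_Ioo_two_pi h0 h1 hφ).2.1
  have := strictMonoOn_Ioo_of_hasDerivAt_pos (fun x hx => (hv x hx).neg)
    fun x hx => neg_pos.2 (hneg x hx)
  intro x hx y hy hxy
  have := this hx hy hxy
  simpa using this

lemma tendsto_log_sin_two_pi :
    Tendsto (fun φ => Real.log (Real.sin φ)) (𝓝[>] (2 * Real.pi)) atBot := by
  refine Real.tendsto_log_nhdsGT_zero.comp (tendsto_nhdsWithin_iff.2 ⟨?_, ?_⟩)
  · have := Real.continuous_sin.tendsto (2 * Real.pi)
    rw [Real.sin_two_pi] at this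
    exact this.mono_left nhdsWithin_le_nhds
  · filter_upwards [Ioo_mem_nhdsGT (show 2 * Real.pi < 3 * Real.pi by linarith [Real.pi_pos])]
      with x hx
    exact sin_pos_of_mem_two_pi hx.1 hx.2

lemma tendsto_levelLog_two_pi (h0 : 1 / 3 < α) (h1 : α < 1 / 2) :
    Tendsto (levelLog α) (𝓝[>] (2 * Real.pi)) atTop := by
  have hp := Real.pi_pos
  have hα : 0 < Real.sin (α * (2 * Real.pi)) :=
    Real.sin_pos_of_pos_of_lt_pi (by nlinarith) (by nlinarith)
  have t1 : Tendsto (fun φ => Real.log (Real.sin (α * φ))) (𝓝[>] (2 * Real.pi))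
      (𝓝 (Real.log (Real.sin (α * (2 * Real.pi))))) := by
    have : ContinuousAt (fun φ => Real.log (Real.sin (α * φ))) (2 * Real.pi) :=
      ContinuousAt.log (by fun_prop) hα.ne'
    exact this.tendsto.mono_left nhdsWithin_le_nhds
  exact (t1.add_atTop (tendsto_neg_atBot_atTop.comp tendsto_log_sin_two_pi)).atTop_div_const
    (by linarith : 0 < 1 - α)

lemma tendsto_levelLog_pi_div (h0 : 1 / 3 < α) (h1 : α < 1 / 2) :
    Tendsto (levelLog α) (𝓝[<] (Real.pi / α)) atBot := by
  have hp := Real.pi_pos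
  have hb := pi_div_bounds h0 h1
  have hs : 0 < Real.sin (Real.pi / α) := sin_pos_of_mem_two_pi hb.1 hb.2
  have t1 : Tendsto (fun φ => Real.log (Real.sin φ)) (𝓝[<] (Real.pi / α))
      (𝓝 (Real.log (Real.sin (Real.pi / α)))) := by
    have : ContinuousAt (fun φ => Real.log (Real.sin φ)) (Real.pi / α) :=
      ContinuousAt.log (by fun_prop) hs.ne'
    exact this.tendsto.mono_left nhdsWithin_le_nhds
  have t2 : Tendsto (fun φ => Real.log (Real.sin (α * φ))) (𝓝[<] (Real.pi / α)) atBot := by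
    refine Real.tendsto_log_nhdsGT_zero.comp (tendsto_nhdsWithin_iff.2 ⟨?_, ?_⟩)
    · have hcont : Continuous fun φ : ℝ => Real.sin (α * φ) := by fun_prop
      have := hcont.tendsto (Real.pi / α)
      rw [mul_div_cancel₀ _ (by linarith : α ≠ 0), Real.sin_pi] at this
      exact this.mono_left nhdsWithin_le_nhds
    · filter_upwards [Ioo_mem_nhdsLT hb.1] with x hx
      exact (sin_pos_of_mem_Ioo_two_pi h0 h1 hx).2.1
  have t3 := t2.atBot_add t1.neg
  exact t3.atBot_div_const (by linarith : 0 < 1 - α)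

lemma tendsto_exp_mul_levelLog_pi_div (h0 : 1 / 3 < α) (h1 : α < 1 / 2) {c : ℝ} (hc : 0 < c) :
    Tendsto (fun φ => Real.exp (c * levelLog α φ)) (𝓝[<] (Real.pi / α)) (𝓝 0) :=
  Real.tendsto_exp_atBot.comp ((tendsto_levelLog_pi_div h0 h1).const_mul_atBot hc)

lemma tendsto_levelValue_pi_div (h0 : 1 / 3 < α) (h1 : α < 1 / 2) :
    Tendsto (levelValue α) (𝓝[<] (Real.pi / α)) (𝓝 0) := by
  have t1 := tendsto_exp_mul_levelLog_pi_div h0 h1 one_pos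
  have t2 := tendsto_exp_mul_levelLog_pi_div h0 h1 (by linarith : 0 < α)
  have t3 := t1.add t2
  rw [add_zero] at t3
  refine squeeze_zero_norm (fun φ => ?_) t3
  rw [levelValue, one_mul]
  refine (norm_sub_le _ _).trans (add_le_add ?_ ?_) <;>
  · rw [norm_mul, Real.norm_of_nonneg (Real.exp_pos _).le]
    exact mul_le_of_le_one_right (Real.exp_pos _).le (Real.abs_cos_le_one _)

lemma levelValue_pos (h0 : 1 / 3 < α) (h1 : α < 1 / 2) {φ : ℝ}
    (hφ : φ ∈ Ioo (2 * Real.pi) (Real.pi / α)) : 0 < levelValue α φ := by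
  have hmid : (φ + Real.pi / α) / 2 ∈ Ioo (2 * Real.pi) (Real.pi / α) :=
    ⟨by linarith [hφ.1, hφ.2], by linarith [hφ.2]⟩
  have h2 := strictAntiOn_levelValue h0 h1 hφ hmid (by linarith [hφ.2])
  refine lt_of_le_of_lt ?_ h2
  refine le_of_tendsto (tendsto_levelValue_pi_div h0 h1) ?_
  filter_upwards [Ioo_mem_nhdsLT hmid.2] with x hx
  exact (strictAntiOn_levelValue h0 h1 hmid ⟨hmid.1.trans hx.1, hx.2⟩ hx.1).le

lemma tendsto_levelValue_two_pi (h0 : 1 / 3 < α) (h1 : α < 1 / 2) :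
    Tendsto (levelValue α) (𝓝[>] (2 * Real.pi)) atTop := by
  have hb := pi_div_bounds h0 h1
  have c1 : Tendsto (fun φ : ℝ => Real.cos φ) (𝓝[>] (2 * Real.pi)) (𝓝 1) := by
    have := (Real.continuous_cos.tendsto (2 * Real.pi)).mono_left
      (nhdsWithin_le_nhds (s := Ioi (2 * Real.pi)))
    rwa [Real.cos_two_pi] at this
  have t := (Real.tendsto_exp_atTop.comp (tendsto_levelLog_two_pi h0 h1)).atTop_mul_pos one_pos c1
  refine tendsto_atTop_mono' _ ?_ t
  filter_upwards [Ioo_mem_nhdsGT hb.1] with φ hφ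
  have := (sin_pos_of_mem_Ioo_two_pi h0 h1 hφ).2.2
  have h3 := Real.exp_pos (α * levelLog α φ)
  simp only [Function.comp_apply, levelValue]
  nlinarith

/-- The real part of the chord from a point of the curve to the real point `u ≥ 1` at which
`s - s^α` takes the same value. -/
noncomputable def chordRe (α φ : ℝ) : ℝ :=
  upperRoot α (levelValue α φ) - Real.exp (levelLog α φ) * Real.cos φ

/-- The imaginary part of a point of the curve. -/
noncomputable def chordIm (α φ : ℝ) : ℝ := Real.exp (levelLog α φ) * Real.sin φ

lemma chordIm_pos (h0 : 1 / 3 < α) (h1 : α < 1 / 2) {φ : ℝ}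
    (hφ : φ ∈ Ioo (2 * Real.pi) (Real.pi / α)) : 0 < chordIm α φ :=
  mul_pos (Real.exp_pos _) (sin_pos_of_mem_Ioo_two_pi h0 h1 hφ).1

lemma chordRe_pos (h0 : 1 / 3 < α) (h1 : α < 1 / 2) {φ : ℝ}
    (hφ : φ ∈ Ioo (2 * Real.pi) (Real.pi / α)) : 0 < chordRe α φ := by
  obtain ⟨a, b⟩ := upperRoot_spec (by linarith : 0 < α) h1.le (levelValue_pos h0 h1 hφ).le
  have hcos := (sin_pos_of_mem_Ioo_two_pi h0 h1 hφ).2.2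
  have h3 := Real.exp_pos (α * levelLog α φ)
  have h4 := Real.rpow_pos_of_pos (by linarith : 0 < upperRoot α (levelValue α φ)) α
  rw [chordRe]
  have : levelValue α φ = Real.exp (levelLog α φ) * Real.cos φ -
    Real.exp (α * levelLog α φ) * Real.cos (α * φ) := rfl
  nlinarith

/-- The angle `β` of the chord satisfies `chordRel α φ β = 0`: by the law of sines in the triangles
`0, u, s` and `0, u^α, s^α`, whose sides opposite to `0` are parallel since `u - s = u^α - s^α`. -/
lemma chordRel_eq_zero (h0 : 1 / 3 < α) (h1 : α < 1 / 2) {φ : ℝ}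
    (hφ : φ ∈ Ioo (2 * Real.pi) (Real.pi / α)) {β : ℝ}
    (hβ : β = Real.arctan (chordIm α φ / chordRe α φ)) :
    0 < β ∧ φ + β < 3 * Real.pi ∧ α * φ + β < Real.pi ∧ chordRel α φ β = 0 := by
  have hα : 0 < α := by linarith
  have hp := Real.pi_pos
  have hn := chordRe_pos h0 h1 hφ
  have hm := chordIm_pos h0 h1 hφ
  obtain ⟨a, b, c, d, e⟩ := mem_Ioo_two_pi h0 h1 hφ
  obtain ⟨s1, s2, _⟩ := sin_pos_of_mem_Ioo_two_pi h0 h1 hφ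
  obtain ⟨hu1, hu⟩ := upperRoot_spec hα h1.le (levelValue_pos h0 h1 hφ).le
  have hβ0 : 0 < β := by rw [hβ]; exact Real.arctan_pos.2 (by positivity)
  have hβ1 : β < Real.pi / 2 := by rw [hβ]; exact Real.arctan_lt_pi_div_two _
  have hcos : 0 < Real.cos β := Real.cos_pos_of_mem_Ioo ⟨by linarith, hβ1⟩
  have hsin : 0 < Real.sin β := Real.sin_pos_of_pos_of_lt_pi hβ0 (by linarith)
  have htan : chordRe α φ * Real.sin β = chordIm α φ * Real.cos β := by
    have : Real.tan β = chordIm α φ / chordRe α φ := by rw [hβ, Real.tan_arctan]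
    rw [Real.tan_eq_sin_div_cos, div_eq_div_iff hcos.ne' hn.ne'] at this
    linarith
  have hlev := exp_levelLog_mul_sin h1.le s1 s2
  set u := upperRoot α (levelValue α φ) with hu_def
  have hu0 : 0 < u := by linarith
  set ρ := Real.exp (levelLog α φ) with hρ
  set ρ' := Real.exp (α * levelLog α φ) with hρ'
  have hρ0 : 0 < ρ := Real.exp_pos _
  have hρ0' : 0 < ρ' := Real.exp_pos _
  have hv : levelValue α φ = ρ * Real.cos φ - ρ' * Real.cos (α * φ) := rfl
  have hnr : chordRe α φ = u - ρ * Real.cos φ := rfl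
  have him : chordIm α φ = ρ * Real.sin φ := rfl
  have r1 : u * Real.sin β = ρ * Real.sin (φ + β) := by
    rw [Real.sin_add]; rw [hnr, him] at htan; linarith
  have r2 : u ^ α * Real.sin β = ρ' * Real.sin (α * φ + β) := by
    rw [Real.sin_add]
    have hnr' : chordRe α φ = u ^ α - ρ' * Real.cos (α * φ) := by linarith
    rw [hnr', him, hlev] at htan; linarith
  have p1 : 0 < Real.sin (φ + β) := by
    have : 0 < ρ * Real.sin (φ + β) := by rw [← r1]; positivity
    exact (pos_iff_pos_of_mul_pos this).1 hρ0
  have p2 : 0 < Real.sin (α * φ + β) := by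
    have : 0 < ρ' * Real.sin (α * φ + β) := by rw [← r2]; positivity
    exact (pos_iff_pos_of_mul_pos this).1 hρ0'
  refine ⟨hβ0, ?_, ?_, ?_⟩
  · by_contra h
    push Not at h
    have : Real.sin (φ + β) ≤ 0 := by
      rw [← Real.sin_sub_two_pi, ← neg_nonneg, ← Real.sin_sub_pi]
      exact Real.sin_nonneg_of_nonneg_of_le_pi (by linarith) (by linarith)
    linarith
  · by_contra h
    push Not at h
    have : Real.sin (α * φ + β) ≤ 0 := by
      rw [← neg_nonneg, ← Real.sin_sub_pi]
      exact Real.sin_nonneg_of_nonneg_of_le_pi (by linarith) (by linarith)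
    linarith
  · have l1 := congrArg Real.log r1
    have l2 := congrArg Real.log r2
    rw [Real.log_mul hu0.ne' hsin.ne', Real.log_mul hρ0.ne' p1.ne', hρ, Real.log_exp] at l1
    rw [Real.log_mul (by positivity) hsin.ne', Real.log_mul hρ0'.ne' p2.ne', hρ', Real.log_exp,
      Real.log_rpow hu0] at l2
    rw [chordRel]
    linear_combination (-α) * l1 + l2

/-- If the slope increased with `φ`, then so would the angle `β`, and `chordRel` could not stay
zero. -/
lemma chordIm_div_chordRe_anti (h0 : 1 / 3 < α) (h1 : α < 1 / 2) {φ₁ φ₂ : ℝ}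
    (hφ₁ : φ₁ ∈ Ioo (2 * Real.pi) (Real.pi / α)) (hφ₂ : φ₂ ∈ Ioo (2 * Real.pi) (Real.pi / α))
    (hφ : φ₁ ≤ φ₂) : chordIm α φ₂ / chordRe α φ₂ ≤ chordIm α φ₁ / chordRe α φ₁ := by
  rcases hφ.eq_or_lt with rfl | hφ
  · exact le_rfl
  by_contra h
  push Not at h
  obtain ⟨a, _, _, b⟩ := chordRel_eq_zero h0 h1 hφ₁ rfl
  obtain ⟨_, c, d, e⟩ := chordRel_eq_zero h0 h1 hφ₂ rfl
  have := chordRel_lt h0 h1 hφ₁ hφ₂ hφ (Real.arctan_strictMono h).le a c d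
  linarith
end

/-! ### Monotonicity of the argument -/

section
variable {α : ℝ}

/-- A primitive of `exp (-r g) g' s dζ` with `g = s - s^α`, obtained from `hankelPrim` by partial
integration. -/
noncomputable def hankelPrimParts (α : ℝ) (r : ℝ) (ζ : ℂ) : ℂ :=
  ((r⁻¹ : ℝ) : ℂ) * (hankelPrim α r ζ - hankelForm α r ζ)

lemma hasDerivAt_hankelPrimParts (h0 : 0 < α) {r : ℝ} (hr : 0 < r) (ζ : ℂ) :
    HasDerivAt (hankelPrimParts α r)
      (hankelForm α r ζ * (Complex.exp ζ - α * Complex.exp (α * ζ))) ζ := by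
  have e1 : HasDerivAt (hankelForm α r) (hankelForm α r ζ -
      r * (hankelForm α r ζ * (Complex.exp ζ - α * Complex.exp (α * ζ)))) ζ := by
    have d1 := Complex.hasDerivAt_exp ζ
    have d2 := ((hasDerivAt_id ζ).const_mul (α : ℂ)).cexp
    have d3 := ((((d1.sub d2).const_mul (r : ℂ)).neg.cexp).mul d1)
    refine d3.congr_deriv ?_
    simp only [hankelForm, id, Pi.sub_apply, Pi.neg_apply]
    ring
  refine (((hasDerivAt_hankelPrim h0 (r : ℂ) ζ).sub e1).const_mul ((r⁻¹ : ℝ) : ℂ)).congr_deriv ?_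
  have : (r : ℂ) ≠ 0 := by exact_mod_cast hr.ne'
  rw [Complex.ofReal_inv]
  field_simp; ring

lemma hankelForm_ofReal (α r x : ℝ) : hankelForm α r x =
    ((Real.exp (-(r * (Real.exp x - Real.exp (α * x)))) * Real.exp x : ℝ) : ℂ) := by
  rw [hankelForm]; push_cast; rfl

lemma hasDerivAt_hankelPrimParts_levelCurve (h0 : 1 / 3 < α) (h1 : α < 1 / 2)
    {φ : ℝ} (hφ : φ ∈ Ioo (2 * Real.pi) (Real.pi / α)) : ∃ d < 0,
    HasDerivAt (levelValue α) d φ ∧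
    (∀ r > 0, HasDerivAt (fun φ => hankelPrimParts α r (levelCurve α φ))
      (((Real.exp (-(r * levelValue α φ)) * d : ℝ) : ℂ) * Complex.exp (levelCurve α φ)) φ) ∧
    (∀ r > 0, HasDerivAt
      (fun φ => (hankelPrimParts α r (Real.log (upperRoot α (levelValue α φ)))).re)
      (Real.exp (-(r * levelValue α φ)) * d * upperRoot α (levelValue α φ)) φ) := by
  have hα : 0 < α := by linarith
  obtain ⟨s1, s2, _⟩ := sin_pos_of_mem_Ioo_two_pi h0 h1 hφ
  obtain ⟨c, d, hc, hv, hd, hgc, _⟩ := exists_hasDerivAt_levelCurve h1.le s1 s2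
  refine ⟨d, hd, hv, fun r hr => ?_, fun r hr => ?_⟩
  · refine ((hasDerivAt_hankelPrimParts hα hr (levelCurve α φ)).comp φ hc).congr_deriv ?_
    rw [mul_assoc, hgc, hankelForm_levelCurve h1.le s1 s2]
    push_cast; ring
  · have hpos := levelValue_pos h0 h1 hφ
    obtain ⟨hu1, hu⟩ := upperRoot_spec hα h1.le hpos.le
    have hroot := (hasDerivAt_upperRoot hα h1.le hpos).comp φ hv
    set u := upperRoot α (levelValue α φ) with hu_def
    have hu0 : 0 < u := by linarith
    have e1 := (hasDerivAt_hankelPrimParts hα hr ((Real.log u : ℝ) : ℂ)).comp_ofReal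
    have e2 := Complex.reCLM.hasFDerivAt.comp_hasDerivAt _ e1
    have e3 := e2.comp_of_eq φ (hroot.log hu0.ne') rfl
    refine e3.congr_deriv ?_
    have hexp : Real.exp (α * Real.log u) = u ^ α := by rw [Real.rpow_def_of_pos hu0, mul_comm]
    have hder : u ^ α = u * u ^ (α - 1) := by
      rw [mul_comm, ← Real.rpow_add_one hu0.ne']; ring_nf
    have hlt : u ^ (α - 1) ≤ 1 := Real.rpow_le_one_of_one_le_of_nonpos hu1 (by linarith)
    have hne : 1 - α * u ^ (α - 1) ≠ 0 := by nlinarith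
    have e4 : Complex.exp (Real.log u) - α * Complex.exp (α * (Real.log u : ℝ)) =
        ((u * (1 - α * u ^ (α - 1)) : ℝ) : ℂ) := by
      rw [← Complex.ofReal_mul, ← Complex.ofReal_exp, ← Complex.ofReal_exp, hexp, hder,
        Real.exp_log hu0]
      push_cast; ring
    rw [e4, hankelForm_ofReal, hexp, Real.exp_log hu0, hu, Complex.reCLM_apply,
      ← Complex.ofReal_mul, Complex.ofReal_re]
    simp only [Function.comp_apply, ← hu_def]
    field_simp

/-- As `φ → 2π` the curve goes to infinity along the positive ray of the second sheet, which gives the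
second term of `N`, up to conjugation. -/
lemma tendsto_hankelPrimParts_two_pi (h0 : 1 / 3 < α) (h1 : α < 1 / 2) {r : ℝ} (hr : 0 < r) :
    Tendsto (fun φ => hankelPrimParts α r (levelCurve α φ)) (𝓝[>] (2 * Real.pi))
      (𝓝 (((r⁻¹ : ℝ) : ℂ) * (((r⁻¹ : ℝ) : ℂ) * (starRingEnd ℂ)
        (powLaplace α (-(((r ^ (1 - α) : ℝ) : ℂ) * stableRot α)))))) := by
  have hα : 0 < α := by linarith
  have hlog := tendsto_levelLog_two_pi h0 h1
  have hp := Real.pi_pos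
  have hr' : (r : ℂ) * Complex.exp ((2 * Real.pi : ℝ) * Complex.I) = (r : ℂ) := by
    push_cast; rw [Complex.exp_two_pi_mul_I, mul_one]
  have hcos : ∀ᶠ φ in 𝓝[>] (2 * Real.pi), |φ - 2 * Real.pi| ≤ Real.pi ∧
      ∀ y ∈ uIcc (2 * Real.pi) φ, r / 2 ≤ ((r : ℂ) * Complex.exp (y * Complex.I)).re := by
    filter_upwards [Ioo_mem_nhdsGT (show 2 * Real.pi < 2 * Real.pi + Real.pi / 3 by linarith)]
      with φ hφ
    refine ⟨by rw [abs_le]; constructor <;> linarith [hφ.1, hφ.2], ?_⟩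
    intro y hy
    rw [uIcc_of_le hφ.1.le] at hy
    have hy1 : y ≤ 2 * Real.pi + Real.pi / 3 := hy.2.trans hφ.2.le
    have : 1 / 2 ≤ Real.cos y := by
      rw [← Real.cos_sub_two_pi, ← Real.cos_pi_div_three]
      exact Real.cos_le_cos_of_nonneg_of_le_pi (by linarith [hy.1]) (by linarith) (by linarith)
    rw [Complex.re_ofReal_mul, Complex.exp_ofReal_mul_I_re]
    nlinarith
  have t1 := (tendsto_hankelPrim_powLaplace hα h1.le (r : ℂ) hr hr').comp hlog
  have t2 := tendsto_hankelPrim_sub_atTop hα h1.le (r : ℂ) (X := levelLog α) (Y := id)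
    (half_pos hr) hlog hcos
  have t3 := tendsto_hankelForm_atTop h1.le (r : ℂ) (X := levelLog α) (Y := id) (half_pos hr) hlog
    (hcos.mono fun φ hφ => hφ.2 φ right_mem_uIcc)
  have t4 := ((t2.add t1).sub t3).const_mul ((r⁻¹ : ℝ) : ℂ)
  rw [zero_add, sub_zero] at t4
  convert t4 using 1
  · ext φ; simp [levelCurve, hankelPrimParts]
  · congr 2
    push_cast
    rw [Complex.exp_two_pi_mul_I, one_mul, ← powLaplace_conj]
    congr 2
    have e : ((r ^ (1 - α) : ℝ) : ℂ) = r * ((r ^ (-α) : ℝ) : ℂ) := by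
      rw [sub_eq_add_neg, Real.rpow_add hr, Real.rpow_one, Complex.ofReal_mul]
    rw [map_neg, map_mul, Complex.conj_ofReal, e, stableRot, ← Complex.exp_conj, map_mul,
      Complex.conj_ofReal, Complex.conj_I]
    push_cast
    ring_nf

/-- As `φ → π/α` the curve runs into the origin. -/
lemma tendsto_hankelPrimParts_pi_div (h0 : 1 / 3 < α) (h1 : α < 1 / 2) {r : ℝ} :
    Tendsto (fun φ => hankelPrimParts α r (levelCurve α φ)) (𝓝[<] (Real.pi / α)) (𝓝 0) := by
  have hα : 0 < α := by linarith
  have hb := pi_div_bounds h0 h1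
  have hlog := tendsto_levelLog_pi_div h0 h1
  have hY : ∀ᶠ φ in 𝓝[<] (Real.pi / α), |φ| ≤ 3 * Real.pi := by
    filter_upwards [Ioo_mem_nhdsLT hb.1] with φ hφ
    rw [abs_le]; constructor <;> linarith [hφ.1, hφ.2, hb.2, Real.pi_pos]
  have t1 := tendsto_hankelPrim_atBot hα (r : ℂ) (Y := id) hlog hY
  have t2 : Tendsto (fun φ => hankelForm α r (levelLog α φ + (φ : ℝ) * Complex.I))
      (𝓝[<] (Real.pi / α)) (𝓝 0) := by
    have := (Real.tendsto_exp_atBot.comp hlog).const_mul (Real.exp (2 * ‖(r : ℂ)‖))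
    rw [mul_zero] at this
    refine squeeze_zero_norm' ?_ this
    filter_upwards [hlog.eventually (eventually_le_atBot 0)] with φ hφ
    exact norm_hankelForm_le_left hα r hφ φ
  have t3 := (t1.sub t2).const_mul ((r⁻¹ : ℝ) : ℂ)
  rw [sub_zero, mul_zero] at t3
  exact t3

/-- The real end of the chord goes to infinity as `φ → 2π` and gives the first term of `N`. -/
lemma tendsto_hankelPrimParts_upperRoot_two_pi (h0 : 1 / 3 < α) (h1 : α < 1 / 2) {r : ℝ}
    (hr : 0 < r) :
    Tendsto (fun φ => (hankelPrimParts α r (Real.log (upperRoot α (levelValue α φ)))).re)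
      (𝓝[>] (2 * Real.pi)) (𝓝 (r⁻¹ * (r⁻¹ * powLaplaceReal α (r ^ (1 - α))))) := by
  have hα : 0 < α := by linarith
  have hb := pi_div_bounds h0 h1
  have hroot : Tendsto (fun φ => upperRoot α (levelValue α φ)) (𝓝[>] (2 * Real.pi)) atTop := by
    refine tendsto_atTop_mono' _ ?_ (tendsto_levelValue_two_pi h0 h1)
    filter_upwards [Ioo_mem_nhdsGT hb.1] with φ hφ
    obtain ⟨a, b⟩ := upperRoot_spec hα h1.le (levelValue_pos h0 h1 hφ).le
    have := Real.rpow_pos_of_pos (by linarith : 0 < upperRoot α (levelValue α φ)) α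
    linarith
  have hlog := Real.tendsto_log_atTop.comp hroot
  have hr' : (r : ℂ) * Complex.exp ((0 : ℝ) * Complex.I) = (r : ℂ) := by simp
  have t1 := (tendsto_hankelPrim_powLaplace hα h1.le (r : ℂ) hr hr').comp hlog
  have t3 := tendsto_hankelForm_atTop h1.le (r : ℂ) (Y := fun _ => 0) hr hlog
    (Eventually.of_forall fun φ => by simp)
  have t4 := (Complex.continuous_re.tendsto _).comp ((t1.sub t3).const_mul ((r⁻¹ : ℝ) : ℂ))
  have e : r ^ (1 - α) = r * r ^ (-α) := by
    rw [sub_eq_add_neg, Real.rpow_add hr, Real.rpow_one]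
  convert t4 using 1
  · ext φ; simp [hankelPrimParts]
  · congr 1
    have e2 : (-((r : ℂ) * Complex.exp ((α * 0 : ℝ) * Complex.I) * ((r ^ (-α) : ℝ) : ℂ))) =
        -((r ^ (1 - α) : ℝ) : ℂ) := by rw [e]; simp
    rw [e2, powLaplace_neg_ofReal, sub_zero, Complex.re_ofReal_mul]
    simp only [Complex.ofReal_zero, zero_mul, Complex.exp_zero, one_mul]
    rw [Complex.re_ofReal_mul, Complex.ofReal_re]

/-- The integral of `exp (-r (u - u^α)) - 1` over `[0, 1]`, on which `u^α ≥ u`. -/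
noncomputable def hankelExcess (α r : ℝ) : ℝ := (hankelPrim α r 0).re - 1

/-- The real end of the chord stops at `u = 1` instead of the origin, which leaves the integral over
`[0, 1]`. -/
lemma tendsto_hankelPrimParts_upperRoot_pi_div (h0 : 1 / 3 < α) (h1 : α < 1 / 2) {r : ℝ}
    (hr : 0 < r) :
    Tendsto (fun φ => (hankelPrimParts α r (Real.log (upperRoot α (levelValue α φ)))).re)
      (𝓝[<] (Real.pi / α)) (𝓝 (r⁻¹ * hankelExcess α r)) := by
  have hα : 0 < α := by linarith
  have hb := pi_div_bounds h0 h1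
  have hroot : Tendsto (fun φ => upperRoot α (levelValue α φ)) (𝓝[<] (Real.pi / α))
      (𝓝 (upperRoot α 0)) := by
    refine tendsto_upperRoot hα h1.le le_rfl (tendsto_levelValue_pi_div h0 h1) ?_
    filter_upwards [Ioo_mem_nhdsLT hb.1] with φ hφ using (levelValue_pos h0 h1 hφ).le
  have hone : upperRoot α 0 = 1 := by
    obtain ⟨a, b⟩ := upperRoot_spec hα h1.le le_rfl
    have := sub_rpow_le hα h1.le le_rfl a
    rw [b, Real.one_rpow] at this
    nlinarith
  rw [hone] at hroot
  have hlog := (Real.continuousAt_log one_ne_zero).tendsto.comp hroot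
  rw [Real.log_one] at hlog
  have hcont : ContinuousAt (fun x : ℝ => (hankelPrimParts α r x).re) 0 :=
    Complex.continuous_re.continuousAt.comp
      (hasDerivAt_hankelPrimParts hα hr _).comp_ofReal.continuousAt
  have := hcont.tendsto.comp hlog
  convert this using 2
  · rfl
  rw [hankelPrimParts, Complex.re_ofReal_mul, hankelExcess, Complex.sub_re, hankelForm_ofReal]
  simp

lemma hasDerivAt_hankelPrim_log (h0 : 0 < α) (r : ℝ) {u : ℝ} (hu : 0 < u) :
    HasDerivAt (fun u : ℝ => (hankelPrim α r (Real.log u)).re) (Real.exp (r * (u ^ α - u))) u := by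
  have e1 := (hasDerivAt_hankelPrim h0 (r : ℂ) (Real.log u : ℝ)).comp_ofReal
  have e2 := Complex.reCLM.hasFDerivAt.comp_hasDerivAt _ e1
  have e3 := e2.comp_of_eq u (Real.hasDerivAt_log hu.ne') rfl
  refine e3.congr_deriv ?_
  have hexp : Real.exp (α * Real.log u) = u ^ α := by rw [Real.rpow_def_of_pos hu, mul_comm]
  rw [hankelForm_ofReal, hexp, Real.exp_log hu, Complex.reCLM_apply, Complex.ofReal_re,
    mul_inv_cancel_right₀ hu.ne']
  ring_nf

lemma tendsto_hankelPrim_log (h0 : 0 < α) (r : ℝ) :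
    Tendsto (fun u : ℝ => (hankelPrim α r (Real.log u)).re) (𝓝[>] 0) (𝓝 0) ∧
    Tendsto (fun u : ℝ => (hankelPrim α r (Real.log u)).re) (𝓝[<] 1)
      (𝓝 (hankelPrim α r 0).re) := by
  constructor
  · have := (Complex.continuous_re.tendsto _).comp
      ((tendsto_hankelPrim_ofReal_atBot h0 (r : ℂ)).comp Real.tendsto_log_nhdsGT_zero)
    exact this
  · have := ((hasDerivAt_hankelPrim_log h0 r one_pos).continuousAt.tendsto).mono_left
      (nhdsWithin_le_nhds (s := Iio 1))
    simpa using this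

lemma lt_rpow_of_mem_Ioo (h1 : α ≤ 1 / 2) {u : ℝ} (hu : u ∈ Ioo (0 : ℝ) 1) : u < u ^ α := by
  have := Real.rpow_lt_rpow_of_exponent_gt hu.1 hu.2 (show α < 1 by linarith)
  rwa [Real.rpow_one] at this

lemma hankelExcess_pos (h0 : 0 < α) (h1 : α ≤ 1 / 2) {r : ℝ} (hr : 0 < r) :
    0 < hankelExcess α r := by
  obtain ⟨t1, t2⟩ := tendsto_hankelPrim_log h0 r
  have i1 : Tendsto (fun u : ℝ => u) (𝓝[>] 0) (𝓝 0) := tendsto_id.mono_left nhdsWithin_le_nhds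
  have i2 : Tendsto (fun u : ℝ => u) (𝓝[<] 1) (𝓝 1) := tendsto_id.mono_left nhdsWithin_le_nhds
  have := lt_of_hasDerivAt_pos_of_tendsto one_pos
    (fun u hu => (hasDerivAt_hankelPrim_log h0 r hu.1).sub (hasDerivAt_id' u)) (fun u hu => ?_)
    (t1.sub i1) (t2.sub i2)
  · rw [hankelExcess]; linarith
  · have : 0 < r * (u ^ α - u) := mul_pos hr (by linarith [lt_rpow_of_mem_Ioo h1 hu])
    linarith [Real.add_one_lt_exp this.ne']

lemma exp_sub_one_mul_lt {a b f : ℝ} (ha : 0 < a) (hab : a < b) (hf : 0 < f) :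
    a⁻¹ * (Real.exp (a * f) - 1) < b⁻¹ * (Real.exp (b * f) - 1) := by
  have hb : 0 < b := ha.trans hab
  have h1 : 0 < Real.exp (a * f) - 1 := by
    have := Real.add_one_lt_exp (mul_pos ha hf).ne'
    have := mul_pos ha hf
    linarith
  have h := one_add_mul_self_lt_rpow_one_add (s := Real.exp (a * f) - 1) (p := b / a)
    (by linarith) h1.ne' (by rwa [lt_div_iff₀ ha, one_mul])
  rw [add_sub_cancel, ← Real.exp_mul, show a * f * (b / a) = b * f by field_simp] at h
  rw [inv_mul_eq_div, inv_mul_eq_div, div_lt_div_iff₀ ha hb]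
  have e : b / a * (Real.exp (a * f) - 1) * a = (Real.exp (a * f) - 1) * b := by field_simp
  nlinarith

/-- Pointwise in `u`, because `(exp (r f) - 1) / r` increases with `r`. -/
lemma hankelExcess_div_lt (h0 : 0 < α) (h1 : α ≤ 1 / 2) {r s : ℝ} (hr : 0 < r) (hrs : r < s) :
    r⁻¹ * hankelExcess α r < s⁻¹ * hankelExcess α s := by
  obtain ⟨t1, t2⟩ := tendsto_hankelPrim_log h0 r
  obtain ⟨t3, t4⟩ := tendsto_hankelPrim_log h0 s
  have i1 : Tendsto (fun u : ℝ => u) (𝓝[>] 0) (𝓝 0) := tendsto_id.mono_left nhdsWithin_le_nhds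
  have i2 : Tendsto (fun u : ℝ => u) (𝓝[<] 1) (𝓝 1) := tendsto_id.mono_left nhdsWithin_le_nhds
  have := lt_of_hasDerivAt_pos_of_tendsto one_pos
    (fun u hu => (((hasDerivAt_hankelPrim_log h0 s hu.1).sub (hasDerivAt_id' u)).const_mul s⁻¹).sub
      (((hasDerivAt_hankelPrim_log h0 r hu.1).sub (hasDerivAt_id' u)).const_mul r⁻¹))
    (fun u hu => ?_)
    (((t3.sub i1).const_mul s⁻¹).sub ((t1.sub i1).const_mul r⁻¹))
    (((t4.sub i2).const_mul s⁻¹).sub ((t2.sub i2).const_mul r⁻¹))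
  · simp only [sub_zero, mul_zero] at this
    rw [hankelExcess, hankelExcess]; linarith
  · have := exp_sub_one_mul_lt hr hrs (sub_pos.2 (lt_rpow_of_mem_Ioo h1 hu))
    linarith

/-- Partial integrals, along the curve, of `exp (-r t) (k n(t) - p(t)) dt` with `p / n` the slope of
the chord. -/
noncomputable def crossing (α k r φ : ℝ) : ℝ :=
  k * ((hankelPrimParts α r (Real.log (upperRoot α (levelValue α φ)))).re -
    (hankelPrimParts α r (levelCurve α φ)).re) - (hankelPrimParts α r (levelCurve α φ)).im

lemma hasDerivAt_crossing (h0 : 1 / 3 < α) (h1 : α < 1 / 2)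
    {φ : ℝ} (hφ : φ ∈ Ioo (2 * Real.pi) (Real.pi / α)) : ∃ d < 0, ∀ k, ∀ r > 0,
    HasDerivAt (crossing α k r)
      (Real.exp (-(r * levelValue α φ)) * (d * (k * chordRe α φ - chordIm α φ))) φ := by
  obtain ⟨d, hd, _, hc, hu⟩ := hasDerivAt_hankelPrimParts_levelCurve h0 h1 hφ
  refine ⟨d, hd, fun k r hr => ?_⟩
  have e1 := Complex.reCLM.hasFDerivAt.comp_hasDerivAt _ (hc r hr)
  have e2 := Complex.imCLM.hasFDerivAt.comp_hasDerivAt _ (hc r hr)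
  refine ((((hu r hr).sub e1).const_mul k).sub e2).congr_deriv ?_
  rw [Complex.reCLM_apply, Complex.imCLM_apply, Complex.re_ofReal_mul, Complex.im_ofReal_mul,
    exp_levelCurve, chordRe, chordIm]
  simp only [Complex.add_re, Complex.add_im, Complex.mul_re, Complex.mul_im, Complex.ofReal_re,
      Complex.ofReal_im, Complex.I_re, Complex.I_im]
  ring

lemma tendsto_crossing_two_pi (h0 : 1 / 3 < α) (h1 : α < 1 / 2) {r : ℝ} (hr : 0 < r) (k : ℝ) :
    Tendsto (crossing α k r) (𝓝[>] (2 * Real.pi))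
      (𝓝 (r⁻¹ * (r⁻¹ * (k * (stableN α ((r ^ (1 - α) : ℝ) : ℂ)).re -
        (stableN α ((r ^ (1 - α) : ℝ) : ℂ)).im)))) := by
  have t1 := tendsto_hankelPrimParts_two_pi h0 h1 hr
  have t2 := tendsto_hankelPrimParts_upperRoot_two_pi h0 h1 hr
  have t3 := (Complex.continuous_re.tendsto _).comp t1
  have t4 := (Complex.continuous_im.tendsto _).comp t1
  have t5 := ((t2.sub t3).const_mul k).sub t4
  convert t5 using 2
  · rfl
  rw [stableN, powLaplace_neg_ofReal, Complex.re_ofReal_mul, Complex.re_ofReal_mul,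
    Complex.im_ofReal_mul, Complex.im_ofReal_mul, Complex.conj_re, Complex.conj_im,
    Complex.sub_re, Complex.sub_im, Complex.ofReal_re, Complex.ofReal_im]
  ring

lemma tendsto_crossing_pi_div (h0 : 1 / 3 < α) (h1 : α < 1 / 2) {r : ℝ} (hr : 0 < r) (k : ℝ) :
    Tendsto (crossing α k r) (𝓝[<] (Real.pi / α)) (𝓝 (k * (r⁻¹ * hankelExcess α r))) := by
  have t1 := tendsto_hankelPrimParts_pi_div h0 h1 (r := r)
  have t2 := tendsto_hankelPrimParts_upperRoot_pi_div h0 h1 hr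
  have t3 := (Complex.continuous_re.tendsto _).comp t1
  have t4 := (Complex.continuous_im.tendsto _).comp t1
  have t5 := ((t2.sub t3).const_mul k).sub t4
  convert t5 using 2
  · rfl
  · simp

/-- `Im N` is the Laplace transform of the height of the curve. -/
lemma stableN_im_pos (h0 : 1 / 3 < α) (h1 : α < 1 / 2) {r : ℝ} (hr : 0 < r) :
    0 < (stableN α ((r ^ (1 - α) : ℝ) : ℂ)).im := by
  have hb := pi_div_bounds h0 h1
  choose! d hd hder using fun φ (hφ : φ ∈ Ioo (2 * Real.pi) (Real.pi / α)) =>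
    hasDerivAt_crossing h0 h1 hφ
  have := lt_of_hasDerivAt_pos_of_tendsto hb.1 (fun φ hφ => hder φ hφ 0 r hr) (fun φ hφ => ?_)
    (tendsto_crossing_two_pi h0 h1 hr 0) (tendsto_crossing_pi_div h0 h1 hr 0)
  · rw [zero_mul, zero_mul, zero_sub] at this
    have hri := inv_pos.2 hr
    by_contra h
    push Not at h
    have : 0 ≤ r⁻¹ * (r⁻¹ * -(stableN α ((r ^ (1 - α) : ℝ) : ℂ)).im) := by
      have : 0 ≤ -(stableN α ((r ^ (1 - α) : ℝ) : ℂ)).im := by linarith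
      positivity
    linarith
  · refine mul_pos (Real.exp_pos _) (mul_pos_of_neg_of_neg (hd φ hφ) ?_)
    linarith [chordIm_pos h0 h1 hφ]

/-- The quotient `Im N / Re N` decreases: `exp (-s t)` weighs the increasing slope of the chord
towards smaller values than `exp (-r t)` does when `r < s`. -/
lemma stableN_im_div_re_lt (h0 : 1 / 3 < α) (h1 : α < 1 / 2) {r s : ℝ} (hr : 0 < r) (hrs : r < s) :
    (stableN α ((s ^ (1 - α) : ℝ) : ℂ)).im / (stableN α ((s ^ (1 - α) : ℝ) : ℂ)).re <
      (stableN α ((r ^ (1 - α) : ℝ) : ℂ)).im / (stableN α ((r ^ (1 - α) : ℝ) : ℂ)).re := by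
  have hs : 0 < s := hr.trans hrs
  have hb := pi_div_bounds h0 h1
  have hN1 := stableN_re_pos h0 h1.le (Real.rpow_pos_of_pos hr (1 - α))
  have hN2 := stableN_re_pos h0 h1.le (Real.rpow_pos_of_pos hs (1 - α))
  have hI1 := stableN_im_pos h0 h1 hr
  set k := (stableN α ((r ^ (1 - α) : ℝ) : ℂ)).im / (stableN α ((r ^ (1 - α) : ℝ) : ℂ)).re with hk
  have hk0 : 0 < k := div_pos hI1 hN1
  have hkr : k * (stableN α ((r ^ (1 - α) : ℝ) : ℂ)).re - (stableN α ((r ^ (1 - α) : ℝ) : ℂ)).im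
      = 0 := by rw [hk, div_mul_cancel₀ _ hN1.ne', sub_self]
  set I := Ioo (2 * Real.pi) (Real.pi / α) with hI
  set w : ℝ → ℝ := fun φ => Real.exp (-((s - r) * levelValue α φ)) with hw
  have hw1 : ∀ φ ∈ I, w φ ≤ 1 := fun φ hφ => by
    rw [hw]; simp only [Real.exp_le_one_iff]
    have := mul_pos (sub_pos.2 hrs) (levelValue_pos h0 h1 hφ)
    linarith
  have hw0 : ∀ φ, 0 < w φ := fun φ => Real.exp_pos _
  -- the value of `exp (-(s - r) t)` where `k n - p` changes sign
  obtain ⟨C, hC0, hC1, hC⟩ : ∃ C, 0 ≤ C ∧ C ≤ 1 ∧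
      ∀ φ ∈ I, 0 ≤ (w φ - C) * (k * chordRe α φ - chordIm α φ) := by
    set B := {φ | φ ∈ I ∧ k * chordRe α φ < chordIm α φ} with hB
    rcases B.eq_empty_or_nonempty with hE | hE
    · refine ⟨0, le_rfl, zero_le_one, fun φ hφ => ?_⟩
      have : φ ∉ B := by rw [hE]; exact notMem_empty φ
      rw [hB, mem_ofPred_eq, not_and, not_lt] at this
      rw [sub_zero]
      exact mul_nonneg (hw0 φ).le (by linarith [this hφ])
    · have hbdd : BddAbove (w '' B) := ⟨1, by rintro _ ⟨φ, hφ, rfl⟩; exact hw1 φ hφ.1⟩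
      refine ⟨sSup (w '' B), ?_, csSup_le (hE.image w) ?_, fun φ hφ => ?_⟩
      · obtain ⟨φ, hφ⟩ := hE
        exact (hw0 φ).le.trans (le_csSup hbdd (mem_image_of_mem w hφ))
      · rintro _ ⟨φ, hφ, rfl⟩; exact hw1 φ hφ.1
      · by_cases hφB : φ ∈ B
        · have e1 := le_csSup hbdd (mem_image_of_mem w hφB)
          exact mul_nonneg_of_nonpos_of_nonpos (by linarith) (by linarith [hφB.2])
        · have e2 : chordIm α φ ≤ k * chordRe α φ := by
            rw [hB, mem_ofPred_eq, not_and, not_lt] at hφB; exact hφB hφ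
          refine mul_nonneg ?_ (by linarith)
          rw [sub_nonneg]
          refine csSup_le (hE.image w) ?_
          rintro _ ⟨ψ, hψ, rfl⟩
          have hlt : ψ < φ := by
            by_contra h
            push Not at h
            have := chordIm_div_chordRe_anti h0 h1 hφ hψ.1 h
            have a1 : k < chordIm α ψ / chordRe α ψ := by
              rw [lt_div_iff₀ (chordRe_pos h0 h1 hψ.1)]; exact hψ.2
            have a2 : chordIm α φ / chordRe α φ ≤ k := by
              rw [div_le_iff₀ (chordRe_pos h0 h1 hφ)]; exact e2
            linarith
          have := strictAntiOn_levelValue h0 h1 hψ.1 hφ hlt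
          rw [hw]; simp only [Real.exp_le_exp]
          nlinarith [sub_pos.2 hrs]
  choose! d hd hder using fun φ (hφ : φ ∈ I) => hasDerivAt_crossing h0 h1 hφ
  -- `exp (-s t) - C exp (-r t)` and `k n - p` have the same sign everywhere; as `t` decreases along
  -- the curve, `C * crossing r - crossing s` increases
  have key := le_of_hasDerivAt_nonneg_of_tendsto hb.1
    (fun φ hφ => ((hder φ hφ k r hr).const_mul C).sub (hder φ hφ k s hs)) (fun φ hφ => ?_)
    (((tendsto_crossing_two_pi h0 h1 hr k).const_mul C).sub (tendsto_crossing_two_pi h0 h1 hs k))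
    (((tendsto_crossing_pi_div h0 h1 hr k).const_mul C).sub (tendsto_crossing_pi_div h0 h1 hs k))
  · rw [hkr] at key
    have hx := hankelExcess_div_lt (by linarith : 0 < α) h1.le hr hrs
    have hxp := mul_pos (inv_pos.2 hr) (hankelExcess_pos (by linarith : 0 < α) h1.le hr)
    have h3 : C * (k * (r⁻¹ * hankelExcess α r)) < k * (s⁻¹ * hankelExcess α s) := by
      calc C * (k * (r⁻¹ * hankelExcess α r)) ≤ 1 * (k * (r⁻¹ * hankelExcess α r)) := by gcongr
        _ = k * (r⁻¹ * hankelExcess α r) := one_mul _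
        _ < _ := by gcongr
    have h4 : 0 < s⁻¹ * (s⁻¹ * (k * (stableN α ((s ^ (1 - α) : ℝ) : ℂ)).re -
        (stableN α ((s ^ (1 - α) : ℝ) : ℂ)).im)) := by
      simp only [mul_zero] at key; linarith
    have hsi := inv_pos.2 hs
    have h5 := (pos_iff_pos_of_mul_pos h4).1 hsi
    have h6 := (pos_iff_pos_of_mul_pos h5).1 hsi
    rw [div_lt_iff₀ hN2]; linarith
  · have e : Real.exp (-(s * levelValue α φ)) = w φ * Real.exp (-(r * levelValue α φ)) := by
      rw [hw, ← Real.exp_add]; ring_nf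
    have h2 := mul_nonneg (mul_nonneg (Real.exp_pos (-(r * levelValue α φ))).le (hC φ hφ))
      (neg_nonneg.2 (hd φ hφ).le)
    rw [e]
    nlinarith

lemma stableTheta_eq_arctan (h0 : 1 / 3 < α) (h1 : α ≤ 1 / 2) {r : ℝ} (hr : 0 < r) :
    stableTheta α r = 1 / 2 - Real.arctan ((stableN α ((r ^ (1 - α) : ℝ) : ℂ)).im /
      (stableN α ((r ^ (1 - α) : ℝ) : ℂ)).re) / Real.pi := by
  have hN := stableN_re_pos h0 h1 (Real.rpow_pos_of_pos hr (1 - α))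
  have h := abs_lt.1 (Complex.abs_arg_lt_pi_div_two_iff.2 (Or.inl hN))
  rw [stableTheta_eq h0 h1 hr, ← Complex.tan_arg, Real.arctan_tan h.1 h.2]

lemma strictMonoOn_stableTheta (h0 : 1 / 3 < α) (h1 : α < 1 / 2) :
    StrictMonoOn (stableTheta α) (Ioi 0) := by
  intro r hr s hs hrs
  rw [stableTheta_eq_arctan h0 h1.le hr, stableTheta_eq_arctan h0 h1.le hs]
  have := Real.arctan_strictMono (stableN_im_div_re_lt h0 h1 hr hrs)
  have := div_lt_div_of_pos_right this Real.pi_pos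
  linarith

/-- For `α = 1/2` the rotation is `-1` and `N` is real. -/
lemma stableTheta_half {r : ℝ} (hr : 0 < r) : stableTheta (1 / 2) r = 1 / 2 := by
  rw [stableTheta_eq_arctan (by norm_num) le_rfl hr]
  have : stableRot (1 / 2) = -1 := by
    rw [stableRot, show ((-(2 * Real.pi * (1 / 2)) : ℝ) : ℂ) * Complex.I = -(Real.pi * Complex.I) by
      push_cast; ring, Complex.exp_neg, Complex.exp_pi_mul_I]
    norm_num
  have him : (stableN (1 / 2) ((r ^ (1 - 1 / 2 : ℝ) : ℝ) : ℂ)).im = 0 := by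
    have e : -(((r ^ (1 - 1 / 2 : ℝ) : ℝ) : ℂ) * -1) =
      -((-(r ^ (1 - 1 / 2 : ℝ)) : ℝ) : ℂ) := by push_cast; ring
    rw [stableN, this, e, powLaplace_neg_ofReal, powLaplace_neg_ofReal, Complex.sub_im,
      Complex.ofReal_im, Complex.ofReal_im, sub_zero]
  rw [him]; simp

lemma monotoneOn_stableTheta (h0 : 1 / 3 < α) (h1 : α ≤ 1 / 2) :
    MonotoneOn (stableTheta α) (Ioi 0) := by
  rcases h1.lt_or_eq with h | rfl
  · exact (strictMonoOn_stableTheta h0 h).monotoneOn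
  · intro r hr s hs _
    rw [stableTheta_half hr, stableTheta_half hs]
end

/-! ### Laplace asymptotics on the cut -/

section
variable {α : ℝ}

/-- The integral `∫ exp (x (u^α - u)) du` over the positive axis. -/
noncomputable def laplaceInt (α x : ℝ) : ℝ := ∫ u in Ioi (0 : ℝ), Real.exp (x * (u ^ α - u))

lemma integrableOn_laplaceInt (h0 : 0 < α) (h1 : α ≤ 1 / 2) {x : ℝ} (hx : 0 < x) :
    IntegrableOn (fun u : ℝ => Real.exp (x * (u ^ α - u))) (Ioi 0) := by
  have h := (integrableOn_exp_ray h0 h1 (x : ℂ) (y := 0) (by simpa using hx)).norm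
  simp only [norm_exp_ray] at h
  refine h.congr (Eventually.of_forall fun u => ?_)
  simp only [mul_zero, Complex.ofReal_zero, zero_mul, Complex.exp_zero, mul_one, Complex.ofReal_re]
  ring_nf

lemma powLaplaceReal_eq_mul_laplaceInt {x : ℝ} (hx : 0 < x) :
    powLaplaceReal α (x ^ (1 - α)) = x * laplaceInt α x := by
  have h := integral_exp_ray_eq_powLaplace (α := α) (x : ℂ) (y := 0) hx (by simp)
  have e1 : -((x : ℂ) * Complex.exp ((α * 0 : ℝ) * Complex.I) * ((x ^ (-α) : ℝ) : ℂ)) =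
      -((x ^ (1 - α) : ℝ) : ℂ) := by
    have : x ^ (1 - α) = x * x ^ (-α) := by
      rw [sub_eq_add_neg, Real.rpow_add hx, Real.rpow_one]
    rw [this]; simp
  rw [e1, powLaplace_neg_ofReal] at h
  have e2 : (laplaceInt α x : ℂ) = ∫ u in Ioi (0 : ℝ), Complex.exp (-((x : ℂ) *
      (u * Complex.exp ((0 : ℝ) * Complex.I) -
        ((u ^ α : ℝ) : ℂ) * Complex.exp ((α * 0 : ℝ) * Complex.I)))) := by
    rw [laplaceInt, ← integral_complex_ofReal]
    congr 1; ext u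
    push_cast
    simp only [mul_zero, zero_mul, Complex.exp_zero, mul_one]
    congr 1; ring
  rw [← e2] at h
  have h' : laplaceInt α x = x⁻¹ * powLaplaceReal α (x ^ (1 - α)) := by exact_mod_cast h
  rw [h']; field_simp

/-- The point where `u^α - u` is maximal on the positive axis. -/
noncomputable def stableSaddle (α : ℝ) : ℝ := α ^ (1 / (1 - α))

lemma stableSaddle_pos (h0 : 0 < α) : 0 < stableSaddle α := Real.rpow_pos_of_pos h0 _

lemma stableSaddle_rpow (h0 : 0 < α) (h1 : α ≤ 1 / 2) :
    stableSaddle α ^ α = stableSaddle α / α := by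
  have h : (1 - α) ≠ 0 := by linarith
  have e : α ^ (1 / (1 - α)) = α ^ (1 / (1 - α) * α) * α := by
    rw [← Real.rpow_add_one h0.ne']
    congr 1; field_simp; ring
  rw [stableSaddle, ← Real.rpow_mul h0.le, eq_div_iff h0.ne', ← e]

lemma stableDelta_eq (h0 : 0 < α) (h1 : α ≤ 1 / 2) :
    stableDelta α = stableSaddle α / α - stableSaddle α := by
  have h : (1 - α) ≠ 0 := by linarith
  have : α ^ (α / (1 - α)) = stableSaddle α / α := by
    rw [← stableSaddle_rpow h0 h1, stableSaddle, ← Real.rpow_mul h0.le]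
    congr 1; field_simp
  rw [stableDelta, this]; field_simp

/-- The gap `1 + αk - (1 + k)^α` in Bernoulli's inequality. -/
noncomputable def bernoulliGap (α k : ℝ) : ℝ := 1 + α * k - (1 + k) ^ α

lemma rpow_sub_eq_bernoulliGap (h0 : 0 < α) (h1 : α ≤ 1 / 2) {k : ℝ} (hk : 0 ≤ 1 + k) :
    (stableSaddle α * (1 + k)) ^ α - stableSaddle α * (1 + k) =
      stableDelta α - stableSaddle α / α * bernoulliGap α k := by
  rw [Real.mul_rpow (stableSaddle_pos h0).le hk, stableSaddle_rpow h0 h1, stableDelta_eq h0 h1,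
    bernoulliGap]
  field_simp; ring

lemma bernoulliGap_nonneg (h0 : 0 < α) (h1 : α ≤ 1 / 2) {k : ℝ} (hk : 0 ≤ 1 + k) :
    0 ≤ bernoulliGap α k := by
  have := rpow_one_add_le_one_add_mul_self (s := k) (p := α) (by linarith) h0.le (by linarith)
  rw [bernoulliGap]; linarith

lemma rpow_sub_le_stableDelta (h0 : 0 < α) (h1 : α ≤ 1 / 2) {u : ℝ} (hu : 0 ≤ u) :
    u ^ α - u ≤ stableDelta α := by
  have hs := stableSaddle_pos h0
  have hk : 0 ≤ 1 + (u / stableSaddle α - 1) := by rw [add_sub_cancel]; positivity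
  have h := rpow_sub_eq_bernoulliGap h0 h1 hk
  rw [add_sub_cancel, mul_div_cancel₀ _ hs.ne'] at h
  have := mul_nonneg (div_pos hs h0).le (bernoulliGap_nonneg h0 h1 hk)
  linarith

/-- A lower bound of the gap, quadratic near zero and linear at infinity. -/
lemma le_bernoulliGap (h0 : 0 < α) (h1 : α ≤ 1 / 2) {k : ℝ} (hk : 0 ≤ 1 + k) :
    α * k ^ 2 ≤ bernoulliGap α k * (4 + 2 * |k|) := by
  -- Bernoulli for `√(1 + k)` with exponent `2α ≤ 1` gives the quadratic gap `α (√(1 + k) - 1)²`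
  set s := Real.sqrt (1 + k) with hs
  have hs0 : 0 ≤ s := Real.sqrt_nonneg _
  have hsq : s ^ 2 = 1 + k := Real.sq_sqrt hk
  have h := rpow_one_add_le_one_add_mul_self (s := s - 1) (p := 2 * α) (by linarith) (by linarith)
    (by linarith)
  rw [add_sub_cancel, Real.rpow_mul hs0, Real.rpow_two, hsq] at h
  have hg : α * (s - 1) ^ 2 ≤ bernoulliGap α k := by
    rw [bernoulliGap]; nlinarith
  have hk2 : k ^ 2 = (s - 1) ^ 2 * (s + 1) ^ 2 := by
    rw [show k = s ^ 2 - 1 by linarith]; ring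
  have hb : (s + 1) ^ 2 ≤ 4 + 2 * |k| := by
    nlinarith [sq_nonneg (s - 1), le_abs_self k]
  calc α * k ^ 2 = α * (s - 1) ^ 2 * (s + 1) ^ 2 := by rw [hk2]; ring
    _ ≤ bernoulliGap α k * (4 + 2 * |k|) := by
      gcongr
      exact bernoulliGap_nonneg h0 h1 hk

lemma laplace_exponent_ge (h0 : 0 < α) (h1 : α ≤ 1 / 2) {x v : ℝ} (hx : 1 ≤ x)
    (hv : 0 ≤ 1 + v / Real.sqrt x) :
    α * ((|v| - 2) / 2) ≤ x * bernoulliGap α (v / Real.sqrt x) := by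
  have hsx : 1 ≤ Real.sqrt x := Real.one_le_sqrt.2 hx
  have hsx0 : 0 < Real.sqrt x := by linarith
  have h := le_bernoulliGap h0 h1 hv
  have hg := bernoulliGap_nonneg h0 h1 hv
  have hxs : Real.sqrt x ^ 2 = x := Real.sq_sqrt (by linarith)
  have e : x * (α * (v / Real.sqrt x) ^ 2) = α * |v| ^ 2 := by
    rw [div_pow, hxs, sq_abs]; field_simp
  have hk : |v / Real.sqrt x| ≤ |v| := by
    rw [abs_div, abs_of_pos hsx0]; exact div_le_self (abs_nonneg _) hsx
  have h2 : α * |v| ^ 2 ≤ x * bernoulliGap α (v / Real.sqrt x) * (4 + 2 * |v|) := by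
    calc α * |v| ^ 2 = x * (α * (v / Real.sqrt x) ^ 2) := e.symm
      _ ≤ x * (bernoulliGap α (v / Real.sqrt x) * (4 + 2 * |v / Real.sqrt x|)) := by gcongr
      _ ≤ x * (bernoulliGap α (v / Real.sqrt x) * (4 + 2 * |v|)) := by gcongr
      _ = _ := by ring
  have hv0 := abs_nonneg v
  by_contra! hc
  have : x * bernoulliGap α (v / Real.sqrt x) * (4 + 2 * |v|) <
      α * ((|v| - 2) / 2) * (4 + 2 * |v|) := by gcongr
  nlinarith

lemma tendsto_bernoulliGap_div_sq (α : ℝ) :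
    Tendsto (fun k => bernoulliGap α k / k ^ 2) (𝓝[≠] 0) (𝓝 (α * (1 - α) / 2)) := by
  have hev : ∀ᶠ k : ℝ in 𝓝 0, 0 < 1 + k :=
    (continuous_const.add continuous_id).tendsto' 0 1 (by simp) |>.eventually (lt_mem_nhds one_pos)
  have hd : ∀ k : ℝ, 0 < 1 + k →
      HasDerivAt (bernoulliGap α) (α - α * (1 + k) ^ (α - 1)) k := by
    intro k hk
    have e := ((Real.hasDerivAt_rpow_const (p := α) (Or.inl hk.ne')).comp k
      ((hasDerivAt_id k).const_add 1))
    refine ((((hasDerivAt_id k).const_mul α).const_add 1).sub e).congr_deriv ?_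
    simp
  have hzero : Tendsto (bernoulliGap α) (𝓝[≠] 0) (𝓝 0) := by
    have := (hd 0 (by simp)).continuousAt.tendsto
    have e : bernoulliGap α 0 = 0 := by simp [bernoulliGap]
    rw [e] at this
    exact this.mono_left nhdsWithin_le_nhds
  refine HasDerivAt.lhopital_zero_nhdsNE (f' := fun k => α - α * (1 + k) ^ (α - 1))
    (g' := fun k => 2 * k) ?_ ?_ ?_ hzero ?_ ?_
  · filter_upwards [nhdsWithin_le_nhds hev] with k hk using hd k hk
  · exact Eventually.of_forall fun k => by simpa using hasDerivAt_pow 2 k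
  · filter_upwards [self_mem_nhdsWithin] with k hk
    exact mul_ne_zero two_ne_zero hk
  · have : Tendsto (fun k : ℝ => k ^ 2) (𝓝 0) (𝓝 0) := (continuous_pow 2).tendsto' 0 0 (by simp)
    exact this.mono_left nhdsWithin_le_nhds
  · have e : HasDerivAt (fun k : ℝ => (1 + k) ^ (α - 1)) (α - 1) 0 := by
      have := ((Real.hasDerivAt_rpow_const (p := α - 1) (x := 1 + id (0 : ℝ))
        (Or.inl (by simp))).comp 0 ((hasDerivAt_id (0 : ℝ)).const_add 1))
      exact this.congr_deriv (by simp)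
    have := (e.tendsto_slope_zero).const_mul (-α / 2)
    refine (this.congr' ?_).trans (le_of_eq (by congr 1; ring))
    filter_upwards [self_mem_nhdsWithin] with k hk
    have hk : k ≠ 0 := hk
    simp only [zero_add, add_zero, Real.one_rpow, smul_eq_mul]
    field_simp; ring

lemma integrable_exp_neg_mul_abs {c : ℝ} (hc : 0 < c) :
    Integrable fun v : ℝ => Real.exp (-c * |v|) := by
  refine IntegrableOn.integrable_of_ae_notMem_eq_zero (s := univ) ?_ (by simp)
  rw [← Iic_union_Ioi (a := (0 : ℝ))]
  refine IntegrableOn.union ?_ ?_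
  · refine (integrableOn_exp_mul_Iic hc 0).congr_fun (fun v hv => ?_) measurableSet_Iic
    simp only [abs_of_nonpos (mem_Iic.1 hv)]; ring_nf
  · refine (integrableOn_exp_mul_Ioi (neg_neg_of_pos hc) 0).congr_fun (fun v hv => ?_)
      measurableSet_Ioi
    simp only [abs_of_pos (mem_Ioi.1 hv)]

/-- The integrand of `laplaceInt` centred at the saddle point and scaled by `√x`. -/
noncomputable def laplaceKernel (α x v : ℝ) : ℝ :=
  if 0 < 1 + v / Real.sqrt x then
    Real.exp (-(stableSaddle α / α * (x * bernoulliGap α (v / Real.sqrt x)))) else 0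

lemma laplaceInt_eq (h0 : 0 < α) (h1 : α ≤ 1 / 2) {x : ℝ} (hx : 0 < x) :
    Real.sqrt x * Real.exp (-(stableDelta α * x)) * laplaceInt α x =
      stableSaddle α * ∫ v, laplaceKernel α x v := by
  have hs := stableSaddle_pos h0
  have hx' := Real.sqrt_pos.2 hx
  set g : ℝ → ℝ := (Ioi (0 : ℝ)).indicator fun u => Real.exp (x * (u ^ α - u)) with hg
  have e1 : laplaceInt α x = ∫ u, g u := by
    rw [laplaceInt, hg, integral_indicator measurableSet_Ioi]
  have e2 : ∫ v, g (stableSaddle α / Real.sqrt x * v + stableSaddle α) =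
      Real.sqrt x / stableSaddle α * ∫ u, g u := by
    rw [Measure.integral_comp_mul_left (fun w => g (w + stableSaddle α)),
      integral_add_right_eq_self g, smul_eq_mul, abs_of_pos (by positivity), inv_div]
  have e3 : ∀ v, g (stableSaddle α / Real.sqrt x * v + stableSaddle α) =
      Real.exp (stableDelta α * x) * laplaceKernel α x v := by
    intro v
    have e : stableSaddle α / Real.sqrt x * v + stableSaddle α =
        stableSaddle α * (1 + v / Real.sqrt x) := by ring
    rw [e, laplaceKernel, hg]
    by_cases hv : 0 < 1 + v / Real.sqrt x
    · rw [indicator_of_mem (mem_Ioi.2 (mul_pos hs hv)), if_pos hv, ← Real.exp_add,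
        rpow_sub_eq_bernoulliGap h0 h1 hv.le]
      congr 1; ring
    · rw [indicator_of_notMem (by rw [mem_Ioi, mul_pos_iff_of_pos_left hs]; exact hv), if_neg hv,
        mul_zero]
  simp only [e3] at e2
  rw [integral_const_mul] at e2
  rw [e1, Real.exp_neg]
  have := Real.exp_pos (stableDelta α * x)
  field_simp at e2 ⊢
  linarith

/-- Laplace's method: the rescaled integrand converges to a Gaussian, dominated by a two-sided
exponential. -/
lemma tendsto_laplaceInt (h0 : 0 < α) (h1 : α ≤ 1 / 2) :
    Tendsto (fun x => Real.sqrt x * Real.exp (-(stableDelta α * x)) * laplaceInt α x) atTop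
      (𝓝 (stableSaddle α * Real.sqrt (2 * Real.pi / (stableSaddle α * (1 - α))))) := by
  have hs := stableSaddle_pos h0
  have hsq : Tendsto Real.sqrt atTop atTop := Real.tendsto_sqrt_atTop
  have hlim : Tendsto (fun x => ∫ v, laplaceKernel α x v) atTop
      (𝓝 (∫ v : ℝ, Real.exp (-(stableSaddle α * (1 - α) / 2) * v ^ 2))) := by
    refine tendsto_integral_filter_of_dominated_convergence
      (fun v => Real.exp (stableSaddle α) * Real.exp (-(stableSaddle α / 2) * |v|)) ?_ ?_ ?_ ?_
    · refine Eventually.of_forall fun x => Measurable.aestronglyMeasurable ?_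
      unfold laplaceKernel bernoulliGap
      have hm : Measurable fun v : ℝ => 1 + v / Real.sqrt x := by fun_prop
      refine Measurable.ite (measurableSet_lt measurable_const hm) ?_ measurable_const
      have : Measurable fun v : ℝ => (1 + v / Real.sqrt x) ^ α := hm.pow_const α
      fun_prop
    · filter_upwards [eventually_ge_atTop 1] with x hx
      refine Eventually.of_forall fun v => ?_
      rw [laplaceKernel]
      split_ifs with hv
      · rw [Real.norm_eq_abs, Real.abs_exp, ← Real.exp_add, Real.exp_le_exp]
        have := mul_le_mul_of_nonneg_left (laplace_exponent_ge h0 h1 hx hv.le) (div_pos hs h0).le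
        have e : stableSaddle α / α * (α * ((|v| - 2) / 2)) =
          stableSaddle α / 2 * |v| - stableSaddle α := by field_simp
        linarith
      · rw [norm_zero]; positivity
    · exact (integrable_exp_neg_mul_abs (by positivity)).const_mul _
    · have hne : ∀ᵐ v : ℝ, v ≠ 0 := by simp [ae_iff, measure_singleton]
      filter_upwards [hne] with v hv
      have hk : Tendsto (fun x => v / Real.sqrt x) atTop (𝓝[≠] 0) := by
        refine tendsto_nhdsWithin_iff.2 ⟨hsq.const_div_atTop v, ?_⟩
        filter_upwards [eventually_gt_atTop 0] with x hx
        exact div_ne_zero hv (Real.sqrt_pos.2 hx).ne'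
      have h2 := ((tendsto_bernoulliGap_div_sq α).comp hk).const_mul
        (-(stableSaddle α / α * v ^ 2))
      have h3 := (Real.continuous_exp.tendsto _).comp h2
      have e : -(stableSaddle α / α * v ^ 2) * (α * (1 - α) / 2) =
        -(stableSaddle α * (1 - α) / 2) * v ^ 2 := by field_simp
      rw [e] at h3
      refine h3.congr' ?_
      have hpos : ∀ᶠ x in atTop, 0 < 1 + v / Real.sqrt x := by
        have := ((hsq.const_div_atTop v).const_add 1)
        rw [add_zero] at this
        exact this.eventually (lt_mem_nhds one_pos)
      filter_upwards [hpos, eventually_gt_atTop 0] with x hx hx0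
      rw [laplaceKernel, if_pos hx]
      simp only [Function.comp_apply]
      congr 1
      rw [div_pow, Real.sq_sqrt hx0.le]
      field_simp
  rw [integral_gaussian] at hlim
  have := (hlim.const_mul (stableSaddle α)).congr'
    (show _ =ᶠ[atTop] fun x => Real.sqrt x * Real.exp (-(stableDelta α * x)) * laplaceInt α x by
      filter_upwards [eventually_gt_atTop 0] with x hx using (laplaceInt_eq h0 h1 hx).symm)
  refine this.trans (le_of_eq ?_)
  congr 3
  field_simp

lemma laplaceInt_le (h0 : 0 < α) (h1 : α ≤ 1 / 2) {x : ℝ} (hx : 1 / 2 ≤ x) :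
    laplaceInt α x ≤ laplaceInt α (1 / 2) * Real.exp (stableDelta α * x) := by
  have h : laplaceInt α (1 / 2) * Real.exp (stableDelta α * x) =
      ∫ u in Ioi (0 : ℝ), Real.exp (1 / 2 * (u ^ α - u)) * Real.exp (stableDelta α * x) := by
    rw [integral_mul_const, laplaceInt]
  have hd : 0 ≤ stableDelta α := by
    have := rpow_sub_le_stableDelta h0 h1 zero_le_one
    simpa using this
  rw [h, laplaceInt]
  refine setIntegral_mono_on (integrableOn_laplaceInt h0 h1 (by linarith))
    ((integrableOn_laplaceInt h0 h1 (by norm_num)).mul_const _) measurableSet_Ioi fun u hu => ?_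
  rw [← Real.exp_add, Real.exp_le_exp]
  have := rpow_sub_le_stableDelta h0 h1 (le_of_lt (mem_Ioi.1 hu))
  nlinarith

lemma stableConst_eq (h0 : 0 < α) (h1 : α ≤ 1 / 2) :
    (2 * Real.pi)⁻¹ * (stableSaddle α * Real.sqrt (2 * Real.pi / (stableSaddle α * (1 - α)))) =
      stableConst α := by
  have hs := stableSaddle_pos h0
  have hp := Real.pi_pos
  have h : 0 < 1 - α := by linarith
  have e : α ^ (1 / (2 * (1 - α))) = Real.sqrt (stableSaddle α) := by
    rw [stableSaddle, Real.sqrt_eq_rpow, ← Real.rpow_mul h0.le]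
    congr 1; field_simp
  rw [stableConst, e, Real.sqrt_div (by positivity), Real.sqrt_mul hs.le,
    Real.sqrt_mul (by positivity) (1 - α)]
  have a1 := Real.sq_sqrt hs.le
  have a2 := Real.sq_sqrt (show 0 ≤ 2 * Real.pi by positivity)
  have b0 := Real.sqrt_pos.2 hs
  have b1 := Real.sqrt_pos.2 h
  have b2 := Real.sqrt_pos.2 (show 0 < 2 * Real.pi by positivity)
  generalize Real.sqrt (stableSaddle α) = a at *
  generalize Real.sqrt (2 * Real.pi) = b at *
  rw [← a1, ← a2]
  field_simp

lemma tendsto_norm_stableGUpper (h0 : 1 / 3 < α) (h1 : α ≤ 1 / 2) :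
    Tendsto (fun r => Real.sqrt r * Real.exp (-(stableDelta α * r)) * ‖stableGUpper α r‖) atTop
      (𝓝 (stableConst α)) := by
  have hα : 0 < α := by linarith
  have hd : 0 < stableDelta α := mul_pos (by linarith) (Real.rpow_pos_of_pos hα _)
  rw [← stableConst_eq hα h1]
  have hmain := (tendsto_laplaceInt hα h1).const_mul (2 * Real.pi)⁻¹
  have herr : Tendsto (fun r : ℝ => Real.exp (-(stableDelta α * r))) atTop (𝓝 0) :=
    Real.tendsto_exp_neg_atTop_nhds_zero.comp (tendsto_id.const_mul_atTop hd)
  have hdiff : Tendsto (fun r => Real.sqrt r * Real.exp (-(stableDelta α * r)) * ‖stableGUpper α r‖ -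
      (2 * Real.pi)⁻¹ * (Real.sqrt r * Real.exp (-(stableDelta α * r)) * laplaceInt α r)) atTop
      (𝓝 0) := by
    refine squeeze_zero_norm' ?_ herr
    filter_upwards [eventually_ge_atTop 1] with r hr
    have hr0 : 0 < r := by linarith
    have hl := (Real.rpow_pos_of_pos hr0 (1 - α)).le
    have hp := Real.pi_gt_three
    have hn : ‖stableGUpper α r‖ =
        (2 * Real.pi * r)⁻¹ * ‖stableN α ((r ^ (1 - α) : ℝ) : ℂ)‖ := by
      rw [stableGUpper_eq_stableN hα h1 hr0, norm_mul, norm_mul, norm_neg, Complex.norm_I, one_mul,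
        Complex.norm_real, Real.norm_of_nonneg (by positivity)]
    have hS := powLaplaceReal_eq_mul_laplaceInt (α := α) hr0
    have hSp : 0 ≤ powLaplaceReal α (r ^ (1 - α)) := by
      have := one_add_le_powLaplaceReal hα h1 (r ^ (1 - α))
      have := mul_nonneg hl (powMoment_pos hα).le
      linarith
    have hN : |‖stableN α ((r ^ (1 - α) : ℝ) : ℂ)‖ - powLaplaceReal α (r ^ (1 - α))| ≤ 1 := by
      have h2 := norm_powLaplace_le_one (α := α) (re_neg_mul_stableRot h0 h1 hl)
      have h3 := abs_norm_sub_norm_le (stableN α ((r ^ (1 - α) : ℝ) : ℂ))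
        (powLaplace α (-((r ^ (1 - α) : ℝ) : ℂ)))
      rw [stableN, sub_sub_cancel_left, norm_neg, powLaplace_neg_ofReal, Complex.norm_real,
        Real.norm_of_nonneg hSp, ← powLaplace_neg_ofReal] at h3
      exact h3.trans h2
    have hsr : Real.sqrt r ≤ r := by
      rw [Real.sqrt_le_left (by linarith)]; nlinarith
    have e : Real.sqrt r * Real.exp (-(stableDelta α * r)) * ‖stableGUpper α r‖ -
      (2 * Real.pi)⁻¹ * (Real.sqrt r * Real.exp (-(stableDelta α * r)) * laplaceInt α r) =
      Real.exp (-(stableDelta α * r)) * ((2 * Real.pi)⁻¹ * (Real.sqrt r / r)) *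
        (‖stableN α ((r ^ (1 - α) : ℝ) : ℂ)‖ - powLaplaceReal α (r ^ (1 - α))) := by
      rw [hn, hS]; field_simp
    rw [e, norm_mul, Real.norm_of_nonneg (by positivity), Real.norm_eq_abs]
    have h4 : (2 * Real.pi)⁻¹ * (Real.sqrt r / r) ≤ 1 := by
      have a : (2 * Real.pi)⁻¹ ≤ 1 := inv_le_one_of_one_le₀ (by linarith)
      have b : Real.sqrt r / r ≤ 1 := (div_le_one hr0).2 hsr
      exact mul_le_one₀ a (by positivity) b
    calc _ ≤ Real.exp (-(stableDelta α * r)) * 1 * 1 := by gcongr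
      _ = _ := by ring
  have := hmain.add hdiff
  rw [add_zero] at this
  refine this.congr fun r => by ring
end

/-! ### Growth in the strip -/

section
variable {α : ℝ}

lemma one_half_le_cos {y : ℝ} (hy : |y| ≤ Real.pi / 3) : 1 / 2 ≤ Real.cos y := by
  rw [← Real.cos_abs, ← Real.cos_pi_div_three]
  exact Real.cos_le_cos_of_nonneg_of_le_pi (abs_nonneg y) (by linarith [Real.pi_pos]) hy

/-- Turning the ray of integration bounds `powLaplace` near the negative axis by the real Laplace
integral `laplaceInt`, which keeps the sharp exponential rate. -/
lemma norm_powLaplace_neg_exp_le (h0 : 0 < α) (h1 : α ≤ 1 / 2) (x : ℝ) {y : ℝ}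
    (hy : |y| ≤ Real.pi / 3) :
    ‖powLaplace α (-Complex.exp ((1 - α) * (x + y * Complex.I)))‖ ≤
      Real.exp x * laplaceInt α (Real.exp x * Real.cos y) := by
  set r : ℂ := Complex.exp (x + y * Complex.I) with hr
  have hre (t : ℝ) : (r * Complex.exp (t * Complex.I)).re = Real.exp x * Real.cos (y + t) := by
    rw [hr, ← Complex.exp_add, show (x : ℂ) + y * Complex.I + t * Complex.I =
      x + ((y + t : ℝ) : ℂ) * Complex.I by push_cast; ring, Complex.exp_re]
    simp
  have hre0 : r.re = Real.exp x * Real.cos y := by simpa using hre 0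
  have hrρ : r * Complex.exp (((-y : ℝ) : ℂ) * Complex.I) = ((Real.exp x : ℝ) : ℂ) := by
    rw [hr, ← Complex.exp_add, Complex.ofReal_exp]
    congr 1; push_cast; ring
  have harg : r * Complex.exp ((α * (-y) : ℝ) * Complex.I) * (((Real.exp x) ^ (-α) : ℝ) : ℂ) =
      Complex.exp ((1 - α) * (x + y * Complex.I)) := by
    rw [← Real.exp_mul, Complex.ofReal_exp, hr, ← Complex.exp_add, ← Complex.exp_add]
    congr 1; push_cast; ring
  have t1 := tendsto_hankelPrim_powLaplace h0 h1 r (Real.exp_pos x) hrρ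
  rw [harg] at t1
  have hpos : 0 < (r * Complex.exp (((0 : ℝ) : ℂ) * Complex.I)).re := by
    rw [hre, add_zero]
    have := one_half_le_cos hy
    have := Real.exp_pos x
    positivity
  have t2 := tendsto_hankelPrim_ray h0 h1 r hpos
  have t3 := tendsto_hankelPrim_sub_atTop h0 h1 r (X := fun t : ℝ => t) (Y := fun _ => -y)
    (y₀ := 0) (M := |y|) (k := Real.exp x / 2) (by positivity) tendsto_id
    (Eventually.of_forall fun t => by
      refine ⟨by simp, fun t ht => ?_⟩
      rw [hre]
      have hc : |y + t| ≤ Real.pi / 3 := by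
        refine le_trans ?_ hy
        rw [abs_le]
        rcases le_total y 0 with h | h
        · rw [uIcc_of_le (by linarith)] at ht
          rw [abs_of_nonpos h]; constructor <;> linarith [ht.1, ht.2]
        · rw [uIcc_of_ge (by linarith)] at ht
          rw [abs_of_nonneg h]; constructor <;> linarith [ht.1, ht.2]
      have := one_half_le_cos hc
      have := Real.exp_pos x
      nlinarith)
  have heq := tendsto_nhds_unique t3 (t1.sub t2)
  have heq2 := congrArg norm (sub_eq_zero.1 heq.symm)
  rw [norm_mul, norm_mul, norm_mul, Complex.norm_exp_ofReal_mul_I, Complex.norm_exp_ofReal_mul_I,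
    one_mul, one_mul, Complex.norm_real, Real.norm_of_nonneg (by positivity)] at heq2
  have hint : ‖∫ u in Ioi (0 : ℝ), Complex.exp (-(r * (u * Complex.exp (((0 : ℝ) : ℂ) * Complex.I) -
      ((u ^ α : ℝ) : ℂ) * Complex.exp ((α * 0 : ℝ) * Complex.I))))‖ ≤
      laplaceInt α (Real.exp x * Real.cos y) := by
    have hx : 0 < Real.exp x * Real.cos y := by
      have := one_half_le_cos hy
      have := Real.exp_pos x
      positivity
    refine norm_integral_le_of_norm_le (integrableOn_laplaceInt h0 h1 hx)
      (Eventually.of_forall fun u => ?_)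
    rw [norm_exp_ray, mul_zero]
    simp only [Complex.ofReal_zero, zero_mul, Complex.exp_zero, mul_one, hre0]
    rw [Real.exp_le_exp]; linarith
  rw [← heq2] at hint
  have := mul_le_mul_of_nonneg_left hint (Real.exp_pos x).le
  rwa [mul_inv_cancel_left₀ (Real.exp_pos x).ne'] at this

lemma norm_stableExt_le (α : ℝ) (ζ : ℂ) : ‖stableExt α ζ‖ ≤ Real.exp (-ζ.re) *
    ‖powLaplace α (Complex.exp (-(Complex.I * Real.pi * α) + (1 - α) * ζ)) -
      powLaplace α (Complex.exp (Complex.I * Real.pi * α + (1 - α) * ζ))‖ := by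
  have hp := Real.pi_gt_three
  have h : ‖(2 * Complex.I * (Real.pi : ℂ))⁻¹‖ ≤ 1 := by
    rw [norm_inv, norm_mul, norm_mul, Complex.norm_I, Complex.norm_real,
      Real.norm_of_nonneg (by linarith)]
    refine inv_le_one_of_one_le₀ ?_
    norm_num; linarith
  rw [stableExt, norm_mul, norm_mul, Complex.norm_exp, Complex.neg_re]
  gcongr
  exact mul_le_of_le_one_left (Real.exp_pos _).le h

lemma norm_stableExt_conj (α : ℝ) (ζ : ℂ) :
    ‖stableExt α (starRingEnd ℂ ζ)‖ = ‖stableExt α ζ‖ := by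
  rw [stableExt_conj, Complex.norm_conj]

lemma norm_exp_neg_rot (α : ℝ) (ζ : ℂ) :
    ‖Complex.exp (-(Complex.I * Real.pi * α) + (1 - α) * ζ)‖ = Real.exp ((1 - α) * ζ.re) := by
  rw [Complex.norm_exp]; simp

lemma norm_exp_rot (α : ℝ) (ζ : ℂ) :
    ‖Complex.exp (Complex.I * Real.pi * α + (1 - α) * ζ)‖ = Real.exp ((1 - α) * ζ.re) := by
  rw [Complex.norm_exp]; simp

/-- Crude growth: the order `2 (1 - α)` is below `3 / 2`. -/
lemma norm_stableExt_le_exp_exp (h0 : 0 < α) (h1 : α ≤ 1 / 2) (ζ : ℂ) :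
    ‖stableExt α ζ‖ ≤ 4 * Real.exp (-ζ.re + (Real.exp ((1 - α) * ζ.re) +
      Real.exp ((1 - α) * ζ.re) ^ 2 / 2)) := by
  refine (norm_stableExt_le α ζ).trans ?_
  have e1 := norm_powLaplace_le h0 h1 (Real.exp_pos _).le (norm_exp_neg_rot α ζ).le
  have e2 := norm_powLaplace_le h0 h1 (Real.exp_pos _).le (norm_exp_rot α ζ).le
  rw [Real.exp_add]
  calc _ ≤ Real.exp (-ζ.re) * (_ + _) :=
        mul_le_mul_of_nonneg_left ((norm_sub_le _ _).trans (add_le_add e1 e2)) (Real.exp_pos _).le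
    _ = _ := by ring

/-- The difference of the two values of `S` is bounded by the distance `O(|z|^(1-α))` of their
arguments. -/
lemma exists_norm_stableExt_le_left (h0 : 0 < α) (h1 : α ≤ 1 / 2) :
    ∃ C, 0 ≤ C ∧ ∀ ζ : ℂ, ζ.re ≤ 0 → ‖stableExt α ζ‖ ≤ C * Real.exp (-(α * ζ.re)) := by
  refine ⟨2 * (2 * Real.exp ((1 + 1) + (1 + 1) ^ 2 / 2)), by positivity, fun ζ hζ => ?_⟩
  set C := 2 * Real.exp ((1 + 1) + (1 + 1) ^ 2 / 2) with hC
  set a := Complex.exp (-(Complex.I * Real.pi * α) + (1 - α) * ζ) with ha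
  set b := Complex.exp (Complex.I * Real.pi * α + (1 - α) * ζ) with hb
  have na : ‖a‖ = Real.exp ((1 - α) * ζ.re) := norm_exp_neg_rot α ζ
  have nb : ‖b‖ = Real.exp ((1 - α) * ζ.re) := norm_exp_rot α ζ
  have hle : Real.exp ((1 - α) * ζ.re) ≤ 1 := Real.exp_le_one_iff.2 (by nlinarith)
  have h := (convex_closedBall (0 : ℂ) 1).norm_image_sub_le_of_norm_hasDerivWithin_le
    (f := powLaplace α) (f' := powLaplaceDeriv α) (C := C) (x := b) (y := a)
    (fun z _ => (hasDerivAt_powLaplace h0 h1 z).hasDerivWithinAt)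
    (fun z hz => norm_powLaplaceDeriv_le h0 h1 zero_le_one (by simpa using hz))
    (by simpa [nb] using hle) (by simpa [na] using hle)
  have hab : ‖a - b‖ ≤ 2 * Real.exp ((1 - α) * ζ.re) :=
    (norm_sub_le _ _).trans (by rw [na, nb, two_mul])
  refine (norm_stableExt_le α ζ).trans ?_
  calc Real.exp (-ζ.re) * ‖powLaplace α a - powLaplace α b‖
      ≤ Real.exp (-ζ.re) * (C * (2 * Real.exp ((1 - α) * ζ.re))) := by
        gcongr
        exact h.trans (mul_le_mul_of_nonneg_left hab (by positivity))
    _ = 2 * C * (Real.exp (-ζ.re) * Real.exp ((1 - α) * ζ.re)) := by ring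
    _ = 2 * C * Real.exp (-(α * ζ.re)) := by
        rw [← Real.exp_add]; congr 2; ring

/-- On the real axis the two terms are conjugate, and their difference is an imaginary part. -/
lemma exists_norm_stableExt_le_real (h0 : 0 < α) (h1 : α ≤ 1 / 2) :
    ∃ C, 0 ≤ C ∧ ∀ x : ℝ, 0 ≤ x →
      ‖stableExt α x‖ ≤ C * Real.exp (-(stableDelta α * Real.exp x)) := by
  obtain ⟨C, hC, h⟩ := im_powLaplace_bound h0 h1
  refine ⟨2 * C, by linarith, fun x hx => ?_⟩
  have hI := h (Real.exp x) (Real.one_le_exp hx)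
  set b := (((Real.exp x) ^ (1 - α) : ℝ) : ℂ) * Complex.exp ((α * Real.pi : ℝ) * Complex.I) with hb
  have e1 : Complex.exp (Complex.I * Real.pi * α + (1 - α) * (x : ℂ)) = b := by
    rw [hb, ← Real.exp_mul, Complex.ofReal_exp, ← Complex.exp_add]
    congr 1; push_cast; ring
  have e2 : Complex.exp (-(Complex.I * Real.pi * α) + (1 - α) * (x : ℂ)) = starRingEnd ℂ b := by
    rw [hb, ← Real.exp_mul, Complex.ofReal_exp, ← Complex.exp_add, ← Complex.exp_conj]
    congr 1
    simp only [map_add, map_mul, Complex.conj_ofReal, Complex.conj_I]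
    push_cast; ring
  have hn := norm_stableExt_le α x
  rw [e1, e2, powLaplace_conj, norm_sub_rev, Complex.sub_conj, norm_mul, Complex.norm_I,
    mul_one, Complex.norm_real, Complex.ofReal_re, Real.norm_eq_abs, abs_mul, abs_two] at hn
  rw [abs_mul, ← Real.exp_neg, Real.abs_exp] at hI
  linarith

/-- Near the cut both terms of `stableExt` are controlled: one has an argument in the right half
plane, the other one carries the exponential rate. -/
lemma exists_norm_stableExt_le_sector (h0 : 1 / 3 < α) (h1 : α ≤ 1 / 2) :
    ∃ C, 0 ≤ C ∧ ∀ ζ : ℂ, 0 ≤ ζ.re → ζ.im ∈ Icc (2 * Real.pi / 3) Real.pi →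
      ‖stableExt α ζ‖ ≤ C * Real.exp (-(stableDelta α * (Complex.exp ζ).re)) := by
  have hα : 0 < α := by linarith
  have hp := Real.pi_pos
  have hd : 0 < stableDelta α := mul_pos (by linarith) (Real.rpow_pos_of_pos hα _)
  have hL : 0 ≤ laplaceInt α (1 / 2) := integral_nonneg fun u => (Real.exp_pos _).le
  refine ⟨1 + laplaceInt α (1 / 2), by linarith, fun ζ hx hy => ?_⟩
  obtain ⟨x, y, rfl⟩ : ∃ x y : ℝ, ζ = x + y * Complex.I := ⟨ζ.re, ζ.im, (Complex.re_add_im ζ).symm⟩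
  simp only [Complex.add_re, Complex.mul_re, Complex.ofReal_re, Complex.ofReal_im, Complex.I_re,
    Complex.I_im, Complex.add_im, Complex.mul_im, mul_zero, mul_one, sub_zero, add_zero, zero_add] at hx hy
  have hy' : |y - Real.pi| ≤ Real.pi / 3 := by
    rw [abs_of_nonpos (by linarith [hy.2])]; linarith [hy.1]
  have hcos := one_half_le_cos hy'
  have hre : (Complex.exp (x + y * Complex.I)).re = -(Real.exp x * Real.cos (y - Real.pi)) := by
    rw [Complex.exp_re, Real.cos_sub_pi]; simp
  have hex := Real.one_le_exp hx
  have a1 : ‖powLaplace α (Complex.exp (-(Complex.I * Real.pi * α) +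
      (1 - α) * (x + y * Complex.I)))‖ ≤ 1 := by
    apply norm_powLaplace_le_one
    have e : -(Complex.I * Real.pi * α) + (1 - α) * (x + y * Complex.I) =
        (((1 - α) * x : ℝ) : ℂ) + (((1 - α) * y - Real.pi * α : ℝ) : ℂ) * Complex.I := by
      push_cast; ring
    rw [e, Complex.exp_re]
    refine mul_nonneg (Real.exp_pos _).le (Real.cos_nonneg_of_mem_Icc ?_)
    simp only [Complex.add_im, Complex.mul_im, Complex.ofReal_re, Complex.ofReal_im, Complex.I_re,
      Complex.I_im, mul_zero, mul_one, zero_add, add_zero]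
    constructor
    · nlinarith [hy.1, hy.2]
    · nlinarith [hy.1, hy.2]
  have a2 : ‖powLaplace α (Complex.exp (Complex.I * Real.pi * α +
      (1 - α) * (x + y * Complex.I)))‖ ≤
      Real.exp x * (laplaceInt α (1 / 2) *
        Real.exp (stableDelta α * (Real.exp x * Real.cos (y - Real.pi)))) := by
    have e : Complex.exp (Complex.I * Real.pi * α + (1 - α) * (x + y * Complex.I)) =
        -Complex.exp ((1 - α) * (x + ((y - Real.pi : ℝ) : ℂ) * Complex.I)) := by
      have e' : Complex.I * Real.pi * α + (1 - α) * (x + y * Complex.I) =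
        (1 - α) * (x + ((y - Real.pi : ℝ) : ℂ) * Complex.I) + Real.pi * Complex.I := by
          push_cast; ring
      rw [e', Complex.exp_add, Complex.exp_pi_mul_I]; ring
    rw [e]
    refine (norm_powLaplace_neg_exp_le hα h1 x hy').trans ?_
    gcongr
    exact laplaceInt_le hα h1 (by nlinarith)
  refine (norm_stableExt_le _ _).trans ?_
  rw [hre, mul_neg, neg_neg]
  set E := Real.exp (stableDelta α * (Real.exp x * Real.cos (y - Real.pi))) with hE
  have hE1 : 1 ≤ E := Real.one_le_exp (by positivity)
  have hxr : ((x : ℂ) + y * Complex.I).re = x := by simp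
  rw [hxr]
  have hinv : Real.exp (-x) ≤ 1 := Real.exp_le_one_iff.2 (by linarith)
  calc _ ≤ Real.exp (-x) * (1 + Real.exp x * (laplaceInt α (1 / 2) * E)) := by
        gcongr
        exact (norm_sub_le _ _).trans (add_le_add a1 a2)
    _ = Real.exp (-x) + laplaceInt α (1 / 2) * E := by
        rw [mul_add, mul_one, ← mul_assoc, ← Real.exp_add]; simp
    _ ≤ (1 + laplaceInt α (1 / 2)) * E := by nlinarith
end

/-! ### Logarithmic potentials in the logarithmic coordinate -/

section

lemma norm_log_le_abs_log_add_pi (w : ℂ) : ‖Complex.log w‖ ≤ |Real.log ‖w‖| + Real.pi := by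
  refine (Complex.norm_le_abs_re_add_abs_im _).trans ?_
  rw [Complex.log_re, Complex.log_im]
  gcongr
  exact Complex.abs_arg_le_pi w

lemma norm_log_one_add_le {w : ℂ} (hw : ‖w‖ ≠ 1) :
    ‖Complex.log (1 + w)‖ ≤ |Real.log (‖w‖ - 1)| + Real.log (1 + ‖w‖) + Real.pi := by
  refine (norm_log_le_abs_log_add_pi _).trans ?_
  have h1 : ‖1 + w‖ ≤ 1 + ‖w‖ := (norm_add_le _ _).trans (by rw [norm_one])
  have h2 : |‖w‖ - 1| ≤ ‖1 + w‖ := by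
    have := abs_norm_sub_norm_le w (-1)
    rwa [norm_neg, norm_one, sub_neg_eq_add, add_comm w] at this
  have h3 : 0 < |‖w‖ - 1| := abs_pos.2 (sub_ne_zero.2 hw)
  have h4 := Real.log_le_log h3 h2
  have h5 := Real.log_le_log (h3.trans_le h2) h1
  have h6 : 0 ≤ Real.log (1 + ‖w‖) := Real.log_nonneg (by linarith [norm_nonneg w])
  rw [Real.log_abs] at h4
  have h7 := neg_abs_le (Real.log (‖w‖ - 1))
  have : |Real.log ‖1 + w‖| ≤ |Real.log (‖w‖ - 1)| + Real.log (1 + ‖w‖) := by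
    have := abs_nonneg (Real.log (‖w‖ - 1))
    rw [abs_le]; constructor <;> linarith
  linarith

/-- A majorant on the positive axis for `log (1 + τ e^{iφ})` times a density that is `O(1/τ)`
and `O(1/τ²)`. -/
noncomputable def logWeight (τ : ℝ) : ℝ :=
  if τ ≤ 1 / 2 then 2 else (|Real.log (τ - 1)| + Real.log (1 + τ) + Real.pi) / τ ^ 2

lemma measurable_logWeight : Measurable logWeight := by
  unfold logWeight
  refine Measurable.ite measurableSet_Iic measurable_const ?_
  have h1 : Measurable fun τ : ℝ => Real.log (τ - 1) := Real.measurable_log.comp (by fun_prop)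
  have h2 : Measurable fun τ : ℝ => Real.log (1 + τ) := Real.measurable_log.comp (by fun_prop)
  have h3 : Measurable fun τ : ℝ => |Real.log (τ - 1)| := h1.abs
  fun_prop

lemma logWeight_nonneg {τ : ℝ} (hτ : 0 < τ) : 0 ≤ logWeight τ := by
  rw [logWeight]
  have := Real.log_nonneg (by linarith : 1 ≤ 1 + τ)
  have := Real.pi_pos
  split_ifs <;> positivity

lemma integrableOn_logWeight : IntegrableOn logWeight (Ioi 0) := by
  have h : Ioi (0 : ℝ) = Ioc 0 (1 / 2) ∪ (Ioc (1 / 2) 3 ∪ Ioi 3) := by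
    rw [Ioc_union_Ioi_eq_Ioi (by norm_num), Ioc_union_Ioi_eq_Ioi (by norm_num)]
  rw [h]
  refine IntegrableOn.union ?_ (IntegrableOn.union ?_ ?_)
  · refine (integrableOn_const (C := (2 : ℝ)) (by simp)).congr_fun (fun τ hτ => ?_)
      measurableSet_Ioc
    simp only [logWeight, if_pos hτ.2]
  · have hi : IntervalIntegrable (fun τ : ℝ => Real.log (τ - 1)) volume (1 / 2) 3 := by
      have := (intervalIntegral.intervalIntegrable_log' (a := -(1 / 2)) (b := 2)).comp_sub_right 1
      convert this using 1 <;> norm_num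
    rw [intervalIntegrable_iff_integrableOn_Ioc_of_le (by norm_num)] at hi
    have hb : IntegrableOn (fun τ : ℝ => 4 * (|Real.log (τ - 1)| + (3 + Real.pi)))
        (Ioc (1 / 2) 3) :=
      (Integrable.add hi.abs (integrableOn_const (by simp))).const_mul 4
    refine Integrable.mono' hb measurable_logWeight.aestronglyMeasurable ?_
    filter_upwards [ae_restrict_mem measurableSet_Ioc] with τ hτ
    have hτ0 : 0 < τ := by linarith [hτ.1]
    rw [Real.norm_of_nonneg (logWeight_nonneg hτ0), logWeight, if_neg (not_le.2 hτ.1),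
      div_le_iff₀ (by positivity)]
    have h1 : Real.log (1 + τ) ≤ 3 := by
      have := Real.log_le_sub_one_of_pos (by linarith : 0 < 1 + τ)
      linarith [hτ.2]
    have h2 : 1 / 4 ≤ τ ^ 2 := by nlinarith [hτ.1]
    have h3 := abs_nonneg (Real.log (τ - 1))
    have := Real.pi_pos
    nlinarith
  · have hb := (integrableOn_Ioi_rpow_of_lt (a := -(3 / 2)) (c := 3) (by norm_num)
      (by norm_num)).const_mul 16
    refine Integrable.mono' hb measurable_logWeight.aestronglyMeasurable ?_
    filter_upwards [ae_restrict_mem measurableSet_Ioi] with τ hτ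
    have hτ : 3 < τ := hτ
    have hτ0 : 0 < τ := by linarith
    rw [Real.norm_of_nonneg (logWeight_nonneg hτ0), logWeight, if_neg (by linarith)]
    have hs : τ ^ (-(3 / 2) : ℝ) = Real.sqrt τ / τ ^ 2 := by
      rw [show (-(3 / 2) : ℝ) = 1 / 2 - 2 by norm_num, Real.rpow_sub hτ0, Real.sqrt_eq_rpow]
      norm_num
    rw [hs, ← mul_div_assoc]
    gcongr
    have hsq := Real.sq_sqrt hτ0.le
    have hs1 : 1 ≤ Real.sqrt τ := Real.one_le_sqrt.2 (by linarith)
    have h0 : 0 ≤ Real.log (τ - 1) := Real.log_nonneg (by linarith)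
    have h1 : Real.log (τ - 1) ≤ Real.log (1 + τ) := Real.log_le_log (by linarith) (by linarith)
    have h2 : Real.log (1 + τ) ≤ 4 * Real.sqrt τ := by
      have h := Real.log_le_rpow_div (by linarith : 0 ≤ 1 + τ) (by norm_num : (0 : ℝ) < 1 / 2)
      rw [← Real.sqrt_eq_rpow] at h
      have : Real.sqrt (1 + τ) ≤ 2 * Real.sqrt τ := by
        rw [Real.sqrt_le_left (by positivity)]; nlinarith
      linarith
    rw [abs_of_nonneg h0]
    linarith [Real.pi_lt_four]

lemma norm_log_one_add_mul_le {w : ℂ} {D h : ℝ} (hw : 0 < ‖w‖) (hw1 : ‖w‖ ≠ 1)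
    (h1 : |h| ≤ D / ‖w‖) (h2 : |h| ≤ D / ‖w‖ ^ 2) :
    ‖Complex.log (1 + w) * (h : ℂ)‖ ≤ D * logWeight ‖w‖ := by
  rw [norm_mul, Complex.norm_real, Real.norm_eq_abs, logWeight]
  split_ifs with hs
  · calc _ ≤ 2 * ‖w‖ * (D / ‖w‖) := by
          gcongr
          exact (Complex.norm_log_one_add_half_le_self hs).trans (by linarith)
      _ = D * 2 := by field_simp
  · calc _ ≤ (|Real.log (‖w‖ - 1)| + Real.log (1 + ‖w‖) + Real.pi) * (D / ‖w‖ ^ 2) := by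
          have := norm_log_one_add_le hw1
          gcongr
          exact (norm_nonneg _).trans this
      _ = _ := by ring

/-- A continuous nonnegative density on the positive axis, integrable and `O(1/t)`, `O(1/t²)`. -/
structure PotentialDensity (g : ℝ → ℝ) (C : ℝ) : Prop where
  continuousOn : ContinuousOn g (Ioi 0)
  nonneg : ∀ t, 0 < t → 0 ≤ g t
  le_div : ∀ t, 0 < t → |g t| ≤ C / t
  le_div_sq : ∀ t, 0 < t → |g t| ≤ C / t ^ 2
  integrableOn : IntegrableOn g (Ioi 0)

/-- The logarithmic potential `∫ log (1 + t / z) g(t) dt` at `z = exp ζ`. -/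
noncomputable def logPotential (g : ℝ → ℝ) (ζ : ℂ) : ℂ :=
  ∫ t in Ioi (0 : ℝ), Complex.log (1 + t * Complex.exp (-ζ)) * (g t : ℂ)

/-- The integrand of `logPotential` after the substitution `t = |z| τ`, which makes the singularity
of the logarithm independent of `|z|`. -/
noncomputable def logPotentialKernel (g : ℝ → ℝ) (ζ : ℂ) (τ : ℝ) : ℂ :=
  Complex.log (1 + τ * Complex.exp (-(ζ.im * Complex.I))) *
    ((Real.exp ζ.re * g (Real.exp ζ.re * τ) : ℝ) : ℂ)

lemma logPotentialKernel_eq (g : ℝ → ℝ) (ζ : ℂ) (τ : ℝ) : logPotentialKernel g ζ τ =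
    (Real.exp ζ.re : ℂ) * (Complex.log (1 + ((Real.exp ζ.re * τ : ℝ) : ℂ) * Complex.exp (-ζ)) *
      (g (Real.exp ζ.re * τ) : ℂ)) := by
  have : Complex.exp (-(ζ.im * Complex.I)) = (Real.exp ζ.re : ℂ) * Complex.exp (-ζ) := by
    rw [Complex.ofReal_exp, ← Complex.exp_add]
    congr 1
    nth_rw 3 [← Complex.re_add_im ζ]
    ring
  rw [logPotentialKernel, this]
  push_cast
  ring_nf

lemma logPotential_eq (g : ℝ → ℝ) (ζ : ℂ) :
    logPotential g ζ = ∫ τ in Ioi (0 : ℝ), logPotentialKernel g ζ τ := by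
  simp only [logPotentialKernel_eq]
  rw [integral_const_mul, integral_comp_mul_left_Ioi (fun t : ℝ =>
    Complex.log (1 + (t : ℂ) * Complex.exp (-ζ)) * (g t : ℂ)) 0 (Real.exp_pos _), mul_zero,
    Complex.real_smul, logPotential, Complex.ofReal_inv, mul_inv_cancel_left₀]
  exact Complex.ofReal_ne_zero.2 (Real.exp_pos _).ne'

variable {g : ℝ → ℝ} {C : ℝ}

lemma PotentialDensity.const_nonneg (hg : PotentialDensity g C) : 0 ≤ C := by
  have := (abs_nonneg _).trans (hg.le_div 1 one_pos)
  simpa using this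

lemma norm_logPotentialKernel_le (hg : PotentialDensity g C) {M : ℝ} (hM : 0 ≤ M) {ζ : ℂ}
    (hζ : -M ≤ ζ.re) {τ : ℝ} (hτ : 0 < τ) (hτ1 : τ ≠ 1) :
    ‖logPotentialKernel g ζ τ‖ ≤ C * Real.exp M * logWeight τ := by
  have hC := hg.const_nonneg
  have hn : ‖(τ : ℂ) * Complex.exp (-(ζ.im * Complex.I))‖ = τ := by
    rw [norm_mul, ← neg_mul, ← Complex.ofReal_neg, Complex.norm_exp_ofReal_mul_I, mul_one,
      Complex.norm_real, Real.norm_of_nonneg hτ.le]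
  have he := Real.exp_pos ζ.re
  have h1 := hg.le_div _ (mul_pos he hτ)
  have h2 := hg.le_div_sq _ (mul_pos he hτ)
  have hM1 := Real.one_le_exp hM
  have hM2 : 1 ≤ Real.exp M * Real.exp ζ.re := by
    rw [← Real.exp_add]; exact Real.one_le_exp (by linarith)
  have key := norm_log_one_add_mul_le (w := (τ : ℂ) * Complex.exp (-(ζ.im * Complex.I)))
    (D := C * Real.exp M) (h := Real.exp ζ.re * g (Real.exp ζ.re * τ))
    (by rwa [hn]) (by rwa [hn]) ?_ ?_
  · rwa [hn] at key
  · rw [hn, abs_mul, Real.abs_exp]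
    calc _ ≤ Real.exp ζ.re * (C / (Real.exp ζ.re * τ)) := by gcongr
      _ = C * 1 / τ := by field_simp
      _ ≤ _ := by gcongr
  · rw [hn, abs_mul, Real.abs_exp]
    calc _ ≤ Real.exp ζ.re * (C / (Real.exp ζ.re * τ) ^ 2) := by gcongr
      _ = C / (Real.exp ζ.re * τ ^ 2) * 1 := by field_simp
      _ ≤ C / (Real.exp ζ.re * τ ^ 2) * (Real.exp M * Real.exp ζ.re) := by gcongr
      _ = _ := by field_simp

lemma ae_ne_one : ∀ᵐ τ ∂(volume.restrict (Ioi (0 : ℝ))), τ ≠ 1 :=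
  ae_restrict_of_ae (by simp [ae_iff, measure_singleton])

lemma measurable_log_one_add_mul (w : ℂ) :
    Measurable fun τ : ℝ => Complex.log (1 + τ * w) :=
  Complex.measurable_log.comp (by fun_prop)

lemma aestronglyMeasurable_logPotentialKernel (hg : PotentialDensity g C) (ζ : ℂ) :
    AEStronglyMeasurable (logPotentialKernel g ζ) (volume.restrict (Ioi 0)) := by
  have h : ContinuousOn (fun τ : ℝ => ((Real.exp ζ.re * g (Real.exp ζ.re * τ) : ℝ) : ℂ))
      (Ioi 0) := by
    refine Complex.continuous_ofReal.comp_continuousOn (continuousOn_const.mul ?_)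
    exact hg.continuousOn.comp (by fun_prop) fun τ hτ => mul_pos (Real.exp_pos _) hτ
  exact (measurable_log_one_add_mul _).aestronglyMeasurable.mul
    (h.aestronglyMeasurable measurableSet_Ioi)

lemma ae_norm_logPotentialKernel_le (hg : PotentialDensity g C) {M : ℝ} (hM : 0 ≤ M) {ζ : ℂ}
    (hζ : -M ≤ ζ.re) : ∀ᵐ τ ∂(volume.restrict (Ioi (0 : ℝ))),
    ‖logPotentialKernel g ζ τ‖ ≤ C * Real.exp M * logWeight τ := by
  filter_upwards [ae_restrict_mem measurableSet_Ioi, ae_ne_one] with τ hτ hτ1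
  exact norm_logPotentialKernel_le hg hM hζ hτ hτ1

lemma integrableOn_logPotential (hg : PotentialDensity g C) (ζ : ℂ) :
    IntegrableOn (fun t : ℝ => Complex.log (1 + t * Complex.exp (-ζ)) * (g t : ℂ)) (Ioi 0) := by
  have hi : IntegrableOn (logPotentialKernel g ζ) (Ioi 0) :=
    Integrable.mono' (integrableOn_logWeight.const_mul (C * Real.exp |ζ.re|))
      (aestronglyMeasurable_logPotentialKernel hg ζ)
      (ae_norm_logPotentialKernel_le hg (abs_nonneg _) (neg_abs_le _))
  have he := Real.exp_pos ζ.re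
  have := (integrableOn_Ioi_comp_mul_left_iff (fun t : ℝ =>
    Complex.log (1 + t * Complex.exp (-ζ)) * (g t : ℂ)) 0 he).1 (by
      refine (hi.const_mul ((Real.exp ζ.re)⁻¹ : ℂ)).congr (Eventually.of_forall fun τ => ?_)
      simp only [logPotentialKernel_eq]
      rw [inv_mul_cancel_left₀ (Complex.ofReal_ne_zero.2 he.ne')])
  rwa [mul_zero] at this

lemma norm_logPotential_le (hg : PotentialDensity g C) {ζ : ℂ} (hζ : 0 ≤ ζ.re) :
    ‖logPotential g ζ‖ ≤ C * ∫ τ in Ioi (0 : ℝ), logWeight τ := by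
  rw [logPotential_eq, ← integral_const_mul]
  refine norm_integral_le_of_norm_le (integrableOn_logWeight.const_mul C) ?_
  have := ae_norm_logPotentialKernel_le hg le_rfl (ζ := ζ) (by simpa using hζ)
  simpa using this

/-- The principal logarithm is continuous on the closed upper half plane minus the origin. -/
lemma continuousWithinAt_log_upper {w : ℂ} (hw : w ≠ 0) :
    ContinuousWithinAt Complex.log {z | 0 ≤ z.im} w := by
  by_cases h : w ∈ Complex.slitPlane
  · exact (continuousAt_clog h).continuousWithinAt
  · rw [Complex.mem_slitPlane_iff, not_or, not_lt, not_not] at h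
    refine Complex.continuousWithinAt_log_of_re_neg_of_im_zero (lt_of_le_of_ne h.1 fun h0 => ?_) h.2
    exact hw (Complex.ext h0 h.2)

lemma im_one_add_mul_exp (τ y : ℝ) :
    (1 + τ * Complex.exp (-(y * Complex.I))).im = -(τ * Real.sin y) := by
  rw [← neg_mul, ← Complex.ofReal_neg, Complex.add_im, Complex.im_ofReal_mul,
    Complex.exp_ofReal_mul_I_im, Real.sin_neg]
  simp

lemma one_add_mul_exp_ne_zero {τ : ℝ} (hτ : 0 < τ) (hτ1 : τ ≠ 1) (y : ℝ) :
    1 + τ * Complex.exp (-(y * Complex.I)) ≠ 0 := by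
  intro h
  have := congrArg norm (eq_neg_of_add_eq_zero_right h)
  rw [norm_mul, ← neg_mul, ← Complex.ofReal_neg, Complex.norm_exp_ofReal_mul_I, mul_one,
      Complex.norm_real, Real.norm_of_nonneg hτ.le, norm_neg, norm_one] at this
  exact hτ1 this

lemma sin_nonpos_of_mem_Icc {y : ℝ} (hy : y ∈ Icc (-Real.pi) 0) : Real.sin y ≤ 0 :=
  Real.sin_nonpos_of_nonpos_of_neg_pi_le hy.2 hy.1

lemma continuousOn_logPotential (hg : PotentialDensity g C) :
    ContinuousOn (logPotential g) (Complex.im ⁻¹' Icc (-Real.pi) 0) := by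
  intro ζ hζ
  have e : logPotential g = fun ζ => ∫ τ in Ioi (0 : ℝ), logPotentialKernel g ζ τ :=
    funext fun ζ => logPotential_eq g ζ
  rw [e]
  refine continuousWithinAt_of_dominated
    (bound := fun τ => C * Real.exp (|ζ.re| + 1) * logWeight τ)
    (Eventually.of_forall fun ζ => aestronglyMeasurable_logPotentialKernel hg ζ) ?_
    (integrableOn_logWeight.const_mul _) ?_
  · have h : ∀ᶠ w : ℂ in 𝓝 ζ, -(|ζ.re| + 1) < w.re :=
      Complex.continuous_re.continuousAt.eventually
        (lt_mem_nhds (by linarith [neg_abs_le ζ.re]))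
    filter_upwards [nhdsWithin_le_nhds h] with w hw
    exact ae_norm_logPotentialKernel_le hg (by positivity) hw.le
  · filter_upwards [ae_restrict_mem measurableSet_Ioi, ae_ne_one] with τ hτ hτ1
    have hτ : 0 < τ := hτ
    have hlog : ContinuousWithinAt
        (fun ζ : ℂ => Complex.log (1 + τ * Complex.exp (-(ζ.im * Complex.I))))
        (Complex.im ⁻¹' Icc (-Real.pi) 0) ζ := by
      refine ContinuousWithinAt.comp (t := {z | 0 ≤ z.im}) (g := Complex.log)
        (f := fun ζ : ℂ => 1 + τ * Complex.exp (-(ζ.im * Complex.I)))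
        (continuousWithinAt_log_upper (one_add_mul_exp_ne_zero hτ hτ1 _)) ?_ ?_
      · have : Continuous fun ζ : ℂ => 1 + τ * Complex.exp (-(ζ.im * Complex.I)) := by
          have := Complex.continuous_ofReal.comp Complex.continuous_im
          fun_prop
        exact this.continuousWithinAt
      · intro w hw
        rw [mem_ofPred_eq, im_one_add_mul_exp]
        nlinarith [sin_nonpos_of_mem_Icc hw]
    have hcg : ContinuousAt (fun ζ : ℂ => g (Real.exp ζ.re * τ)) ζ := by
      have h1 : ContinuousAt g (Real.exp ζ.re * τ) :=
        hg.continuousOn.continuousAt (Ioi_mem_nhds (mul_pos (Real.exp_pos _) hτ))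
      exact h1.comp (f := fun ζ : ℂ => Real.exp ζ.re * τ) (by fun_prop)
    have hexp : ContinuousAt (fun ζ : ℂ => Real.exp ζ.re) ζ := by fun_prop
    exact hlog.mul
      ((Complex.continuous_ofReal.continuousAt.comp (hexp.mul hcg)).continuousWithinAt)

/-- In the open strip the kernel of the derivative is bounded, so no scaling is needed there. -/
lemma differentiableAt_logPotential (hg : PotentialDensity g C) {ζ : ℂ}
    (hζ : ζ.im ∈ Ioo (-Real.pi) 0) : DifferentiableAt ℂ (logPotential g) ζ := by
  set c := -Real.sin ζ.im / 2 with hc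
  have hs : Real.sin ζ.im < 0 := Real.sin_neg_of_neg_of_neg_pi_lt hζ.2 hζ.1
  have hc0 : 0 < c := by rw [hc]; linarith
  have him : ∀ (w : ℂ) (t : ℝ), (1 + t * Complex.exp (-w)).im =
      -(t * Real.exp (-w.re) * Real.sin w.im) := by
    intro w t
    rw [Complex.add_im, Complex.im_ofReal_mul, Complex.exp_im, Complex.neg_re, Complex.neg_im,
      Real.sin_neg, Complex.one_im]
    ring
  have hnhds : {w : ℂ | c < -Real.sin w.im} ∈ 𝓝 ζ := by
    refine (isOpen_lt continuous_const ?_).mem_nhds ?_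
    · fun_prop
    · rw [mem_ofPred_eq, hc]; linarith
  have hg' : AEStronglyMeasurable (fun t : ℝ => (g t : ℂ)) (volume.restrict (Ioi 0)) :=
    (Complex.continuous_ofReal.comp_continuousOn hg.continuousOn).aestronglyMeasurable
      measurableSet_Ioi
  have hpos : ∀ w ∈ {w : ℂ | c < -Real.sin w.im}, ∀ t : ℝ, 0 < t →
      t * Real.exp (-w.re) * c ≤ (1 + t * Complex.exp (-w)).im := by
    intro w hw t ht
    have hw : c < -Real.sin w.im := hw
    rw [him]
    have := mul_pos ht (Real.exp_pos (-w.re))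
    nlinarith
  refine (hasDerivAt_integral_of_dominated_loc_of_deriv_le (𝕜 := ℂ)
    (F := fun (w : ℂ) (t : ℝ) => Complex.log (1 + t * Complex.exp (-w)) * (g t : ℂ))
    (F' := fun (w : ℂ) (t : ℝ) => t * (Complex.exp (-w) * -1) / (1 + t * Complex.exp (-w)) *
      (g t : ℂ))
    (bound := fun t => 1 / c * g t) hnhds ?_ (integrableOn_logPotential hg ζ) ?_ ?_
    (hg.integrableOn.const_mul _) ?_).2.differentiableAt
  · exact Eventually.of_forall fun w =>
      (measurable_log_one_add_mul _).aestronglyMeasurable.mul hg'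
  · refine AEStronglyMeasurable.mul (Measurable.aestronglyMeasurable ?_) hg'
    fun_prop
  · filter_upwards [ae_restrict_mem measurableSet_Ioi] with t ht w hw
    have ht : 0 < t := ht
    have h1 := hpos w hw t ht
    have h2 : 0 < t * Real.exp (-w.re) := mul_pos ht (Real.exp_pos (-w.re))
    have h3 : t * Real.exp (-w.re) * c ≤ ‖1 + t * Complex.exp (-w)‖ :=
      h1.trans ((le_abs_self _).trans (Complex.abs_im_le_norm _))
    rw [norm_mul, Complex.norm_real, Real.norm_of_nonneg (hg.nonneg t ht)]
    refine mul_le_mul_of_nonneg_right ?_ (hg.nonneg t ht)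
    rw [norm_div, norm_mul, norm_mul, norm_neg, norm_one, mul_one, Complex.norm_real,
      Complex.norm_exp, Complex.neg_re, Real.norm_of_nonneg ht.le,
      div_le_div_iff₀ (lt_of_lt_of_le (mul_pos h2 hc0) h3) hc0]
    linarith
  · filter_upwards [ae_restrict_mem measurableSet_Ioi] with t ht w hw
    have ht : 0 < t := ht
    have h1 := hpos w hw t ht
    have h2 : 0 < t * Real.exp (-w.re) := mul_pos ht (Real.exp_pos (-w.re))
    have hsl : 1 + t * Complex.exp (-w) ∈ Complex.slitPlane := by
      rw [Complex.mem_slitPlane_iff]; right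
      exact ((mul_pos h2 hc0).trans_le h1).ne'
    have hd : HasDerivAt (fun w : ℂ => 1 + t * Complex.exp (-w)) (t * (Complex.exp (-w) * -1)) w :=
      (((hasDerivAt_neg w).cexp).const_mul (t : ℂ)).const_add 1
    exact (hd.clog hsl).mul_const _

lemma logPotential_im_of_im_eq_zero {ζ : ℂ} (hζ : ζ.im = 0) : (logPotential g ζ).im = 0 := by
  obtain ⟨x, rfl⟩ : ∃ x : ℝ, ζ = x := ⟨ζ.re, Complex.ext rfl (by simpa using hζ)⟩
  have : logPotential g x =
      ((∫ t in Ioi (0 : ℝ), Real.log (1 + t * Real.exp (-x)) * g t : ℝ) : ℂ) := by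
    rw [logPotential, ← integral_complex_ofReal]
    refine setIntegral_congr_fun measurableSet_Ioi fun t ht => ?_
    have ht : 0 < t := ht
    rw [Complex.ofReal_mul, Complex.ofReal_log (by positivity)]
    push_cast; rfl
  rw [this, Complex.ofReal_im]

/-- Below the cut the argument of `1 + t / z` jumps from `0` to `π` at `t = |z|`. -/
lemma logPotential_im_of_im_eq_neg_pi (hg : PotentialDensity g C) (x : ℝ) :
    (logPotential g (x - Real.pi * Complex.I)).im =
      Real.pi * ∫ t in Ioi (Real.exp x), g t := by
  have hexp : Complex.exp (-(x - Real.pi * Complex.I)) = ((-Real.exp (-x) : ℝ) : ℂ) := by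
    rw [neg_sub, sub_eq_neg_add, Complex.exp_add, Complex.exp_pi_mul_I]; push_cast; ring
  have hi := integrableOn_logPotential hg (x - Real.pi * Complex.I)
  have h1 : (logPotential g (x - Real.pi * Complex.I)).im =
      ∫ t in Ioi (0 : ℝ), (Complex.log (1 + t * Complex.exp (-(x - Real.pi * Complex.I))) *
        (g t : ℂ)).im := (integral_im hi).symm
  rw [h1, ← integral_const_mul]
  have h2 : ∫ t in Ioi (Real.exp x), Real.pi * g t =
      ∫ t in Ioi (0 : ℝ), (Ioi (Real.exp x)).indicator (fun t => Real.pi * g t) t := by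
    rw [setIntegral_indicator measurableSet_Ioi, Ioi_inter_Ioi, sup_of_le_right (Real.exp_pos x).le]
  rw [h2]
  refine setIntegral_congr_fun measurableSet_Ioi fun t ht => ?_
  have e : (1 : ℂ) + t * Complex.exp (-(x - Real.pi * Complex.I)) =
      ((1 - t * Real.exp (-x) : ℝ) : ℂ) := by rw [hexp]; push_cast; ring
  rw [e, Complex.im_mul_ofReal, Complex.log_im]
  have hiff : Real.exp x < t ↔ 1 < t * Real.exp (-x) := by
    rw [Real.exp_neg, ← div_eq_mul_inv, one_lt_div (Real.exp_pos x)]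
  by_cases h : Real.exp x < t
  · rw [indicator_of_mem (mem_Ioi.2 h), Complex.arg_ofReal_of_neg (by linarith [hiff.1 h])]
  · rw [indicator_of_notMem (by simpa using h), Complex.arg_ofReal_of_nonneg, zero_mul]
    linarith [not_lt.1 (fun h' => h (hiff.2 h'))]

lemma tendsto_logPotential_atTop (hg : PotentialDensity g C) (y : ℝ) :
    Tendsto (fun x : ℝ => logPotential g (x + y * Complex.I)) atTop (𝓝 0) := by
  simp only [logPotential_eq]
  have h0 : ∫ τ in Ioi (0 : ℝ), (0 : ℂ) = 0 := by simp
  rw [← h0]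
  refine tendsto_integral_filter_of_dominated_convergence
    (fun τ => C * Real.exp 0 * logWeight τ)
    (Eventually.of_forall fun x => aestronglyMeasurable_logPotentialKernel hg _) ?_
    (integrableOn_logWeight.const_mul _) ?_
  · filter_upwards [eventually_ge_atTop 0] with x hx
    exact ae_norm_logPotentialKernel_le hg le_rfl (by simpa using hx)
  · filter_upwards [ae_restrict_mem measurableSet_Ioi] with τ hτ
    have hτ : 0 < τ := hτ
    have hk : Tendsto (fun x : ℝ => Real.exp x * g (Real.exp x * τ)) atTop (𝓝 0) := by
      have hb : Tendsto (fun x : ℝ => C / τ ^ 2 * Real.exp (-x)) atTop (𝓝 0) := by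
        simpa using (Real.tendsto_exp_neg_atTop_nhds_zero).const_mul (C / τ ^ 2)
      refine squeeze_zero_norm (fun x => ?_) hb
      have he := Real.exp_pos x
      rw [Real.norm_eq_abs, abs_mul, Real.abs_exp, Real.exp_neg]
      calc _ ≤ Real.exp x * (C / (Real.exp x * τ) ^ 2) := by
            gcongr
            exact hg.le_div_sq _ (mul_pos he hτ)
        _ = _ := by field_simp
    have := ((Complex.continuous_ofReal.tendsto 0).comp hk).const_mul
      (Complex.log (1 + τ * Complex.exp (-(y * Complex.I))))
    rw [Complex.ofReal_zero, mul_zero] at this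
    refine this.congr fun x => ?_
    simp [logPotentialKernel]

lemma re_logPotential_le (hg : PotentialDensity g C) {ζ : ℂ} (hζ : ζ.re ≤ 0) :
    (logPotential g ζ).re ≤
      -ζ.re * (∫ t in Ioi (0 : ℝ), g t) + C * ∫ τ in Ioi (0 : ℝ), logWeight τ := by
  have h0 := integrableOn_logPotential hg 0
  have hζi := integrableOn_logPotential hg ζ
  have e0 : (logPotential g 0).re = ∫ t in Ioi (0 : ℝ),
      (Complex.log (1 + t * Complex.exp (-0)) * (g t : ℂ)).re := (integral_re h0).symm
  have e1 : (logPotential g ζ).re = ∫ t in Ioi (0 : ℝ),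
      (Complex.log (1 + t * Complex.exp (-ζ)) * (g t : ℂ)).re := (integral_re hζi).symm
  have hb : (logPotential g 0).re ≤ C * ∫ τ in Ioi (0 : ℝ), logWeight τ :=
    (Complex.re_le_norm _).trans (norm_logPotential_le hg (by simp))
  refine le_trans ?_ (add_le_add_right hb _)
  have h0r : IntegrableOn (fun t : ℝ => (Complex.log (1 + t * Complex.exp (-0)) * (g t : ℂ)).re)
    (Ioi 0) := h0.re
  have hζr : IntegrableOn (fun t : ℝ => (Complex.log (1 + t * Complex.exp (-ζ)) * (g t : ℂ)).re)
    (Ioi 0) := hζi.re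
  rw [e0, e1, ← integral_const_mul, ← integral_add (hg.integrableOn.const_mul _) h0r]
  refine setIntegral_mono_on hζr ((hg.integrableOn.const_mul _).add h0r) measurableSet_Ioi
    fun t ht => ?_
  have ht : 0 < t := ht
  have hgt := hg.nonneg t ht
  simp only [neg_zero, Complex.exp_zero, mul_one]
  rw [Complex.re_mul_ofReal, Complex.re_mul_ofReal, ← add_mul, Complex.log_re, Complex.log_re]
  refine mul_le_mul_of_nonneg_right ?_ hgt
  have n1 : ‖(1 : ℂ) + t‖ = 1 + t := by
    rw [← Complex.ofReal_one, ← Complex.ofReal_add, Complex.norm_real,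
      Real.norm_of_nonneg (by linarith)]
  have hx : 1 ≤ Real.exp (-ζ.re) := Real.one_le_exp (by linarith)
  have n2 : ‖1 + t * Complex.exp (-ζ)‖ ≤ Real.exp (-ζ.re) * (1 + t) := by
    refine (norm_add_le _ _).trans ?_
    rw [norm_one, norm_mul, Complex.norm_exp, Complex.norm_real, Real.norm_of_nonneg ht.le,
      Complex.neg_re]
    linarith
  rw [n1]
  rcases (norm_nonneg (1 + t * Complex.exp (-ζ))).eq_or_lt with h | h
  · rw [← h, Real.log_zero]
    have := Real.log_nonneg (by linarith : 1 ≤ 1 + t)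
    linarith
  · have := Real.log_le_log h n2
    rwa [Real.log_mul (Real.exp_pos _).ne' (by linarith), Real.log_exp] at this
end

/-! ### The quotient is constant -/

section
variable {α : ℝ}

lemma deriv_stableTheta (h0 : 1 / 3 < α) (h1 : α ≤ 1 / 2) {r : ℝ} (hr : 0 < r) :
    deriv (stableTheta α) r = stableThetaDeriv α r := (hasDerivAt_stableTheta h0 h1 hr).deriv

lemma hasDerivAt_stableTheta_deriv (h0 : 1 / 3 < α) (h1 : α ≤ 1 / 2) {r : ℝ} (hr : 0 < r) :
    HasDerivAt (stableTheta α) (deriv (stableTheta α) r) r :=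
  (hasDerivAt_stableTheta h0 h1 hr).differentiableAt.hasDerivAt

lemma deriv_stableTheta_nonneg (h0 : 1 / 3 < α) (h1 : α ≤ 1 / 2) {r : ℝ} (hr : 0 < r) :
    0 ≤ deriv (stableTheta α) r := by
  have := (monotoneOn_stableTheta h0 h1).derivWithin_nonneg (x := r)
  rwa [derivWithin_of_isOpen isOpen_Ioi hr] at this

/-- The extension of `stableTheta` to `0` by its limit `α`. -/
lemma stableTheta_update (h0 : 1 / 3 < α) (h1 : α ≤ 1 / 2) :
    ContinuousWithinAt (Function.update (stableTheta α) 0 α) (Ici 0) 0 ∧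
    (∀ r ∈ Ioi (0 : ℝ), HasDerivAt (Function.update (stableTheta α) 0 α)
      (deriv (stableTheta α) r) r) ∧
    Tendsto (Function.update (stableTheta α) 0 α) atTop (𝓝 (1 / 2)) := by
  refine ⟨?_, fun r hr => ?_, ?_⟩
  · rw [continuousWithinAt_update_same, Ici_sdiff_left]
    exact tendsto_stableTheta_zero h0 h1
  · refine (hasDerivAt_stableTheta_deriv h0 h1 hr).congr_of_eventuallyEq ?_
    filter_upwards [Ioi_mem_nhds hr] with s hs
    exact Function.update_of_ne (ne_of_gt hs) _ _
  · refine (tendsto_stableTheta_atTop h0 h1).congr' ?_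
    filter_upwards [eventually_gt_atTop 0] with s hs
    exact (Function.update_of_ne (ne_of_gt hs) _ _).symm

lemma integrableOn_deriv_stableTheta (h0 : 1 / 3 < α) (h1 : α ≤ 1 / 2) :
    IntegrableOn (deriv (stableTheta α)) (Ioi 0) := by
  obtain ⟨a, b, c⟩ := stableTheta_update h0 h1
  exact integrableOn_Ioi_deriv_of_nonneg a b (fun r hr => deriv_stableTheta_nonneg h0 h1 hr) c

lemma integral_deriv_stableTheta (h0 : 1 / 3 < α) (h1 : α ≤ 1 / 2) :
    ∫ t in Ioi (0 : ℝ), deriv (stableTheta α) t = 1 / 2 - α := by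
  obtain ⟨a, b, c⟩ := stableTheta_update h0 h1
  rw [integral_Ioi_of_hasDerivAt_of_tendsto a b (integrableOn_deriv_stableTheta h0 h1) c,
    Function.update_self]

lemma integral_deriv_stableTheta_Ioi (h0 : 1 / 3 < α) (h1 : α ≤ 1 / 2) {r : ℝ} (hr : 0 < r) :
    ∫ t in Ioi r, deriv (stableTheta α) t = 1 / 2 - stableTheta α r :=
  integral_Ioi_of_hasDerivAt_of_tendsto'
    (fun _ hs => hasDerivAt_stableTheta_deriv h0 h1 (hr.trans_le hs))
    ((integrableOn_deriv_stableTheta h0 h1).mono_set (Ioi_subset_Ioi hr.le))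
    (tendsto_stableTheta_atTop h0 h1)

lemma exists_potentialDensity (h0 : 1 / 3 < α) (h1 : α ≤ 1 / 2) :
    ∃ C, PotentialDensity (deriv (stableTheta α)) C := by
  obtain ⟨C, _, h⟩ := exists_abs_stableThetaDeriv_le h0 h1
  refine ⟨C, ⟨?_, fun t ht => deriv_stableTheta_nonneg h0 h1 ht, fun t ht => ?_, fun t ht => ?_,
    integrableOn_deriv_stableTheta h0 h1⟩⟩
  · exact (continuousOn_stableThetaDeriv h0 h1).congr fun t ht => deriv_stableTheta h0 h1 ht
  · rw [deriv_stableTheta h0 h1 ht]; exact (h t ht).1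
  · rw [deriv_stableTheta h0 h1 ht]; exact (h t ht).2

/-- The quotient of `stableExt` by the claimed closed form, up to the constant. -/
noncomputable def stableQuotient (α : ℝ) (ζ : ℂ) : ℂ :=
  stableExt α ζ * Complex.exp (stableDelta α * Complex.exp ζ) * Complex.exp (ζ / 2) *
    Complex.exp (logPotential (deriv (stableTheta α)) ζ)

lemma norm_stableQuotient (α : ℝ) (ζ : ℂ) : ‖stableQuotient α ζ‖ = ‖stableExt α ζ‖ *
    Real.exp (stableDelta α * (Complex.exp ζ).re + ζ.re / 2 +
      (logPotential (deriv (stableTheta α)) ζ).re) := by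
  rw [stableQuotient, norm_mul, norm_mul, norm_mul, Complex.norm_exp, Complex.norm_exp,
    Complex.norm_exp, Complex.re_ofReal_mul, Real.exp_add, Real.exp_add,
    show (ζ / 2).re = ζ.re / 2 by simp]
  ring

lemma stableDelta_pos (h0 : 0 < α) (h1 : α ≤ 1 / 2) : 0 < stableDelta α :=
  mul_pos (by linarith) (Real.rpow_pos_of_pos h0 _)

/-- At the origin the powers of `z` cancel: `-α` from `stableExt`, `1/2` from the square root and
`α - 1/2` from the potential, whose total mass is `1/2 - α`. -/
lemma exists_norm_stableQuotient_le_left (h0 : 1 / 3 < α) (h1 : α ≤ 1 / 2) :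
    ∃ A, 0 ≤ A ∧ ∀ ζ : ℂ, ζ.re ≤ 0 → ‖stableQuotient α ζ‖ ≤ A := by
  have hα : 0 < α := by linarith
  obtain ⟨C, hC, hb⟩ := exists_norm_stableExt_le_left hα h1
  obtain ⟨D, hD⟩ := exists_potentialDensity h0 h1
  set W := D * ∫ τ in Ioi (0 : ℝ), logWeight τ with hW
  refine ⟨C * Real.exp (stableDelta α + W), by positivity, fun ζ hζ => ?_⟩
  have hd := stableDelta_pos hα h1
  have h := re_logPotential_le hD hζ
  rw [integral_deriv_stableTheta h0 h1, ← hW] at h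
  have he : (Complex.exp ζ).re ≤ 1 := by
    refine (Complex.re_le_norm _).trans ?_
    rw [Complex.norm_exp]; exact Real.exp_le_one_iff.2 hζ
  rw [norm_stableQuotient]
  calc _ ≤ C * Real.exp (-(α * ζ.re)) * Real.exp (stableDelta α * 1 + ζ.re / 2 +
        (-ζ.re * (1 / 2 - α) + W)) := by
        gcongr
        exact hb ζ hζ
    _ = _ := by rw [mul_assoc, ← Real.exp_add]; ring_nf

/-- On the right, an estimate of `stableExt` with the sharp exponential rate leaves only the factor
`exp (ζ / 2)`. -/
lemma norm_stableQuotient_le_right {D : ℝ} (hD : PotentialDensity (deriv (stableTheta α)) D)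
    {C : ℝ} {ζ : ℂ} (hζ : 0 ≤ ζ.re)
    (hb : ‖stableExt α ζ‖ ≤ C * Real.exp (-(stableDelta α * (Complex.exp ζ).re))) :
    ‖stableQuotient α ζ‖ ≤
      C * Real.exp (D * ∫ τ in Ioi (0 : ℝ), logWeight τ) * Real.exp (ζ.re / 2) := by
  have h := (Complex.re_le_norm _).trans (norm_logPotential_le hD hζ)
  rw [norm_stableQuotient]
  calc _ ≤ C * Real.exp (-(stableDelta α * (Complex.exp ζ).re)) *
        Real.exp (stableDelta α * (Complex.exp ζ).re + ζ.re / 2 +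
          D * ∫ τ in Ioi (0 : ℝ), logWeight τ) := by
        gcongr
        exact (norm_nonneg _).trans hb
    _ = _ := by rw [mul_assoc, mul_assoc, ← Real.exp_add, ← Real.exp_add]; ring_nf

lemma exists_norm_stableQuotient_le_boundary (h0 : 1 / 3 < α) (h1 : α ≤ 1 / 2) :
    ∃ A, 0 ≤ A ∧ ∀ ζ : ℂ, (ζ.re ≤ 0 → ‖stableQuotient α ζ‖ ≤ A) ∧
      (0 ≤ ζ.re → (ζ.im = 0 ∨ ζ.im ∈ Icc (-Real.pi) (-(2 * Real.pi / 3))) →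
        ‖stableQuotient α ζ‖ ≤ A * Real.exp (ζ.re / 2)) := by
  have hα : 0 < α := by linarith
  obtain ⟨A₁, hA₁, h₁⟩ := exists_norm_stableQuotient_le_left h0 h1
  obtain ⟨C₂, hC₂, h₂⟩ := exists_norm_stableExt_le_real hα h1
  obtain ⟨C₃, hC₃, h₃⟩ := exists_norm_stableExt_le_sector h0 h1
  obtain ⟨D, hD⟩ := exists_potentialDensity h0 h1
  set W := Real.exp (D * ∫ τ in Ioi (0 : ℝ), logWeight τ) with hW
  have hW0 : 0 < W := Real.exp_pos _
  refine ⟨A₁ + (C₂ + C₃) * W, by positivity, fun ζ => ⟨fun h => (h₁ ζ h).trans ?_, fun hx hy => ?_⟩⟩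
  · have : 0 ≤ (C₂ + C₃) * W := by positivity
    linarith
  · have hb : ‖stableExt α ζ‖ ≤ (C₂ + C₃) * Real.exp (-(stableDelta α * (Complex.exp ζ).re)) := by
      rcases hy with hy | hy
      · obtain ⟨x, rfl⟩ : ∃ x : ℝ, ζ = x := ⟨ζ.re, Complex.ext rfl (by simpa using hy)⟩
        refine (h₂ x (by simpa using hx)).trans ?_
        rw [Complex.exp_ofReal_re]
        gcongr
        linarith
      · have := h₃ (starRingEnd ℂ ζ) (by simpa using hx)
          (by rw [Complex.conj_im]; constructor <;> linarith [hy.1, hy.2])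
        rw [norm_stableExt_conj, Complex.exp_conj, Complex.conj_re] at this
        refine this.trans ?_
        gcongr
        linarith
    refine (norm_stableQuotient_le_right hD hx hb).trans ?_
    gcongr
    linarith

/-- Growth of order `4/3 ≥ 2 (1 - α)` in `z`, the bound the Phragmén–Lindelöf principle asks for. -/
lemma exists_norm_stableQuotient_le_exp_exp (h0 : 1 / 3 < α) (h1 : α ≤ 1 / 2) :
    ∃ A B, 0 ≤ A ∧ 0 ≤ B ∧ ∀ ζ : ℂ,
      ‖stableQuotient α ζ‖ ≤ A * Real.exp (B * Real.exp (4 / 3 * |ζ.re|)) := by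
  have hα : 0 < α := by linarith
  obtain ⟨A₁, hA₁, h₁⟩ := exists_norm_stableQuotient_le_left h0 h1
  obtain ⟨D, hD⟩ := exists_potentialDensity h0 h1
  set W := D * ∫ τ in Ioi (0 : ℝ), logWeight τ with hW
  have hd := stableDelta_pos hα h1
  refine ⟨A₁ + 4 * Real.exp W, 3 / 2 + stableDelta α, by positivity, by positivity, fun ζ => ?_⟩
  set E := Real.exp (4 / 3 * |ζ.re|) with hE
  have hE0 : 0 < E := Real.exp_pos _
  rcases le_total ζ.re 0 with hx | hx
  · have h2 : 1 ≤ Real.exp ((3 / 2 + stableDelta α) * E) := Real.one_le_exp (by positivity)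
    have h3 := Real.exp_pos W
    calc _ ≤ A₁ := h₁ ζ hx
      _ ≤ (A₁ + 4 * Real.exp W) * 1 := by linarith
      _ ≤ _ := by gcongr
  · rw [abs_of_nonneg hx] at hE
    have hJ := (Complex.re_le_norm _).trans (norm_logPotential_le hD hx)
    rw [← hW] at hJ
    have e1 : Real.exp ((1 - α) * ζ.re) ≤ E := by
      rw [hE, Real.exp_le_exp]; nlinarith
    have e2 : Real.exp ((1 - α) * ζ.re) ^ 2 ≤ E := by
      rw [hE, ← Real.exp_nat_mul, Real.exp_le_exp]; push_cast; nlinarith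
    have e3 : (Complex.exp ζ).re ≤ E := by
      refine (Complex.re_le_norm _).trans ?_
      rw [Complex.norm_exp, hE, Real.exp_le_exp]; linarith
    have e4 := mul_le_mul_of_nonneg_left e3 hd.le
    rw [norm_stableQuotient]
    calc _ ≤ 4 * Real.exp (-ζ.re + (Real.exp ((1 - α) * ζ.re) +
          Real.exp ((1 - α) * ζ.re) ^ 2 / 2)) * Real.exp (stableDelta α * (Complex.exp ζ).re +
            ζ.re / 2 + (logPotential (deriv (stableTheta α)) ζ).re) := by
          gcongr
          exact norm_stableExt_le_exp_exp hα h1 ζ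
      _ ≤ 4 * Real.exp (W + (3 / 2 + stableDelta α) * E) := by
          rw [mul_assoc, ← Real.exp_add]
          exact mul_le_mul_of_nonneg_left (Real.exp_le_exp.2 (by linarith)) (by norm_num)
      _ = 4 * Real.exp W * Real.exp ((3 / 2 + stableDelta α) * E) := by rw [Real.exp_add]; ring
      _ ≤ _ := by
          gcongr
          linarith

lemma closure_im_preimage_Ioo {a b : ℝ} (hab : a < b) :
    closure (Complex.im ⁻¹' Ioo a b) = Complex.im ⁻¹' Icc a b := by
  rw [Complex.closure_preimage_im, closure_Ioo hab.ne]

lemma continuousOn_stableQuotient (h0 : 1 / 3 < α) (h1 : α ≤ 1 / 2) :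
    ContinuousOn (stableQuotient α) (Complex.im ⁻¹' Icc (-Real.pi) 0) := by
  obtain ⟨D, hD⟩ := exists_potentialDensity h0 h1
  have e1 := (differentiable_stableExt (by linarith : 0 < α) h1).continuous
  have e2 := Complex.continuous_exp.comp_continuousOn (continuousOn_logPotential hD)
  have e3 : Continuous fun ζ : ℂ => stableExt α ζ *
    Complex.exp (stableDelta α * Complex.exp ζ) * Complex.exp (ζ / 2) := by fun_prop
  exact e3.continuousOn.mul e2

lemma differentiableOn_stableQuotient (h0 : 1 / 3 < α) (h1 : α ≤ 1 / 2) :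
    DifferentiableOn ℂ (stableQuotient α) (Complex.im ⁻¹' Ioo (-Real.pi) 0) := by
  obtain ⟨D, hD⟩ := exists_potentialDensity h0 h1
  have e1 := differentiable_stableExt (by linarith : 0 < α) h1
  have e3 : Differentiable ℂ fun ζ : ℂ => stableExt α ζ *
    Complex.exp (stableDelta α * Complex.exp ζ) * Complex.exp (ζ / 2) := by fun_prop
  intro ζ hζ
  exact (e3.differentiableAt.mul
    (differentiableAt_logPotential hD hζ).cexp).differentiableWithinAt

lemma diffContOnCl_stableQuotient (h0 : 1 / 3 < α) (h1 : α ≤ 1 / 2) {a : ℝ} (ha : -Real.pi ≤ a)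
    (ha0 : a < 0) : DiffContOnCl ℂ (stableQuotient α) (Complex.im ⁻¹' Ioo a 0) := by
  refine ⟨(differentiableOn_stableQuotient h0 h1).mono (preimage_mono (Ioo_subset_Ioo_left ha)), ?_⟩
  rw [closure_im_preimage_Ioo ha0]
  exact (continuousOn_stableQuotient h0 h1).mono (preimage_mono (Icc_subset_Icc_left ha))

lemma one_le_norm_one_add {w : ℂ} (hw : 0 ≤ w.re) : 1 ≤ ‖1 + w‖ ∧ ‖w‖ ≤ ‖1 + w‖ := by
  constructor
  · refine le_trans ?_ (Complex.re_le_norm _)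
    simpa using hw
  · rw [← sq_le_sq₀ (norm_nonneg _) (norm_nonneg _), Complex.sq_norm, Complex.sq_norm,
      Complex.normSq_apply, Complex.normSq_apply, Complex.add_re, Complex.add_im, Complex.one_re,
      Complex.one_im]
    nlinarith

lemma exp_half_re_nonneg {ζ : ℂ} (hζ : ζ.im ∈ Icc (-(2 * Real.pi / 3)) 0) :
    0 ≤ (Complex.exp (ζ / 2)).re := by
  rw [Complex.exp_re, show (ζ / 2).im = ζ.im / 2 by simp]
  refine mul_nonneg (Real.exp_pos _).le (Real.cos_nonneg_of_mem_Icc ?_)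
  constructor <;> linarith [hζ.1, hζ.2, Real.pi_pos]

/-- Phragmén–Lindelöf in a strip of width `2π/3`, where growth of order below `3/2` is allowed. -/
lemma exists_norm_stableQuotient_le (h0 : 1 / 3 < α) (h1 : α ≤ 1 / 2) :
    ∃ A, 0 ≤ A ∧ ∀ ζ : ℂ, ζ.im ∈ Icc (-Real.pi) 0 →
      ‖stableQuotient α ζ‖ ≤ A * (1 + Real.exp (ζ.re / 2)) := by
  have hp := Real.pi_pos
  obtain ⟨A, hA, hbd⟩ := exists_norm_stableQuotient_le_boundary h0 h1
  obtain ⟨A', B, hA', hB, hgr⟩ := exists_norm_stableQuotient_le_exp_exp h0 h1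
  refine ⟨A, hA, fun ζ hζ => ?_⟩
  -- dividing by `1 + exp (ζ / 2)`, which has no zero here, makes the quotient bounded on the sides
  have hside : ∀ ζ : ℂ, (ζ.im = 0 ∨ ζ.im ∈ Icc (-Real.pi) (-(2 * Real.pi / 3))) →
      ‖stableQuotient α ζ‖ ≤ A ∨ ‖stableQuotient α ζ‖ ≤ A * Real.exp (ζ.re / 2) := fun ζ h =>
    (le_total ζ.re 0).imp (fun hx => (hbd ζ).1 hx) fun hx => (hbd ζ).2 hx h
  have hen (ζ : ℂ) : ‖Complex.exp (ζ / 2)‖ = Real.exp (ζ.re / 2) := by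
    rw [Complex.norm_exp]; simp
  rcases le_total ζ.im (-(2 * Real.pi / 3)) with h | h
  · have := Real.exp_pos (ζ.re / 2)
    rcases hside ζ (Or.inr ⟨hζ.1, h⟩) with h | h <;> nlinarith
  have hden : ∀ ζ : ℂ, ζ.im ∈ Icc (-(2 * Real.pi / 3)) 0 →
      1 ≤ ‖1 + Complex.exp (ζ / 2)‖ ∧ Real.exp (ζ.re / 2) ≤ ‖1 + Complex.exp (ζ / 2)‖ := by
    intro ζ hζ
    have := one_le_norm_one_add (exp_half_re_nonneg hζ)
    rwa [hen] at this
  have hline : ∀ ζ : ℂ, (ζ.im = 0 ∨ ζ.im = -(2 * Real.pi / 3)) →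
      ‖stableQuotient α ζ / (1 + Complex.exp (ζ / 2))‖ ≤ A := by
    intro ζ hζ
    have hm : ζ.im ∈ Icc (-(2 * Real.pi / 3)) 0 := by
      rcases hζ with h | h <;> rw [h] <;> constructor <;> linarith
    obtain ⟨d1, d2⟩ := hden ζ hm
    rw [norm_div, div_le_iff₀ (by linarith)]
    rcases hside ζ (hζ.imp_right fun h => by rw [h]; constructor <;> linarith) with h | h
    · nlinarith
    · exact h.trans (by gcongr)
  have hPL := PhragmenLindelof.horizontal_strip (a := -(2 * Real.pi / 3)) (b := 0) (C := A)
    (f := fun ζ => stableQuotient α ζ / (1 + Complex.exp (ζ / 2))) (z := ζ) ?_ ?_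
    (fun z hz => hline z (Or.inr hz)) (fun z hz => hline z (Or.inl hz)) h hζ.2
  · obtain ⟨d1, _⟩ := hden ζ ⟨h, hζ.2⟩
    rw [norm_div, div_le_iff₀ (by linarith)] at hPL
    refine hPL.trans ?_
    gcongr
    exact (norm_add_le _ _).trans (by rw [norm_one, hen])
  · have hne : ∀ ζ ∈ Complex.im ⁻¹' Icc (-(2 * Real.pi / 3)) 0, 1 + Complex.exp (ζ / 2) ≠ 0 := by
      intro ζ hζ h
      have := (hden ζ hζ).1
      rw [h, norm_zero] at this
      linarith
    have hq := diffContOnCl_stableQuotient h0 h1 (a := -(2 * Real.pi / 3)) (by linarith)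
      (by linarith)
    have hd : Differentiable ℂ fun ζ : ℂ => 1 + Complex.exp (ζ / 2) := by fun_prop
    refine ⟨hq.differentiableOn.div hd.differentiableOn fun ζ hζ => hne ζ ⟨hζ.1.le, hζ.2.le⟩, ?_⟩
    have hc := hq.continuousOn
    rw [closure_im_preimage_Ioo (by linarith)] at hc ⊢
    exact hc.div hd.continuous.continuousOn hne
  · refine ⟨4 / 3, ?_, B, Asymptotics.IsBigO.of_bound A' ?_⟩
    · rw [lt_div_iff₀ (by linarith)]; linarith
    · refine eventually_inf_principal.2 (Eventually.of_forall fun ζ hζ => ?_)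
      obtain ⟨d1, _⟩ := hden ζ ⟨hζ.1.le, hζ.2.le⟩
      rw [norm_div, Real.norm_of_nonneg (Real.exp_pos _).le]
      exact (div_le_self (norm_nonneg _) d1).trans (hgr ζ)

lemma stableQuotient_im_of_im_eq_zero {ζ : ℂ} (hζ : ζ.im = 0) : (stableQuotient α ζ).im = 0 := by
  have hc : starRingEnd ℂ ζ = ζ := Complex.conj_eq_iff_im.2 hζ
  have hJ : starRingEnd ℂ (logPotential (deriv (stableTheta α)) ζ) =
    logPotential (deriv (stableTheta α)) ζ :=
      Complex.conj_eq_iff_im.2 (logPotential_im_of_im_eq_zero hζ)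
  rw [← Complex.conj_eq_iff_im, stableQuotient, map_mul, map_mul, map_mul, ← Complex.exp_conj,
    ← Complex.exp_conj, ← Complex.exp_conj, hJ, map_mul, map_div₀, ← Complex.exp_conj,
    ← stableExt_conj, hc, Complex.conj_ofReal, map_ofNat]

/-- On the lower side of the cut the phases of `stableExt`, of `exp (ζ / 2)` and of the potential
cancel: this is how the density `θ'` is tied to the argument of the boundary values. -/
lemma stableQuotient_lower (h0 : 1 / 3 < α) (h1 : α ≤ 1 / 2) (x : ℝ) :
    stableQuotient α (x - Real.pi * Complex.I) =
      ((Real.sqrt (Real.exp x) * Real.exp (-(stableDelta α * Real.exp x)) *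
        ‖stableGUpper α (Real.exp x)‖ *
        Real.exp (logPotential (deriv (stableTheta α)) (x - Real.pi * Complex.I)).re : ℝ) : ℂ) := by
  obtain ⟨D, hD⟩ := exists_potentialDensity h0 h1
  have hJ := logPotential_im_of_im_eq_neg_pi hD x
  rw [integral_deriv_stableTheta_Ioi h0 h1 (Real.exp_pos x)] at hJ
  have hG := (stableGUpper_polar h0 h1 (Real.exp_pos x)).2
  have hE : stableExt α (x - Real.pi * Complex.I) =
      ‖stableGUpper α (Real.exp x)‖ *
        Complex.exp (Complex.I * Real.pi * stableTheta α (Real.exp x)) := by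
    have e : (x : ℂ) - Real.pi * Complex.I = starRingEnd ℂ (x + Real.pi * Complex.I) := by
      simp [sub_eq_add_neg]
    have e2 := stableGUpper_eq (by linarith : 0 < α) h1 (Real.exp_pos x)
    rw [Real.log_exp] at e2
    rw [e, stableExt_conj, ← e2]
    nth_rw 1 [hG]
    rw [map_mul, Complex.conj_ofReal, ← Complex.exp_conj]
    simp
  have hexp : Complex.exp (x - Real.pi * Complex.I) = -(Real.exp x : ℂ) := by
    rw [Complex.exp_sub, Complex.exp_pi_mul_I]; push_cast; ring
  have hs : Real.sqrt (Real.exp x) = Real.exp (x / 2) := by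
    rw [Real.exp_half]
  set J := logPotential (deriv (stableTheta α)) (x - Real.pi * Complex.I) with hJdef
  have hJe : J = (J.re : ℂ) +
      ((Real.pi * (1 / 2 - stableTheta α (Real.exp x)) : ℝ) : ℂ) * Complex.I := by
    rw [← hJ]; exact (Complex.re_add_im J).symm
  rw [stableQuotient, ← hJdef, hE, hexp, hs]
  nth_rw 1 [hJe]
  push_cast
  rw [mul_assoc, mul_assoc, mul_assoc, ← Complex.exp_add, ← Complex.exp_add, ← Complex.exp_add]
  rw [mul_comm (Complex.exp _ * _) (‖_‖ : ℂ), mul_assoc, mul_assoc, ← Complex.exp_add, mul_assoc,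
    ← Complex.exp_add]
  congr 2
  ring

lemma stableQuotient_im_of_im_eq_neg_pi (h0 : 1 / 3 < α) (h1 : α ≤ 1 / 2) {ζ : ℂ}
    (hζ : ζ.im = -Real.pi) : (stableQuotient α ζ).im = 0 := by
  have : ζ = (ζ.re : ℂ) - Real.pi * Complex.I := by
    apply Complex.ext <;> simp [hζ]
  rw [this, stableQuotient_lower h0 h1, Complex.ofReal_im]

lemma tendsto_stableQuotient_lower (h0 : 1 / 3 < α) (h1 : α ≤ 1 / 2) :
    Tendsto (fun x : ℝ => stableQuotient α (x - Real.pi * Complex.I)) atTop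
      (𝓝 (stableConst α)) := by
  obtain ⟨D, hD⟩ := exists_potentialDensity h0 h1
  have h2 := tendsto_logPotential_atTop hD (-Real.pi)
  have h3 := (Real.continuous_exp.tendsto _).comp ((Complex.continuous_re.tendsto _).comp h2)
  have h4 := ((tendsto_norm_stableGUpper h0 h1).comp Real.tendsto_exp_atTop).mul h3
  rw [Complex.zero_re, Real.exp_zero, mul_one] at h4
  refine ((Complex.continuous_ofReal.tendsto _).comp h4).congr fun x => ?_
  rw [stableQuotient_lower h0 h1]
  simp [sub_eq_add_neg]

/-- Phragmén–Lindelöf for `exp (c K)`, `c = ±i`, where `K` is the quotient: it is real on both sides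
of the strip, and its growth `exp (Re ζ / 2)` is below the critical `exp (Re ζ)`. -/
lemma norm_exp_mul_stableQuotient_le (h0 : 1 / 3 < α) (h1 : α ≤ 1 / 2) {c : ℂ} (hc : ‖c‖ = 1)
    (hcr : c.re = 0) {ζ : ℂ} (hζ : ζ.im ∈ Icc (-Real.pi) 0) :
    ‖Complex.exp (c * stableQuotient α ζ)‖ ≤ 1 := by
  have hp := Real.pi_pos
  obtain ⟨A, hA, hb⟩ := exists_norm_stableQuotient_le h0 h1
  have hline : ∀ ζ : ℂ, (stableQuotient α ζ).im = 0 →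
      ‖Complex.exp (c * stableQuotient α ζ)‖ ≤ 1 := by
    intro ζ h
    rw [Complex.norm_exp, Complex.mul_re, hcr, h]
    simp
  refine PhragmenLindelof.horizontal_strip (a := -Real.pi) (b := 0) (C := 1)
    (f := fun ζ => Complex.exp (c * stableQuotient α ζ)) (z := ζ) ?_ ?_
    (fun z hz => hline z (stableQuotient_im_of_im_eq_neg_pi h0 h1 hz))
    (fun z hz => hline z (stableQuotient_im_of_im_eq_zero hz)) hζ.1 hζ.2
  · have hq := diffContOnCl_stableQuotient h0 h1 le_rfl (by linarith : -Real.pi < 0)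
    exact ⟨(hq.differentiableOn.const_mul c).cexp, (hq.continuousOn.const_mul c).cexp⟩
  · refine ⟨1 / 2, ?_, 2 * A, Asymptotics.IsBigO.of_bound 1 ?_⟩
    · rw [lt_div_iff₀ (by linarith)]; linarith
    · refine eventually_inf_principal.2 (Eventually.of_forall fun ζ hζ => ?_)
      have h2 := hb ζ ⟨hζ.1.le, hζ.2.le⟩
      have h3 : Real.exp (ζ.re / 2) ≤ Real.exp (1 / 2 * |ζ.re|) :=
        Real.exp_le_exp.2 (by linarith [le_abs_self ζ.re])
      have h4 : 1 ≤ Real.exp (1 / 2 * |ζ.re|) := Real.one_le_exp (by positivity)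
      rw [Complex.norm_exp, one_mul, Real.norm_of_nonneg (Real.exp_pos _).le, Real.exp_le_exp]
      refine (Complex.re_le_norm _).trans ?_
      rw [norm_mul, hc, one_mul]
      nlinarith

lemma stableQuotient_im (h0 : 1 / 3 < α) (h1 : α ≤ 1 / 2) {ζ : ℂ}
    (hζ : ζ.im ∈ Icc (-Real.pi) 0) : (stableQuotient α ζ).im = 0 := by
  have a := norm_exp_mul_stableQuotient_le h0 h1 (c := Complex.I) (by simp) (by simp) hζ
  have b := norm_exp_mul_stableQuotient_le h0 h1 (c := -Complex.I) (by simp) (by simp) hζ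
  rw [Complex.norm_exp, Real.exp_le_one_iff] at a b
  simp at a b
  linarith

/-- A holomorphic function with real values is constant, by the open mapping theorem. -/
lemma exists_eq_of_im_eq_zero {f : ℂ → ℂ} {U : Set ℂ} (hU : IsOpen U) (hUc : IsPreconnected U)
    (hne : U.Nonempty) (hf : DifferentiableOn ℂ f U) (him : ∀ z ∈ U, (f z).im = 0) :
    ∃ w, ∀ z ∈ U, f z = w := by
  refine ((hf.analyticOnNhd hU).is_constant_or_isOpen hUc).resolve_right fun h => ?_
  obtain ⟨z, hz⟩ := hne
  obtain ⟨ε, hε, hball⟩ := Metric.isOpen_iff.1 (h U subset_rfl hU) (f z) (mem_image_of_mem f hz)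
  obtain ⟨w, hw, hfw⟩ := hball (show f z + ((ε / 2 : ℝ) : ℂ) * Complex.I ∈ Metric.ball (f z) ε by
    rw [Metric.mem_ball, dist_eq_norm, add_sub_cancel_left, norm_mul, Complex.norm_I, mul_one,
      Complex.norm_real, Real.norm_of_nonneg (by linarith)]
    linarith)
  have h1 := him w hw
  rw [hfw, Complex.add_im, him z hz, Complex.im_ofReal_mul, Complex.I_im] at h1
  linarith

lemma stableQuotient_eq (h0 : 1 / 3 < α) (h1 : α ≤ 1 / 2) {ζ : ℂ}
    (hζ : ζ.im ∈ Icc (-Real.pi) 0) : stableQuotient α ζ = stableConst α := by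
  have hp := Real.pi_pos
  obtain ⟨w, hw⟩ := exists_eq_of_im_eq_zero (f := stableQuotient α)
    (U := Complex.im ⁻¹' Ioo (-Real.pi) 0) (isOpen_Ioo.preimage Complex.continuous_im)
    ((convex_Ioo _ _).linear_preimage Complex.imLm).isPreconnected
    ⟨((-(Real.pi / 2) : ℝ) : ℂ) * Complex.I, by
      rw [mem_preimage, Complex.im_ofReal_mul, Complex.I_im, mul_one]
      constructor <;> linarith⟩
    (differentiableOn_stableQuotient h0 h1)
    (fun z hz => stableQuotient_im h0 h1 ⟨hz.1.le, hz.2.le⟩)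
  have hcl : EqOn (stableQuotient α) (fun _ => w) (Complex.im ⁻¹' Icc (-Real.pi) 0) :=
    EqOn.of_subset_closure (s := Complex.im ⁻¹' Ioo (-Real.pi) 0) (fun z hz => hw z hz)
      (continuousOn_stableQuotient h0 h1) continuousOn_const
      (preimage_mono Ioo_subset_Icc_self) (closure_im_preimage_Ioo (by linarith)).ge
  have hlim := tendsto_stableQuotient_lower h0 h1
  have hconst : (fun x : ℝ => stableQuotient α (x - Real.pi * Complex.I)) = fun _ => w := by
    ext x
    refine hcl ?_
    simp [hp.le]
  rw [hconst] at hlim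
  rw [hcl hζ, tendsto_nhds_unique tendsto_const_nhds hlim]

/-! ### The product formula -/

lemma stableExt_eq_of_im_nonpos (h0 : 1 / 3 < α) (h1 : α ≤ 1 / 2) {ζ : ℂ}
    (hζ : ζ.im ∈ Icc (-Real.pi) 0) : stableExt α ζ =
      stableConst α * Complex.exp (-(stableDelta α * Complex.exp ζ)) * Complex.exp (-(ζ / 2)) *
        Complex.exp (-logPotential (deriv (stableTheta α)) ζ) := by
  rw [← stableQuotient_eq h0 h1 hζ, stableQuotient, Complex.exp_neg, Complex.exp_neg,
    Complex.exp_neg]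
  field_simp

lemma logPotential_conj {g : ℝ → ℝ} {ζ : ℂ} (hζ : ζ.im ∈ Ioo 0 Real.pi) :
    logPotential g (starRingEnd ℂ ζ) = starRingEnd ℂ (logPotential g ζ) := by
  rw [logPotential, logPotential, ← integral_conj]
  refine setIntegral_congr_fun measurableSet_Ioi fun t ht => ?_
  have ht : 0 < t := ht
  have him : (1 + t * Complex.exp (-ζ)).im ≠ 0 := by
    rw [Complex.add_im, Complex.im_ofReal_mul, Complex.exp_im, Complex.neg_im, Real.sin_neg,
      Complex.one_im, zero_add]
    have := Real.sin_pos_of_mem_Ioo hζ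
    have h2 := mul_pos ht (mul_pos (Real.exp_pos (-ζ).re) this)
    intro h; linarith
  have harg : Complex.arg (1 + t * Complex.exp (-ζ)) ≠ Real.pi := by
    intro h; exact him (Complex.arg_eq_pi_iff.1 h).2
  rw [map_mul, Complex.conj_ofReal, ← Complex.log_conj _ harg, map_add, map_one, map_mul,
    Complex.conj_ofReal, ← Complex.exp_conj, map_neg]

lemma stableExt_eq (h0 : 1 / 3 < α) (h1 : α ≤ 1 / 2) {ζ : ℂ}
    (hζ : ζ.im ∈ Ioo (-Real.pi) Real.pi) : stableExt α ζ =
      stableConst α * Complex.exp (-(stableDelta α * Complex.exp ζ)) * Complex.exp (-(ζ / 2)) *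
        Complex.exp (-logPotential (deriv (stableTheta α)) ζ) := by
  rcases le_or_gt ζ.im 0 with h | h
  · exact stableExt_eq_of_im_nonpos h0 h1 ⟨hζ.1.le, h⟩
  · have e := stableExt_eq_of_im_nonpos h0 h1 (ζ := starRingEnd ℂ ζ)
      (by rw [Complex.conj_im]; constructor <;> linarith [hζ.2])
    rw [stableExt_conj, logPotential_conj ⟨h, hζ.2⟩] at e
    have e2 := congrArg (starRingEnd ℂ) e
    simpa only [map_mul, map_neg, map_div₀, map_ofNat, ← Complex.exp_conj, Complex.conj_conj,
      Complex.conj_ofReal] using e2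

end

theorem mainTheorem2 (α : ℝ) (hα : 1 / 3 < α) (hα' : α ≤ 1 / 2) :
    (∀ r : ℝ, 0 < r →
      Tendsto (stableG α) (𝓝[{z : ℂ | 0 < z.im}] (-(r : ℂ))) (𝓝 (stableGUpper α r)) ∧
      stableTheta α r ∈ Ioo (0 : ℝ) 1 ∧
      ∃ R : ℝ, 0 < R ∧
        stableGUpper α r = R * Complex.exp (-(Complex.I * Real.pi * stableTheta α r))) ∧
    MonotoneOn (stableTheta α) (Ioi 0) ∧
    (α < 1 / 2 → StrictMonoOn (stableTheta α) (Ioi 0)) ∧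
    Tendsto (stableTheta α) (𝓝[>] 0) (𝓝 α) ∧
    Tendsto (stableTheta α) atTop (𝓝 (1 / 2)) ∧
    DifferentiableOn ℝ (stableTheta α) (Ioi 0) ∧
    ∀ z : ℂ, z ∈ Complex.slitPlane →
      IntegrableOn
        (fun t : ℝ => Complex.log (1 + t / z) * ((deriv (stableTheta α) t : ℝ) : ℂ)) (Ioi 0) ∧
      stableG α z =
        stableConst α * Complex.exp (-(stableDelta α * z)) * z ^ (-(1 / 2) : ℂ) *
          Complex.exp (-∫ t in Ioi (0 : ℝ),
            Complex.log (1 + t / z) * ((deriv (stableTheta α) t : ℝ) : ℂ)) := by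
  have h0 : 0 < α := by linarith
  refine ⟨fun r hr => ⟨?_, stableTheta_mem_Ioo hα hα' hr, _, stableGUpper_polar hα hα' hr⟩,
    monotoneOn_stableTheta hα hα', fun h => strictMonoOn_stableTheta hα h,
    tendsto_stableTheta_zero hα hα', tendsto_stableTheta_atTop hα hα',
    fun r hr => (hasDerivAt_stableTheta hα hα' hr).differentiableAt.differentiableWithinAt,
    fun z hz => ?_⟩
  · rw [stableGUpper_eq h0 hα' hr]
    exact tendsto_stableG_upper h0 hα' hr
  · have hz0 := Complex.slitPlane_ne_zero hz
    have hinv (t : ℝ) : (t : ℂ) / z = t * Complex.exp (-Complex.log z) := by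
      rw [Complex.exp_neg, Complex.exp_log hz0, div_eq_mul_inv]
    obtain ⟨D, hD⟩ := exists_potentialDensity hα hα'
    simp only [hinv]
    refine ⟨integrableOn_logPotential hD _, ?_⟩
    have hlog : (Complex.log z).im ∈ Ioo (-Real.pi) Real.pi := by
      rw [Complex.log_im]
      exact ⟨Complex.neg_pi_lt_arg z, lt_of_le_of_ne (Complex.arg_le_pi z)
        (Complex.mem_slitPlane_iff_arg.1 hz).1⟩
    rw [stableG_eq_stableExt h0 hα' hz0, stableExt_eq hα hα' hlog, Complex.exp_log hz0,
      Complex.cpow_def_of_ne_zero hz0, logPotential]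
    congr 3
    ring
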